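/- Fix $T>0$ and let $X=(X_t)_{t\in[0,T]}$ be a centered Gaussian process on a probability space $(\Omega,\mathcal F,P)$ with continuous paths and $X_0=0$ a.s. Write $R(s,t)=\operatorname{Cov}(X_s,X_t)$ and $\gamma(t)=\operatorname{Var}(X_t)$. A *covariance measure* of $X$ is a signed Borel measure $\mu$ on $[0,T]^2$ with $\mu(]a_1,b_1]\times]a_2,b_2])=R(b_1,b_2)+R(a_1,a_2)-R(a_1,b_2)-R(b_1,a_2)$ for all rectangles in $[0,T]^2$, and null on $(\{0\}\times[0,T])\cup([0,T]\times\{0\})$ (so that $\mu([0,s]\times[0,t])=R(s,t)$). Let $L_\mu$ be the set of Borel functions $\varphi:[0,T]\to\mathbb R$ with $\|\varphi\|_{|\mathcal H|}^2:=\int_{[0,T]^2}|\varphi(u)\varphi(v)|\,d|\mu|(u,v)<\infty$, and $\langle\varphi,\psi\rangle_{\mathcal H}=\int_{[0,T]^2}\varphi(u)\psi(v)\,d\mu(u,v)$ the associated scalar product (when the integral is not absolutely convergent, it is understood as the scalar product in the completion $\mathcal H$, i.e. as the limit of the integrals of the truncations $\varphi 1_{|\varphi|\le n}$, $\psi 1_{|\psi|\le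 n}$). The Wiener integral $\varphi\mapsto\int\varphi\,dX\in L^2(\Omega)$, $\varphi\in L_\mu$, is the extension, continuous for $\|\cdot\|_{\mathcal H}$, of the linear map with $1_{]a,b]}\mapsto X_b-X_a$. A *cylindrical* variable is $F=f(\int\varphi_1dX,\dots,\int\varphi_ndX)$ with $\varphi_i\in L_\mu$ and $f:\mathbb R^n\to\mathbb R$ smooth, bounded with all its derivatives; its derivative is $DF=\sum_i\partial_if(\int\varphi_1dX,\dots,\int\varphi_ndX)\,\varphi_i$. A jointly measurable process $u=(u_s)_{s\in[0,T]}$ with $E\|u\|_{|\mathcal H|}^2<\infty$ belongs to the *Skorohod domain* $\operatorname{Dom}(\delta)$ if there is a centered $Z\in L^2(\Omega)$, measurable for the completed $\sigma$-algebra generated by $X$, with $E(FZ)=E\langle DF,u\rangle_{\mathcal H}$ for every cylindrical $F$; then $\int_0^Tu_s\,\delta X_s:=Z$, and $\int_0^tu_s\,\delta X_s:=\int_0^Tu_s1_{[0,t]}(s)\,\delta X_s$. Let $f\in C^2(\mathbb R)$ with $f''$ bounded. (i) If $X$ has a covariance measure, then $\gamma$ has bounded variation on $[0,T]$, the processes $f'(X)$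 and $f'(X)1_{[0,t]}$, $t\in[0,T]$, belong to $\operatorname{Dom}(\delta)$, and for every $t\in[0,T]$, almost surely, $$f(X_t)=f(X_0)+\int_0^tf'(X_s)\,\delta X_s+\frac12\int_0^tf''(X_s)\,d\gamma(s),$$ the last integral being a Lebesgue–Stieltjes integral. (ii) In particular, let $X$ be a continuous bifractional Brownian motion with $H\in(0,1)$, $K\in(0,1]$ and $2HK=1$, i.e. $R(s,t)=2^{-K}\big((t^{2H}+s^{2H})^K-|t-s|^{2HK}\big)$. Then $X$ has a covariance measure, $f'(X)$ and all $f'(X)1_{[0,t]}$ belong to $\operatorname{Dom}(\delta)$, and for every $t\in[0,T]$, almost surely, the Itô formula of Brownian motion holds: $$f(X_t)=f(X_0)+\int_0^tf'(X_s)\,\delta X_s+\frac12\int_0^tf''(X_s)\,ds .$$ -/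

import Mathlib

open MeasureTheory ProbabilityTheory Set Filter
open scoped ENNReal Topology

namespace SkorohodIto

instance instCompactIccSpaceInterval {T : ℝ} : CompactIccSpace (Icc (0 : ℝ) T) where
  isCompact_Icc := fun {_ _} => IsClosed.isCompact isClosed_Icc

/-- A centered Gaussian process on `[0,T]` with continuous paths, starting from zero. -/
structure IsContinuousCenteredGaussian {T : ℝ} {Ω : Type*} [MeasurableSpace Ω]
    (X : Icc (0 : ℝ) T → Ω → ℝ) (P : Measure Ω) : Prop where
  measurable : ∀ t, Measurable (X t)
  gaussian : IsGaussianProcess X P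
  centered : ∀ t, ∫ ω, X t ω ∂P = 0
  continuous_paths : ∀ ω, Continuous fun t => X t ω
  start_zero : ∀ t : Icc (0 : ℝ) T, (t : ℝ) = 0 → ∀ᵐ ω ∂P, X t ω = 0

/-- The increment of a function of two variables over `]a₁,b₁] × ]a₂,b₂]`. -/
def planarIncrement {α : Type*} (R : α → α → ℝ) (a₁ b₁ a₂ b₂ : α) : ℝ :=
  R b₁ b₂ + R a₁ a₂ - R a₁ b₂ - R b₁ a₂

/-- `μ` is the covariance measure of `X`: a signed Borel measure on `[0,T]²` whose value on every
rectangle `]a₁,b₁] × ]a₂,b₂]` is the planar increment of the covariance function. These rectangles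
do not meet the axes, where the covariance of a process starting from zero vanishes; there the
measure is null, so that `μ ([0,s] × [0,t]) = Cov (X s, X t)`. -/
structure IsCovarianceMeasure {T : ℝ} {Ω : Type*} [MeasurableSpace Ω]
    (X : Icc (0 : ℝ) T → Ω → ℝ) (P : Measure Ω)
    (μ : SignedMeasure (Icc (0 : ℝ) T × Icc (0 : ℝ) T)) : Prop where
  rectangle : ∀ a₁ b₁ a₂ b₂ : Icc (0 : ℝ) T, a₁ ≤ b₁ → a₂ ≤ b₂ →
    μ (Ioc a₁ b₁ ×ˢ Ioc a₂ b₂) = planarIncrement (fun s t => cov[X s, X t; P]) a₁ b₁ a₂ b₂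
  axes : μ.variation {p | (p.1 : ℝ) = 0 ∨ (p.2 : ℝ) = 0} = 0

/-- The square of `‖φ‖_{|H|}`, i.e. `∫∫ |φ(u)| |φ(v)| d|μ|(u,v)`. -/
noncomputable def absNormSq {T : ℝ} (μ : SignedMeasure (Icc (0 : ℝ) T × Icc (0 : ℝ) T))
    (φ : Icc (0 : ℝ) T → ℝ) : ℝ≥0∞ :=
  ∫⁻ p, ‖φ p.1‖ₑ * ‖φ p.2‖ₑ ∂μ.variation

/-- The class `L_μ` of Borel functions on `[0,T]` with `‖φ‖_{|H|} < ∞`. -/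
def MemLMu {T : ℝ} (μ : SignedMeasure (Icc (0 : ℝ) T × Icc (0 : ℝ) T))
    (φ : Icc (0 : ℝ) T → ℝ) : Prop :=
  Measurable φ ∧ absNormSq μ φ < ∞

/-- The scalar product `⟨φ, ψ⟩_H` of two elements of `L_μ` in its completion `H`: the integral
`∫∫ φ(u) ψ(v) dμ(u,v)` whenever it converges absolutely (`innerH_eq_integral`), in particular for
bounded functions. Absolute convergence can fail for unbounded `φ ≠ ψ` in `L_μ`; the scalar
product of `H` is then the limit along the truncations `φ 1_{|φ| ≤ n}`, `ψ 1_{|ψ| ≤ n}`, which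
converge to `φ` and `ψ` for `‖·‖_{|H|}`. -/
noncomputable def innerH {T : ℝ} (μ : SignedMeasure (Icc (0 : ℝ) T × Icc (0 : ℝ) T))
    (φ ψ : Icc (0 : ℝ) T → ℝ) : ℝ :=
  limUnder atTop fun n : ℕ => ∫ᵛ p, truncation φ n p.1 * truncation ψ n p.2 ∂•μ

/-- The squared distance `‖φ - ψ‖_H²`, expanded by bilinearity. -/
noncomputable def distSqH {T : ℝ} (μ : SignedMeasure (Icc (0 : ℝ) T × Icc (0 : ℝ) T))
    (φ ψ : Icc (0 : ℝ) T → ℝ) : ℝ :=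
  innerH μ φ φ - 2 * innerH μ φ ψ + innerH μ ψ ψ

/-- Elementary integrands `∑ cᵢ 1_{]aᵢ,bᵢ]}`. -/
structure Elementary (T : ℝ) where
  n : ℕ
  coeff : Fin n → ℝ
  left : Fin n → Icc (0 : ℝ) T
  right : Fin n → Icc (0 : ℝ) T
  left_le_right : ∀ i, left i ≤ right i

/-- The function `∑ cᵢ 1_{]aᵢ,bᵢ]}`. -/
noncomputable def Elementary.toFun {T : ℝ} (S : Elementary T) (s : Icc (0 : ℝ) T) : ℝ :=
  ∑ i, (Ioc (S.left i) (S.right i)).indicator (fun _ => S.coeff i) s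

/-- The integral `∑ cᵢ (X_{bᵢ} - X_{aᵢ})` of an elementary integrand. -/
def Elementary.integral {T : ℝ} {Ω : Type*} (S : Elementary T) (X : Icc (0 : ℝ) T → Ω → ℝ)
    (ω : Ω) : ℝ :=
  ∑ i, S.coeff i * (X (S.right i) ω - X (S.left i) ω)

/-- `I` is (a version of) the Wiener integral `∫ φ dX`: the extension of the integral of
elementary functions that is continuous from the seminorm of `H` to `L²(Ω)`. -/
def IsWienerIntegral {T : ℝ} {Ω : Type*} [MeasurableSpace Ω] (X : Icc (0 : ℝ) T → Ω → ℝ)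
    (P : Measure Ω) (μ : SignedMeasure (Icc (0 : ℝ) T × Icc (0 : ℝ) T))
    (φ : Icc (0 : ℝ) T → ℝ) (I : Ω → ℝ) : Prop :=
  MemLp I 2 P ∧ ∃ S : ℕ → Elementary T,
    Tendsto (fun k => distSqH μ (S k).toFun φ) atTop (𝓝 0) ∧
    Tendsto (fun k => eLpNorm (fun ω => (S k).integral X ω - I ω) 2 P) atTop (𝓝 0)

/-- The class `C_b^∞(ℝⁿ)`: smooth functions, bounded together with all their derivatives. -/
def IsSmoothBounded {n : ℕ} (f : (Fin n → ℝ) → ℝ) : Prop :=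
  ContDiff ℝ ((⊤ : ℕ∞) : WithTop ℕ∞) f ∧ ∀ k : ℕ, ∃ C : ℝ, ∀ x, ‖iteratedFDeriv ℝ k f x‖ ≤ C

/-- A smooth cylindrical random variable `f (∫ φ₁ dX, …, ∫ φₙ dX)`, with `f ∈ C_b^∞(ℝⁿ)` and
`φᵢ ∈ L_μ`. -/
structure Cyl {T : ℝ} {Ω : Type*} [MeasurableSpace Ω] (X : Icc (0 : ℝ) T → Ω → ℝ)
    (P : Measure Ω) (μ : SignedMeasure (Icc (0 : ℝ) T × Icc (0 : ℝ) T)) where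
  n : ℕ
  f : (Fin n → ℝ) → ℝ
  smooth : IsSmoothBounded f
  φ : Fin n → Icc (0 : ℝ) T → ℝ
  mem : ∀ i, MemLMu μ (φ i)
  wiener : Fin n → Ω → ℝ
  isWiener : ∀ i, IsWienerIntegral X P μ (φ i) (wiener i)

namespace Cyl

variable {T : ℝ} {Ω : Type*} [MeasurableSpace Ω] {X : Icc (0 : ℝ) T → Ω → ℝ}
  {P : Measure Ω} {μ : SignedMeasure (Icc (0 : ℝ) T × Icc (0 : ℝ) T)}

/-- The random variable `F = f (∫ φ₁ dX, …, ∫ φₙ dX)`. -/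
def value (F : Cyl X P μ) (ω : Ω) : ℝ := F.f fun i => F.wiener i ω

/-- `∂ᵢ f (∫ φ₁ dX, …, ∫ φₙ dX)`, the coefficient of `φᵢ` in the Malliavin derivative
`DF = ∑ᵢ ∂ᵢ f (∫ φ₁ dX, …, ∫ φₙ dX) φᵢ`. -/
noncomputable def derivCoeff (F : Cyl X P μ) (i : Fin F.n) (ω : Ω) : ℝ :=
  fderiv ℝ F.f (fun j => F.wiener j ω) (Pi.single i 1)

/-- `⟨DF, u⟩_H = ∑ᵢ ∂ᵢ f (∫ φ₁ dX, …, ∫ φₙ dX) ⟨φᵢ, u⟩_H` for a process `u`. -/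
noncomputable def innerDeriv (F : Cyl X P μ) (u : Icc (0 : ℝ) T → Ω → ℝ) (ω : Ω) : ℝ :=
  ∑ i, F.derivCoeff i ω * innerH μ (F.φ i) fun s => u s ω

end Cyl

/-- `Z` is (a version of) the Skorohod integral of `u` with respect to `X`: a centered
square integrable random variable, measurable for the completed `σ`-algebra generated by `X`, with
`E (F Z) = E ⟨DF, u⟩_H` for every smooth cylindrical `F`. -/
structure IsSkorohodIntegral {T : ℝ} {Ω : Type*} [MeasurableSpace Ω] (X : Icc (0 : ℝ) T → Ω → ℝ)
    (P : Measure Ω) (μ : SignedMeasure (Icc (0 : ℝ) T × Icc (0 : ℝ) T))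
    (u : Icc (0 : ℝ) T → Ω → ℝ) (Z : Ω → ℝ) : Prop where
  memLp : MemLp Z 2 P
  aestronglyMeasurable :
    AEStronglyMeasurable[⨆ t, MeasurableSpace.comap (X t) (borel ℝ)] Z P
  centered : ∫ ω, Z ω ∂P = 0
  duality : ∀ F : Cyl X P μ, ∫ ω, F.value ω * Z ω ∂P = ∫ ω, F.innerDeriv u ω ∂P

/-- The domain of the Skorohod integral: processes `u ∈ L²(Ω; L_μ)`, i.e. with
`E ‖u‖²_{|H|} < ∞`, that have a Skorohod integral. -/
def MemSkorohodDomain {T : ℝ} {Ω : Type*} [MeasurableSpace Ω] (X : Icc (0 : ℝ) T → Ω → ℝ)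
    (P : Measure Ω) (μ : SignedMeasure (Icc (0 : ℝ) T × Icc (0 : ℝ) T))
    (u : Icc (0 : ℝ) T → Ω → ℝ) : Prop :=
  Measurable (Function.uncurry u) ∧ ∫⁻ ω, absNormSq μ (fun s => u s ω) ∂P < ∞ ∧
    ∃ Z, IsSkorohodIntegral X P μ u Z

open scoped Classical in
/-- The Skorohod integral `∫_0^T u δX` (zero outside the domain). -/
noncomputable def skorohodIntegral {T : ℝ} {Ω : Type*} [MeasurableSpace Ω]
    (X : Icc (0 : ℝ) T → Ω → ℝ) (P : Measure Ω)
    (μ : SignedMeasure (Icc (0 : ℝ) T × Icc (0 : ℝ) T)) (u : Icc (0 : ℝ) T → Ω → ℝ) : Ω → ℝ :=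
  if h : MemSkorohodDomain X P μ u then h.2.2.choose else 0

/-- The process `u 1_{[0,t]}`, so that `∫_0^t u δX = ∫_0^T u 1_{[0,t]} δX`. -/
noncomputable def stopAt {T : ℝ} {Ω : Type*} (u : Icc (0 : ℝ) T → Ω → ℝ) (t : Icc (0 : ℝ) T) :
    Icc (0 : ℝ) T → Ω → ℝ :=
  (Iic t).indicator u

/-- Lebesgue measure on `[0,T]`. -/
noncomputable def lebesgue (T : ℝ) : Measure (Icc (0 : ℝ) T) :=
  (volume : Measure ℝ).comap Subtype.val

/-- The covariance function of the bifractional Brownian motion with parameters `H` and `K`. -/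
noncomputable def bifractionalCovariance (H K s t : ℝ) : ℝ :=
  ((t ^ (2 * H) + s ^ (2 * H)) ^ K - |t - s| ^ (2 * H * K)) / 2 ^ K

theorem innerH_eq_integral {T : ℝ} (μ : SignedMeasure (Icc (0 : ℝ) T × Icc (0 : ℝ) T))
    {φ ψ : Icc (0 : ℝ) T → ℝ} (hφ : Measurable φ) (hψ : Measurable ψ)
    (h : Integrable (fun p : Icc (0 : ℝ) T × Icc (0 : ℝ) T => φ p.1 * ψ p.2) μ.variation) :
    innerH μ φ ψ = ∫ᵛ p, φ p.1 * ψ p.2 ∂•μ := by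
  have key : ∀ (g : Icc (0 : ℝ) T → ℝ) (s : Icc (0 : ℝ) T),
      ∀ᶠ n : ℕ in atTop, truncation g n s = g s := by
    intro g s
    obtain ⟨N, hN⟩ := exists_nat_gt |g s|
    filter_upwards [eventually_ge_atTop N] with n hn
    exact truncation_eq_self (hN.trans_le (by exact_mod_cast hn))
  refine Tendsto.limUnder_eq ?_
  refine tendsto_setToFun_of_dominated_convergence _ (fun p => ‖φ p.1 * ψ p.2‖) ?_ h.norm ?_ ?_
  · intro n
    have m : ∀ g : Icc (0 : ℝ) T → ℝ, Measurable g → Measurable (truncation g n) := fun g hg =>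
      (measurable_id.indicator measurableSet_Ioc).comp hg
    exact (((m φ hφ).comp measurable_fst).mul
      ((m ψ hψ).comp measurable_snd)).aestronglyMeasurable
  · intro n
    refine ae_of_all _ fun p => ?_
    rw [norm_mul, norm_mul]
    gcongr
    · exact abs_truncation_le_abs_self _ _ _
    · exact abs_truncation_le_abs_self _ _ _
  · refine ae_of_all _ fun p => tendsto_const_nhds.congr' ?_
    filter_upwards [key φ p.1, key ψ p.2] with n h₁ h₂
    rw [h₁, h₂]

end SkorohodIto

/-! ### Signs of signed measures; functions with infinitesimal increments -/

namespace SkorohodIto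

/-! The formula itself forces the candidate for the Skorohod integral: Z = f(X_t) - f(X_0) - ½ ∫_0^t
f''(X_s) dγ(s) (`itoRemainder`). It remains to check that Z is square integrable, centered,
measurable for the σ-algebra of X and dual to the derivative, and that these properties determine it
almost surely (`IsSkorohodIntegral.ae_eq`).

For G = g(∫ φ_1 dX, …, ∫ φ_n dX) with elementary φ_j, duality is a formula for E(G f(X_t)) - E(G
f(X_0)) (`integral_mul_comp_sub_eq`). It is a fundamental theorem of calculus in t that needs no
differentiability of γ. Over ]a,b], differentiate E(G f(X_a + θ(X_b - X_a))) in θ. Gaussian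
integration by parts (`integral_mul_comp_of_hasGaussianLaw`) replaces the factor X_b - X_a by
covariances, which are masses of μ, and leaves ∑_j ⟨φ_j, 1_{]a,b]}⟩ E(∂_j g f') + (⟨1_{[0,a]},
1_{]a,b]}⟩ + θ ⟨1_{]a,b]}, 1_{]a,b]}⟩) E(G f''). Integrated over θ in [0,1], the coefficient of E(G
f'') is half of μ{a < max(u,v) ≤ b}, by the symmetry of μ. The expectations are continuous in a, b,
θ, so freezing them costs at most ε times the |μ|-mass of strips; these masses add up over a
partition, and the total error vanishes with ε (`eq_of_abs_sub_le_mul`).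

Symmetry and positivity of the form of μ are inherited from the covariance: elementary functions are
dense in L² of the marginals of |μ|, where the form is continuous (`tendsto_form`). The resulting
Cauchy–Schwarz inequality gives a meaning to ⟨φ, u⟩_H for φ in L_μ and bounded u, and carries
duality from elementary integrands to all cylindrical variables (`duality_of_elementary`). Since
γ(t) = μ{max(u,v) ≤ t}, the function γ has bounded variation and dγ is the image of μ under the
maximum (`vectorMeasure_variance`). This turns ∫∫ f''(X_{max(u,v)}) dμ into the Stieltjes integral.

When 2HK = 1, the term -|t - s| of the bifractional covariance contributes twice the Lebesgue
measure on the diagonal. The other term is homogeneous of degree one, so its t-derivative is a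
function of s/t, decreasing because K ≤ 1; its mixed increments are therefore minus those of a
positive finite measure, the law of (τξ, τ) for τ uniform and ξ with a fixed distribution
(`scaleMeasure`). As γ(t) = t, part (i) gives the classical formula. -/

instance isFiniteMeasure_variation {α : Type*} [MeasurableSpace α] (μ : SignedMeasure α) :
    IsFiniteMeasure μ.variation := by
  rw [← SignedMeasure.totalVariation_eq_variation]
  unfold SignedMeasure.totalVariation
  infer_instance

theorem integral_lsmul_toSignedMeasure {α : Type*} [MeasurableSpace α] (μ : Measure α)
    [IsFiniteMeasure μ] (f : α → ℝ) : ∫ᵛ x, f x ∂•μ.toSignedMeasure = ∫ x, f x ∂μ := by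
  rw [← VectorMeasure.integral_toSignedMeasure]
  congr 1
  ext
  simp

/-- A signed measure has a sign with respect to its variation. -/
theorem exists_sign {α : Type*} [MeasurableSpace α] (μ : SignedMeasure α) :
    ∃ σ : α → ℝ, Measurable σ ∧ (∀ x, |σ x| ≤ 1) ∧
      (∀ f : α → ℝ, Integrable f μ.variation →
        ∫ᵛ x, f x ∂•μ = ∫ x, f x * σ x ∂μ.variation) ∧
      ∀ A, MeasurableSet A → μ A = ∫ x in A, σ x ∂μ.variation := by
  classical
  set j := μ.toJordanDecomposition with hj
  have hvar : μ.variation = j.posPart + j.negPart := by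
    rw [← SignedMeasure.totalVariation_eq_variation]; rfl
  have hμ : μ = j.posPart.toSignedMeasure - j.negPart.toSignedMeasure :=
    μ.toSignedMeasure_toJordanDecomposition.symm
  -- `S` is null for the positive part and its complement for the negative part, so the sign is -1
  -- on `S` and 1 elsewhere.
  obtain ⟨S, hS, hpos, hneg⟩ := j.mutuallySingular
  have hp : ∀ᵐ x ∂j.posPart, x ∉ S := measure_eq_zero_iff_ae_notMem.mp hpos
  have hn : ∀ᵐ x ∂j.negPart, x ∉ Sᶜ := measure_eq_zero_iff_ae_notMem.mp hneg
  have key : ∀ f : α → ℝ, Integrable f μ.variation →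
      ∫ x, f x * (if x ∈ S then -1 else 1) ∂μ.variation
        = ∫ x, f x ∂j.posPart - ∫ x, f x ∂j.negPart := by
    intro f hf
    rw [hvar] at hf ⊢
    have h1 : (fun x => f x * (if x ∈ S then -1 else 1)) =ᵐ[j.posPart] f := by
      filter_upwards [hp] with x hx
      simp [hx]
    have h2 : (fun x => f x * (if x ∈ S then -1 else 1)) =ᵐ[j.negPart] fun x => - f x := by
      filter_upwards [hn] with x hx
      have : x ∈ S := by simpa using hx
      simp [this]
    rw [integral_add_measure, integral_congr_ae h1, integral_congr_ae h2, integral_neg,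
      sub_eq_add_neg]
    · exact (hf.left_of_add_measure).congr h1.symm
    · exact (hf.right_of_add_measure).neg.congr h2.symm
  refine ⟨fun x => if x ∈ S then -1 else 1, Measurable.ite hS measurable_const measurable_const,
    fun x => ?_, fun f hf => ?_, fun A hA => ?_⟩
  · by_cases hx : x ∈ S <;> simp [hx]
  · rw [key f hf]
    conv_lhs => rw [hμ]
    rw [hvar] at hf
    rw [VectorMeasure.integral_sub_vectorMeasure, integral_lsmul_toSignedMeasure,
      integral_lsmul_toSignedMeasure]
    · simpa [VectorMeasure.Integrable] using hf.left_of_add_measure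
    · simpa [VectorMeasure.Integrable] using hf.right_of_add_measure
  · have := key (A.indicator fun _ => 1) ((integrable_const _).indicator hA)
    rw [integral_indicator_const _ hA, integral_indicator_const _ hA] at this
    conv_lhs => rw [hμ]
    rw [Measure.toSignedMeasure_sub_apply hA, ← integral_indicator hA]
    simp only [smul_eq_mul, mul_one] at this
    rw [← this]
    congr 1
    ext x
    by_cases hx : x ∈ A <;> simp [hx]

/-- A function on `[0,T]` whose increments over short intervals are infinitesimal with respect to
those of a fixed function is constant. -/
theorem eq_of_abs_sub_le_mul {T : ℝ} (D M : Icc (0 : ℝ) T → ℝ)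
    (h : ∀ ε > 0, ∃ δ > 0, ∀ a b : Icc (0 : ℝ) T, a ≤ b → (b : ℝ) - a < δ →
      |D b - D a| ≤ ε * (M b - M a)) {s t : Icc (0 : ℝ) T} (hst : s ≤ t) : D s = D t := by
  have key : ∀ ε > 0, |D t - D s| ≤ ε * (M t - M s) := by
    intro ε hε
    obtain ⟨δ, hδ, H⟩ := h ε hε
    obtain ⟨N, hN⟩ := exists_nat_gt (((t : ℝ) - s) / δ)
    have hst' : (s : ℝ) ≤ t := hst
    have hNpos : (0 : ℝ) < N := lt_of_le_of_lt (div_nonneg (by linarith) hδ.le) hN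
    -- Equidistant points with mesh below δ. The minimum with `t` keeps them in the interval for
    -- every `i`, so that the induction needs no bound `i ≤ N`.
    have hmem : ∀ i : ℕ, min ((s : ℝ) + i * ((t - s) / N)) t ∈ Icc (0 : ℝ) T := by
      intro i
      have h0 : 0 ≤ (i : ℝ) * ((t - s) / N) :=
        mul_nonneg (Nat.cast_nonneg _) (div_nonneg (by linarith) hNpos.le)
      refine ⟨le_min (by linarith [s.2.1]) t.2.1, (min_le_right _ _).trans t.2.2⟩
    let p : ℕ → Icc (0 : ℝ) T := fun i => ⟨_, hmem i⟩
    have hp0 : p 0 = s := by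
      apply Subtype.ext
      simp [p, hst']
    have hpN : p N = t := by
      apply Subtype.ext
      simp only [p]
      rw [mul_div_cancel₀ _ hNpos.ne']
      simp
    have hstep : ∀ i, p i ≤ p (i + 1) ∧ (p (i + 1) : ℝ) - p i < δ := by
      intro i
      have h1 : ((t : ℝ) - s) / N < δ := by
        rw [div_lt_iff₀ hNpos]
        rw [div_lt_iff₀ hδ] at hN
        linarith
      have h0 : 0 ≤ ((t : ℝ) - s) / N := div_nonneg (by linarith) hNpos.le
      have e : (s : ℝ) + ((i + 1 : ℕ) : ℝ) * ((t - s) / N)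
          = ((s : ℝ) + i * ((t - s) / N)) + (t - s) / N := by push_cast; ring
      constructor
      · change min ((s : ℝ) + i * ((t - s) / N)) t ≤ min ((s : ℝ) + (i + 1 : ℕ) * ((t - s) / N)) t
        rw [e]
        exact min_le_min_right _ (by linarith)
      · change min ((s : ℝ) + (i + 1 : ℕ) * ((t - s) / N)) t - min ((s : ℝ) + i * ((t - s) / N)) t < δ
        rw [e]
        rcases le_total ((s : ℝ) + i * ((t - s) / N)) t with h' | h'
        · rw [min_eq_left h']
          linarith [min_le_left ((s : ℝ) + i * ((t - s) / N) + (t - s) / N) t]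
        · rw [min_eq_right h']
          linarith [min_le_right ((s : ℝ) + i * ((t - s) / N) + (t - s) / N) t]
    have tele : ∀ n, |D (p n) - D (p 0)| ≤ ε * (M (p n) - M (p 0)) := by
      intro n
      induction n with
      | zero => simp
      | succ n ih =>
        have := H _ _ (hstep n).1 (hstep n).2
        calc |D (p (n + 1)) - D (p 0)|
            ≤ |D (p (n + 1)) - D (p n)| + |D (p n) - D (p 0)| := abs_sub_le _ _ _
          _ ≤ _ := by linarith
    simpa [hp0, hpN] using tele N
  have hlim : Tendsto (fun ε : ℝ => ε * (M t - M s)) (𝓝[>] 0) (𝓝 (0 * (M t - M s))) :=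
    (tendsto_id.mul_const _).mono_left nhdsWithin_le_nhds
  rw [zero_mul] at hlim
  have := ge_of_tendsto hlim (eventually_nhdsWithin_of_forall key)
  have h0 : D t - D s = 0 := by simpa using le_antisymm this (abs_nonneg _)
  linarith

end SkorohodIto

/-! ### Gaussian integration by parts -/

namespace SkorohodIto

theorem hasDerivAt_gaussianPDFReal (v : NNReal) (x : ℝ) :
    HasDerivAt (gaussianPDFReal 0 v) (-(x / v) * gaussianPDFReal 0 v x) x := by
  unfold gaussianPDFReal
  have h1 : HasDerivAt (fun x : ℝ => -(x - 0) ^ 2 / (2 * v)) (-(x / v)) x := by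
    have := (((hasDerivAt_id x).sub_const 0).pow 2).neg.div_const (2 * (v : ℝ))
    convert! this using 1
    simp only [id, Nat.cast_ofNat, sub_zero]
    -- For zero variance both sides vanish by the convention on division by zero.
    by_cases hv : (v : ℝ) = 0
    · simp [hv]
    · field_simp
      simp
  convert! (h1.exp.const_mul ((√(2 * Real.pi * v))⁻¹)) using 1
  ring

/-- Integration by parts for a centered Gaussian measure on the line. -/
theorem integral_id_mul_gaussianReal {v : NNReal} (hv : v ≠ 0) {q q' : ℝ → ℝ}
    (hq : ∀ x, HasDerivAt q (q' x) x) (h0 : Integrable q (gaussianReal 0 v))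
    (h1 : Integrable (fun x => x * q x) (gaussianReal 0 v))
    (h2 : Integrable q' (gaussianReal 0 v)) :
    ∫ x, x * q x ∂gaussianReal 0 v = v * ∫ x, q' x ∂gaussianReal 0 v := by
  have hv' : (v : ℝ) ≠ 0 := by exact_mod_cast hv
  have conv : ∀ {g : ℝ → ℝ}, Integrable g (gaussianReal 0 v) →
      Integrable (fun x => gaussianPDFReal 0 v x * g x) := by
    intro g hg
    rw [gaussianReal_of_var_ne_zero _ hv] at hg
    have := (integrable_withDensity_iff_integrable_smul₀' (measurable_gaussianPDF 0 v).aemeasurable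
      (ae_of_all _ fun x => gaussianPDF_lt_top)).mp hg
    simpa [toReal_gaussianPDF] using this
  rw [integral_gaussianReal_eq_integral_smul hv, integral_gaussianReal_eq_integral_smul hv]
  have ibp := integral_mul_deriv_eq_deriv_mul_of_integrable (u := q) (u' := q')
    (v := gaussianPDFReal 0 v) (v' := fun x => -(x / v) * gaussianPDFReal 0 v x)
    (fun x _ => hq x) (fun x _ => hasDerivAt_gaussianPDFReal v x) ?_ ?_ ?_
  · have e : ∀ x, gaussianPDFReal 0 v x • (x * q x)
        = -v * (q x * (-(x / v) * gaussianPDFReal 0 v x)) := by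
      intro x
      rw [smul_eq_mul]
      field_simp
    simp_rw [e]
    rw [integral_const_mul, ibp]
    simp only [smul_eq_mul]
    rw [mul_neg, neg_mul, neg_neg]
    congr 2
    ext x
    ring
  · refine ((conv h1).const_mul (-(v : ℝ)⁻¹)).congr (ae_of_all _ fun x => ?_)
    simp only [Pi.mul_apply]
    field_simp
  · refine (conv h2).congr (ae_of_all _ fun x => ?_)
    simp [mul_comm]
  · refine (conv h0).congr (ae_of_all _ fun x => ?_)
    simp [mul_comm]

/-- A differentiable function whose derivative has linear growth has quadratic growth. -/
theorem abs_le_of_norm_fderiv_le {E : Type*} [NormedAddCommGroup E] [NormedSpace ℝ E]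
    {ψ : E → ℝ} (hψ : ContDiff ℝ 1 ψ) {C : ℝ} (hC : ∀ x, ‖fderiv ℝ ψ x‖ ≤ C * (1 + ‖x‖)) (x : E) :
    |ψ x| ≤ |ψ 0| + C * (1 + ‖x‖) * ‖x‖ := by
  have hC0 : 0 ≤ C := by
    have := (norm_nonneg _).trans (hC 0)
    simpa using this
  have := (convex_closedBall (0 : E) ‖x‖).norm_image_sub_le_of_norm_fderiv_le (𝕜 := ℝ) (f := ψ)
    (C := C * (1 + ‖x‖)) (fun y _ => (hψ.differentiable one_ne_zero).differentiableAt)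
    (fun y hy => (hC y).trans ?_) (x := 0) (y := x) (by simp) (by simp)
  · rw [sub_zero, Real.norm_eq_abs] at this
    calc |ψ x| = |ψ 0 + (ψ x - ψ 0)| := by ring_nf
      _ ≤ |ψ 0| + |ψ x - ψ 0| := abs_add_le _ _
      _ ≤ _ := by linarith
  · have : ‖y‖ ≤ ‖x‖ := by simpa using hy
    gcongr

/-- Integration by parts for jointly Gaussian variables: if `V` is centered and `c` represents the
covariance of `V` with `W`, then `E (V ψ(W)) = E (∂_c ψ(W))`. -/
theorem integral_mul_comp_of_hasGaussianLaw {Ω E : Type*} [MeasurableSpace Ω] {P : Measure Ω}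
    [IsProbabilityMeasure P] [NormedAddCommGroup E] [NormedSpace ℝ E] [FiniteDimensional ℝ E]
    [MeasurableSpace E] [BorelSpace E] {V : Ω → ℝ} {W : Ω → E}
    (h : HasGaussianLaw (fun ω => (V ω, W ω)) P) (hV : ∫ ω, V ω ∂P = 0) (c : E)
    (hc : ∀ L : StrongDual ℝ E, cov[V, fun ω => L (W ω); P] = L c) {ψ : E → ℝ}
    (hψ : ContDiff ℝ 1 ψ) {C : ℝ} (hC : ∀ x, ‖fderiv ℝ ψ x‖ ≤ C * (1 + ‖x‖)) :
    ∫ ω, V ω * ψ (W ω) ∂P = ∫ ω, fderiv ℝ ψ (W ω) c ∂P := by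
  have : CompleteSpace E := FiniteDimensional.complete ℝ E
  have hVg : HasGaussianLaw V P := h.fst
  have hC0 : 0 ≤ C := by
    have := (norm_nonneg _).trans (hC 0)
    simpa using this
  -- If V is degenerate, it vanishes almost surely and so does the covariance vector `c`; both sides
  -- are zero.
  by_cases hvar : Var[V; P] = 0
  · have hV0 : V =ᵐ[P] fun _ => 0 := by
      have h2 : evariance V P = 0 := by
        rw [← ofReal_variance hVg.memLp_two, hvar, ENNReal.ofReal_zero]
      have := (evariance_eq_zero_iff hVg.aemeasurable).mp h2
      rwa [hV] at this
    have hc0 : c = 0 := by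
      refine SeparatingDual.eq_zero_of_forall_dual_eq_zero (R := ℝ) fun L => ?_
      rw [← hc L]
      refine integral_eq_zero_of_ae ?_
      filter_upwards [hV0] with ω hω
      simp [hω, hV]
    rw [hc0]
    simp only [map_zero, integral_zero]
    refine integral_eq_zero_of_ae ?_
    filter_upwards [hV0] with ω hω
    simp [hω]
  set v : NNReal := Var[V; P].toNNReal with hv
  have hvR : (v : ℝ) = Var[V; P] := Real.coe_toNNReal _ (variance_nonneg _ _)
  have hv0 : (v : ℝ) ≠ 0 := by rwa [hvR]
  have hv1 : v ≠ 0 := by exact_mod_cast hv0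
  have hmapV : P.map V = gaussianReal 0 v := by rw [hVg.map_eq_gaussianReal, hV]
  -- Gaussian regression: the residual of W on V is uncorrelated with V, hence independent of it.
  -- Given the residual, W is an affine function of V alone, and the one-dimensional formula
  -- applies.
  set W' : Ω → E := fun ω => W ω - ((v : ℝ)⁻¹ * V ω) • c with hW'
  have hVm : AEMeasurable V P := hVg.aemeasurable
  have hWm : AEMeasurable W P := h.snd.aemeasurable
  have hjoint : HasGaussianLaw (fun ω => (V ω, W' ω)) P := by
    let L : ℝ × E →L[ℝ] ℝ × E := (ContinuousLinearMap.fst ℝ ℝ E).prod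
      (ContinuousLinearMap.snd ℝ ℝ E
        - ((v : ℝ)⁻¹ • ContinuousLinearMap.fst ℝ ℝ E).smulRight c)
    convert! h.map L using 1
  have hindep : IndepFun V W' P := by
    apply hjoint.indepFun_of_covariance_strongDual
    intro L₁ L₂
    have e1 : (L₁ ∘ V) = fun ω => L₁ 1 * V ω := by
      ext ω
      have := L₁.map_smul (V ω) 1
      simp only [smul_eq_mul, mul_one] at this
      simp [this, mul_comm]
    have e2 : (L₂ ∘ W') = fun ω => L₂ (W ω) - (v : ℝ)⁻¹ * L₂ c * V ω := by
      ext ω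
      simp [hW']
      ring
    have hLW : MemLp (fun ω => L₂ (W ω)) 2 P := (h.snd.map_fun L₂).memLp_two
    rw [e1, e2, covariance_const_mul_left, covariance_fun_sub_right hVg.memLp_two hLW
      (hVg.memLp_two.const_mul _), covariance_const_mul_right, hc, covariance_self hVm, ← hvR]
    field_simp
    simp
  have hprod : P.map (fun ω => (V ω, W' ω)) = (gaussianReal 0 v).prod (P.map W') := by
    rw [(indepFun_iff_map_prod_eq_prod_map_map hVm hjoint.snd.aemeasurable).mp hindep, hmapV]
  set ρ := P.map W' with hρ
  have : IsProbabilityMeasure ρ := P.isProbabilityMeasure_map hjoint.snd.aemeasurable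
  let A : ℝ × E → E := fun p => p.2 + ((v : ℝ)⁻¹ * p.1) • c
  have hA : Continuous A := by fun_prop
  have hAW : ∀ ω, A (V ω, W' ω) = W ω := fun ω => by simp [A, hW']
  have transfer : ∀ g : ℝ × E → ℝ, Continuous g →
      (Integrable (fun ω => g (V ω, W' ω)) P ↔ Integrable g ((gaussianReal 0 v).prod ρ)) ∧
      ∫ ω, g (V ω, W' ω) ∂P = ∫ p, g p ∂((gaussianReal 0 v).prod ρ) := by
    intro g hg
    rw [← hprod]
    exact ⟨(integrable_map_measure hg.aestronglyMeasurable hjoint.aemeasurable).symm,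
      (integral_map hjoint.aemeasurable hg.aestronglyMeasurable).symm⟩
  have hψc : Continuous ψ := hψ.continuous
  have hdc : Continuous (fun x => fderiv ℝ ψ x c) :=
    (hψ.continuous_fderiv one_ne_zero).clm_apply continuous_const
  have hZ : ∀ n : ℕ, n ≠ 0 → Integrable (fun ω => ‖(V ω, W ω)‖ ^ n) P := fun n hn =>
    (h.memLp (by simp : ((n : ℕ) : ℝ≥0∞) ≠ ∞)).integrable_norm_pow hn
  -- ψ grows quadratically and V ψ(W) cubically, so one cubic polynomial of the norm, integrable by
  -- the moments of Gaussian laws, dominates all three integrands.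
  have bound : Integrable (fun ω => (1 + ‖(V ω, W ω)‖) ^ 3 * (|ψ 0| + C + C * ‖c‖)) P := by
    apply Integrable.mul_const
    have e : ∀ ω, (1 + ‖(V ω, W ω)‖) ^ 3 = 1 + 3 * ‖(V ω, W ω)‖ ^ 1 + 3 * ‖(V ω, W ω)‖ ^ 2
      + ‖(V ω, W ω)‖ ^ 3 := fun ω => by ring
    simp_rw [e]
    exact (((integrable_const _).add ((hZ 1 one_ne_zero).const_mul 3)).add
      ((hZ 2 two_ne_zero).const_mul 3)).add (hZ 3 three_ne_zero)
  have poly : ∀ z a b d : ℝ, 0 ≤ z → 0 ≤ a → 0 ≤ b → 0 ≤ d →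
      a + b * (1 + z) * z ≤ (1 + z) ^ 3 * (a + b + b * d) ∧
      z * (a + b * (1 + z) * z) ≤ (1 + z) ^ 3 * (a + b + b * d) ∧
      b * (1 + z) * d ≤ (1 + z) ^ 3 * (a + b + b * d) := by
    intro z a b d hz ha hb hd
    have hbd := mul_nonneg hb hd
    refine ⟨?_, ?_, ?_⟩
    all_goals
      rw [← sub_nonneg]
      ring_nf
      positivity
  have hψb : ∀ ω, |ψ (W ω)| ≤ |ψ 0| + C * (1 + ‖(V ω, W ω)‖) * ‖(V ω, W ω)‖ := by
    intro ω
    refine (abs_le_of_norm_fderiv_le hψ hC _).trans ?_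
    have : ‖W ω‖ ≤ ‖(V ω, W ω)‖ := norm_snd_le (V ω, W ω)
    gcongr
  have hWms : AEStronglyMeasurable W P := hWm.aestronglyMeasurable
  have i0 : Integrable (fun ω => ψ (W ω)) P := by
    refine bound.mono' (hψc.comp_aestronglyMeasurable hWms) (ae_of_all _ fun ω => ?_)
    exact (hψb ω).trans (poly _ _ _ _ (norm_nonneg _) (abs_nonneg _) hC0 (norm_nonneg _)).1
  have i1 : Integrable (fun ω => V ω * ψ (W ω)) P := by
    refine bound.mono' (hVm.aestronglyMeasurable.mul (hψc.comp_aestronglyMeasurable hWms))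
      (ae_of_all _ fun ω => ?_)
    have : ‖V ω‖ ≤ ‖(V ω, W ω)‖ := norm_fst_le (V ω, W ω)
    rw [norm_mul]
    refine (mul_le_mul this (hψb ω) (abs_nonneg _) (norm_nonneg _)).trans ?_
    exact (poly _ _ _ _ (norm_nonneg _) (abs_nonneg _) hC0 (norm_nonneg _)).2.1
  have i2 : Integrable (fun ω => fderiv ℝ ψ (W ω) c) P := by
    refine bound.mono' (hdc.comp_aestronglyMeasurable hWms) (ae_of_all _ fun ω => ?_)
    have : ‖W ω‖ ≤ ‖(V ω, W ω)‖ := norm_snd_le (V ω, W ω)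
    refine ((fderiv ℝ ψ (W ω)).le_opNorm c).trans ?_
    refine le_trans ?_ (poly ‖(V ω, W ω)‖ _ _ _ (norm_nonneg _) (abs_nonneg _) hC0
      (norm_nonneg c)).2.2
    gcongr
    exact (hC _).trans (by gcongr)
  have T0 := transfer (fun p => ψ (A p)) (hψc.comp hA)
  have T1 := transfer (fun p => p.1 * ψ (A p)) (continuous_fst.mul (hψc.comp hA))
  have T2 := transfer (fun p => fderiv ℝ ψ (A p) c) (hdc.comp hA)
  simp only [hAW] at T0 T1 T2
  rw [T1.2, T2.2]
  have j0 := (T0.1.mp i0)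
  have j1 := (T1.1.mp i1)
  have j2 := (T2.1.mp i2)
  rw [integral_prod_symm _ j1, integral_prod_symm _ j2]
  apply integral_congr_ae
  filter_upwards [j0.prod_left_ae, j1.prod_left_ae, j2.prod_left_ae] with w k0 k1 k2
  -- The factor `v⁻¹` of this chain rule cancels the variance in the one-dimensional formula.
  have hder : ∀ x, HasDerivAt (fun x => ψ (A (x, w))) ((v : ℝ)⁻¹ * fderiv ℝ ψ (A (x, w)) c) x := by
    intro x
    have hl : HasDerivAt (fun x : ℝ => A (x, w)) ((v : ℝ)⁻¹ • c) x := by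
      have := (((hasDerivAt_id x).const_mul (v : ℝ)⁻¹).smul_const c).const_add w
      simpa [A] using this
    have := ((hψ.differentiable one_ne_zero) (A (x, w))).hasFDerivAt.comp_hasDerivAt x hl
    rw [map_smul, smul_eq_mul] at this
    exact this
  rw [integral_id_mul_gaussianReal hv1 hder k0 k1 (k2.const_mul _), integral_const_mul]
  field_simp

end SkorohodIto

/-! ### The bilinear form of a signed measure on a square -/

namespace SkorohodIto

/-- Scalar products converge along sequences that converge in `L²`. -/
theorem tendsto_integral_mul_of_tendsto_eLpNorm {α ι : Type*} [MeasurableSpace α] {m : Measure α}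
    {l : Filter ι} {f g : ι → α → ℝ} {f₀ g₀ : α → ℝ} (hf : ∀ i, MemLp (f i) 2 m)
    (hg : ∀ i, MemLp (g i) 2 m) (hf₀ : MemLp f₀ 2 m) (hg₀ : MemLp g₀ 2 m)
    (h₁ : Tendsto (fun i => eLpNorm (fun x => f i x - f₀ x) 2 m) l (𝓝 0))
    (h₂ : Tendsto (fun i => eLpNorm (fun x => g i x - g₀ x) 2 m) l (𝓝 0)) :
    Tendsto (fun i => ∫ x, f i x * g i x ∂m) l (𝓝 (∫ x, f₀ x * g₀ x ∂m)) := by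
  have conv : ∀ {f g : α → ℝ} (hf : MemLp f 2 m) (hg : MemLp g 2 m),
      ∫ x, f x * g x ∂m = inner ℝ (hg.toLp g) (hf.toLp f) := by
    intro f g hf hg
    rw [L2.inner_def]
    apply integral_congr_ae
    filter_upwards [hf.coeFn_toLp, hg.coeFn_toLp] with x h1 h2
    simp [h1, h2]
  have t1 : Tendsto (fun i => (hf i).toLp (f i)) l (𝓝 (hf₀.toLp f₀)) :=
    (Lp.tendsto_Lp_iff_tendsto_eLpNorm'' f hf f₀ hf₀).mpr h₁
  have t2 : Tendsto (fun i => (hg i).toLp (g i)) l (𝓝 (hg₀.toLp g₀)) :=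
    (Lp.tendsto_Lp_iff_tendsto_eLpNorm'' g hg g₀ hg₀).mpr h₂
  rw [conv hf₀ hg₀]
  simp_rw [fun i => conv (hf i) (hg i)]
  exact t2.inner t1

/-- The sign of a signed measure with respect to its variation. -/
noncomputable def signDensity {α : Type*} [MeasurableSpace α] (μ : SignedMeasure α) : α → ℝ :=
  (exists_sign μ).choose

section signDensity

variable {α : Type*} [MeasurableSpace α] (μ : SignedMeasure α)

theorem measurable_signDensity : Measurable (signDensity μ) := (exists_sign μ).choose_spec.1

theorem abs_signDensity_le (x : α) : |signDensity μ x| ≤ 1 := (exists_sign μ).choose_spec.2.1 x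

theorem integral_eq_integral_signDensity {f : α → ℝ} (hf : Integrable f μ.variation) :
    ∫ᵛ x, f x ∂•μ = ∫ x, f x * signDensity μ x ∂μ.variation :=
  (exists_sign μ).choose_spec.2.2.1 f hf

theorem apply_eq_setIntegral_signDensity {A : Set α} (hA : MeasurableSet A) :
    μ A = ∫ x in A, signDensity μ x ∂μ.variation :=
  (exists_sign μ).choose_spec.2.2.2 A hA

theorem integrable_mul_signDensity {f : α → ℝ} (hf : Integrable f μ.variation) :
    Integrable (fun x => f x * signDensity μ x) μ.variation :=
  hf.mul_bdd (c := 1) (measurable_signDensity μ).aestronglyMeasurable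
    (ae_of_all _ fun x => abs_signDensity_le μ x)

theorem abs_integral_mul_signDensity_le {f : α → ℝ} (hf : Integrable f μ.variation) :
    |∫ x, f x * signDensity μ x ∂μ.variation| ≤ ∫ x, |f x| ∂μ.variation := by
  rw [← Real.norm_eq_abs]
  refine norm_integral_le_of_norm_le hf.abs (ae_of_all _ fun x => ?_)
  rw [norm_mul]
  exact mul_le_of_le_one_right (norm_nonneg _) (abs_signDensity_le μ x)

end signDensity

/-- Bounded measurable functions. -/
structure IsBoundedMeasurable {α : Type*} [MeasurableSpace α] (φ : α → ℝ) : Prop where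
  measurable : Measurable φ
  bounded : ∃ C, ∀ s, |φ s| ≤ C

namespace IsBoundedMeasurable

variable {α : Type*} [MeasurableSpace α] {φ ψ : α → ℝ}

theorem sub (hφ : IsBoundedMeasurable φ) (hψ : IsBoundedMeasurable ψ) :
    IsBoundedMeasurable (fun s => φ s - ψ s) := by
  obtain ⟨C, hC⟩ := hφ.bounded
  obtain ⟨D, hD⟩ := hψ.bounded
  exact ⟨hφ.measurable.sub hψ.measurable, C + D, fun s =>
    (abs_sub _ _).trans (add_le_add (hC s) (hD s))⟩

theorem add (hφ : IsBoundedMeasurable φ) (hψ : IsBoundedMeasurable ψ) :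
    IsBoundedMeasurable (fun s => φ s + ψ s) := by
  obtain ⟨C, hC⟩ := hφ.bounded
  obtain ⟨D, hD⟩ := hψ.bounded
  exact ⟨hφ.measurable.add hψ.measurable, C + D, fun s =>
    (abs_add_le _ _).trans (add_le_add (hC s) (hD s))⟩

theorem mul (hφ : IsBoundedMeasurable φ) (hψ : IsBoundedMeasurable ψ) :
    IsBoundedMeasurable (fun s => φ s * ψ s) := by
  obtain ⟨C, hC⟩ := hφ.bounded
  obtain ⟨D, hD⟩ := hψ.bounded
  refine ⟨hφ.measurable.mul hψ.measurable, C * D, fun s => ?_⟩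
  rw [abs_mul]
  exact mul_le_mul (hC s) (hD s) (abs_nonneg _) ((abs_nonneg _).trans (hC s))

theorem const (c : ℝ) : IsBoundedMeasurable (fun _ : α => c) :=
  ⟨measurable_const, |c|, fun _ => le_rfl⟩

theorem const_mul (hφ : IsBoundedMeasurable φ) (c : ℝ) :
    IsBoundedMeasurable (fun s => c * φ s) := (const c).mul hφ

theorem indicator (hφ : IsBoundedMeasurable φ) {A : Set α} (hA : MeasurableSet A) :
    IsBoundedMeasurable (A.indicator φ) := by
  obtain ⟨C, hC⟩ := hφ.bounded
  refine ⟨hφ.measurable.indicator hA, C, fun s => ?_⟩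
  by_cases hs : s ∈ A
  · simpa [hs] using hC s
  · simpa [hs] using (abs_nonneg _).trans (hC s)

theorem sum {ι : Type*} (t : Finset ι) {φ : ι → α → ℝ} (h : ∀ i, IsBoundedMeasurable (φ i)) :
    IsBoundedMeasurable (fun s => ∑ i ∈ t, φ i s) := by
  classical
  induction t using Finset.induction_on with
  | empty => simpa using const 0
  | insert i t hi ih => simpa [Finset.sum_insert hi] using (h i).add ih

theorem comp {β : Type*} [MeasurableSpace β] {g : β → α} (hφ : IsBoundedMeasurable φ)
    (hg : Measurable g) : IsBoundedMeasurable (fun x => φ (g x)) :=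
  ⟨hφ.measurable.comp hg, hφ.bounded.imp fun _ h s => h (g s)⟩

theorem memLp (hφ : IsBoundedMeasurable φ) (m : Measure α) [IsFiniteMeasure m] (p : ℝ≥0∞) :
    MemLp φ p m := by
  obtain ⟨C, hC⟩ := hφ.bounded
  exact MemLp.of_bound hφ.measurable.aestronglyMeasurable C (ae_of_all _ hC)

theorem integrable (hφ : IsBoundedMeasurable φ) (m : Measure α) [IsFiniteMeasure m] :
    Integrable φ m := memLp_one_iff_integrable.mp (hφ.memLp m 1)

end IsBoundedMeasurable

/-- The sum of the marginals of the variation of a signed measure on a square. -/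
noncomputable def marginal {α : Type*} [MeasurableSpace α] (μ : SignedMeasure (α × α)) :
    Measure α :=
  μ.variation.map Prod.fst + μ.variation.map Prod.snd

/-- The integral `∫∫ φ(u) ψ(v) dμ(u,v)`, written with the variation of `μ`. -/
noncomputable def form {α : Type*} [MeasurableSpace α] (μ : SignedMeasure (α × α))
    (φ ψ : α → ℝ) : ℝ :=
  ∫ p, φ p.1 * (ψ p.2 * signDensity μ p) ∂μ.variation

section form

variable {α : Type*} [MeasurableSpace α] {μ : SignedMeasure (α × α)}

instance : IsFiniteMeasure (marginal μ) := by
  unfold marginal; infer_instance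

theorem IsBoundedMeasurable.prod {φ ψ : α → ℝ} (hφ : IsBoundedMeasurable φ)
    (hψ : IsBoundedMeasurable ψ) : IsBoundedMeasurable fun p : α × α => φ p.1 * ψ p.2 :=
  (hφ.comp measurable_fst).mul (hψ.comp measurable_snd)

theorem form_eq_integral {φ ψ : α → ℝ} (hφ : IsBoundedMeasurable φ)
    (hψ : IsBoundedMeasurable ψ) : form μ φ ψ = ∫ᵛ p, φ p.1 * ψ p.2 ∂•μ := by
  rw [integral_eq_integral_signDensity μ ((hφ.prod hψ).integrable _), form]
  simp_rw [mul_assoc]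

theorem isBoundedMeasurable_form_integrand {φ ψ : α → ℝ} (hφ : IsBoundedMeasurable φ)
    (hψ : IsBoundedMeasurable ψ) :
    IsBoundedMeasurable fun p : α × α => φ p.1 * (ψ p.2 * signDensity μ p) :=
  (hφ.comp measurable_fst).mul ((hψ.comp measurable_snd).mul
    ⟨measurable_signDensity μ, 1, abs_signDensity_le μ⟩)

theorem form_add_left {φ φ' ψ : α → ℝ} (hφ : IsBoundedMeasurable φ)
    (hφ' : IsBoundedMeasurable φ') (hψ : IsBoundedMeasurable ψ) :
    form μ (fun s => φ s + φ' s) ψ = form μ φ ψ + form μ φ' ψ := by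
  unfold form
  rw [← integral_add ((isBoundedMeasurable_form_integrand hφ hψ).integrable _)
    ((isBoundedMeasurable_form_integrand hφ' hψ).integrable _)]
  simp_rw [add_mul]

theorem form_sub_left {φ φ' ψ : α → ℝ} (hφ : IsBoundedMeasurable φ)
    (hφ' : IsBoundedMeasurable φ') (hψ : IsBoundedMeasurable ψ) :
    form μ (fun s => φ s - φ' s) ψ = form μ φ ψ - form μ φ' ψ := by
  unfold form
  rw [← integral_sub ((isBoundedMeasurable_form_integrand hφ hψ).integrable _)
    ((isBoundedMeasurable_form_integrand hφ' hψ).integrable _)]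
  simp_rw [sub_mul]

theorem form_add_right {φ ψ ψ' : α → ℝ} (hφ : IsBoundedMeasurable φ)
    (hψ : IsBoundedMeasurable ψ) (hψ' : IsBoundedMeasurable ψ') :
    form μ φ (fun s => ψ s + ψ' s) = form μ φ ψ + form μ φ ψ' := by
  unfold form
  rw [← integral_add ((isBoundedMeasurable_form_integrand hφ hψ).integrable _)
    ((isBoundedMeasurable_form_integrand hφ hψ').integrable _)]
  simp_rw [add_mul, mul_add]

theorem form_sub_right {φ ψ ψ' : α → ℝ} (hφ : IsBoundedMeasurable φ)
    (hψ : IsBoundedMeasurable ψ) (hψ' : IsBoundedMeasurable ψ') :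
    form μ φ (fun s => ψ s - ψ' s) = form μ φ ψ - form μ φ ψ' := by
  unfold form
  rw [← integral_sub ((isBoundedMeasurable_form_integrand hφ hψ).integrable _)
    ((isBoundedMeasurable_form_integrand hφ hψ').integrable _)]
  simp_rw [sub_mul, mul_sub]

theorem form_const_mul_left (c : ℝ) (φ ψ : α → ℝ) :
    form μ (fun s => c * φ s) ψ = c * form μ φ ψ := by
  unfold form
  rw [← integral_const_mul]
  simp_rw [mul_assoc]

theorem form_const_mul_right (c : ℝ) (φ ψ : α → ℝ) :
    form μ φ (fun s => c * ψ s) = c * form μ φ ψ := by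
  unfold form
  rw [← integral_const_mul]
  congr 1
  ext p
  ring

theorem form_zero_left (ψ : α → ℝ) : form μ (fun _ => 0) ψ = 0 := by simp [form]

theorem form_zero_right (φ : α → ℝ) : form μ φ (fun _ => 0) = 0 := by simp [form]

theorem form_sum_left {ι : Type*} (t : Finset ι) {φ : ι → α → ℝ} {ψ : α → ℝ}
    (hφ : ∀ i, IsBoundedMeasurable (φ i)) (hψ : IsBoundedMeasurable ψ) :
    form μ (fun s => ∑ i ∈ t, φ i s) ψ = ∑ i ∈ t, form μ (φ i) ψ := by
  classical
  induction t using Finset.induction_on with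
  | empty => simpa using form_zero_left ψ
  | insert i t hi ih =>
    simp_rw [Finset.sum_insert hi]
    rw [form_add_left (hφ i) (IsBoundedMeasurable.sum t hφ) hψ, ih]

theorem form_sum_right {ι : Type*} (t : Finset ι) {φ : α → ℝ} {ψ : ι → α → ℝ}
    (hφ : IsBoundedMeasurable φ) (hψ : ∀ i, IsBoundedMeasurable (ψ i)) :
    form μ φ (fun s => ∑ i ∈ t, ψ i s) = ∑ i ∈ t, form μ φ (ψ i) := by
  classical
  induction t using Finset.induction_on with
  | empty => simpa using form_zero_right φ
  | insert i t hi ih =>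
    simp_rw [Finset.sum_insert hi]
    rw [form_add_right hφ (hψ i) (IsBoundedMeasurable.sum t hψ), ih]

theorem form_indicator {A B : Set α} (hA : MeasurableSet A) (hB : MeasurableSet B) (c d : ℝ) :
    form μ (A.indicator fun _ => c) (B.indicator fun _ => d) = c * d * μ (A ×ˢ B) := by
  rw [apply_eq_setIntegral_signDensity μ (hA.prod hB), ← integral_indicator (hA.prod hB),
    ← integral_const_mul, form]
  congr 1
  ext ⟨u, v⟩
  by_cases hu : u ∈ A <;> by_cases hv : v ∈ B <;> simp [hu, hv, mul_assoc]

theorem MemLp.comp_fst_marginal {φ : α → ℝ} (h : MemLp φ 2 (marginal μ)) :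
    MemLp (fun p : α × α => φ p.1) 2 μ.variation :=
  ((h.mono_measure (Measure.le_add_right le_rfl)).comp_of_map measurable_fst.aemeasurable)

theorem MemLp.comp_snd_marginal {φ : α → ℝ} (h : MemLp φ 2 (marginal μ)) :
    MemLp (fun p : α × α => φ p.2) 2 μ.variation :=
  ((h.mono_measure (Measure.le_add_left le_rfl)).comp_of_map measurable_snd.aemeasurable)

theorem eLpNorm_comp_fst_le {φ : α → ℝ} (h : MemLp φ 2 (marginal μ)) :
    eLpNorm (fun p : α × α => φ p.1) 2 μ.variation ≤ eLpNorm φ 2 (marginal μ) := by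
  have h1 : MemLp φ 2 (μ.variation.map Prod.fst) := h.mono_measure (Measure.le_add_right le_rfl)
  have := eLpNorm_map_measure (p := 2) h1.1 measurable_fst.aemeasurable
  rw [Function.comp_def] at this
  rw [← this]
  exact eLpNorm_mono_measure _ (Measure.le_add_right le_rfl)

theorem eLpNorm_comp_snd_le {φ : α → ℝ} (h : MemLp φ 2 (marginal μ)) :
    eLpNorm (fun p : α × α => φ p.2) 2 μ.variation ≤ eLpNorm φ 2 (marginal μ) := by
  have h1 : MemLp φ 2 (μ.variation.map Prod.snd) := h.mono_measure (Measure.le_add_left le_rfl)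
  have := eLpNorm_map_measure (p := 2) h1.1 measurable_snd.aemeasurable
  rw [Function.comp_def] at this
  rw [← this]
  exact eLpNorm_mono_measure _ (Measure.le_add_left le_rfl)

/-- The form is continuous for the norm of `L²` of the marginal. -/
theorem tendsto_form {ι : Type*} {l : Filter ι} {φ ψ : ι → α → ℝ} {φ₀ ψ₀ : α → ℝ}
    (hφ : ∀ i, MemLp (φ i) 2 (marginal μ)) (hψ : ∀ i, MemLp (ψ i) 2 (marginal μ))
    (hφ₀ : MemLp φ₀ 2 (marginal μ)) (hψ₀ : MemLp ψ₀ 2 (marginal μ))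
    (h₁ : Tendsto (fun i => eLpNorm (fun x => φ i x - φ₀ x) 2 (marginal μ)) l (𝓝 0))
    (h₂ : Tendsto (fun i => eLpNorm (fun x => ψ i x - ψ₀ x) 2 (marginal μ)) l (𝓝 0)) :
    Tendsto (fun i => form μ (φ i) (ψ i)) l (𝓝 (form μ φ₀ ψ₀)) := by
  have hs : ∀ {ψ : α → ℝ}, MemLp ψ 2 (marginal μ) →
      MemLp (fun p : α × α => ψ p.2 * signDensity μ p) 2 μ.variation := by
    intro ψ h
    refine (MemLp.comp_snd_marginal h).mono ((MemLp.comp_snd_marginal h).1.mul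
      (measurable_signDensity μ).aestronglyMeasurable) (ae_of_all _ fun p => ?_)
    rw [norm_mul]
    exact mul_le_of_le_one_right (norm_nonneg _) (abs_signDensity_le μ p)
  have e₁ : ∀ i, eLpNorm (fun p : α × α => φ i p.1 - φ₀ p.1) 2 μ.variation
      ≤ eLpNorm (fun x => φ i x - φ₀ x) 2 (marginal μ) := fun i =>
    eLpNorm_comp_fst_le (φ := fun x => φ i x - φ₀ x) ((hφ i).sub hφ₀)
  have e₂ : ∀ i, eLpNorm (fun p : α × α => ψ i p.2 * signDensity μ p - ψ₀ p.2 * signDensity μ p)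
      2 μ.variation ≤ eLpNorm (fun x => ψ i x - ψ₀ x) 2 (marginal μ) := fun i => by
    refine (eLpNorm_mono (g := fun p : α × α => ψ i p.2 - ψ₀ p.2) fun p => ?_).trans
      (eLpNorm_comp_snd_le (φ := fun x => ψ i x - ψ₀ x) ((hψ i).sub hψ₀))
    rw [← sub_mul, norm_mul]
    exact mul_le_of_le_one_right (norm_nonneg _) (abs_signDensity_le μ p)
  -- The form is the L²(|μ|) scalar product of φ(u) and ψ(v)σ(u,v), with |σ| ≤ 1; both norms are
  -- bounded by those in L² of the marginal sum.
  exact tendsto_integral_mul_of_tendsto_eLpNorm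
    (f := fun i (p : α × α) => φ i p.1) (f₀ := fun p => φ₀ p.1)
    (g := fun i (p : α × α) => ψ i p.2 * signDensity μ p)
    (g₀ := fun p => ψ₀ p.2 * signDensity μ p) (fun i => MemLp.comp_fst_marginal (hφ i))
    (fun i => hs (hψ i)) (MemLp.comp_fst_marginal hφ₀) (hs hψ₀)
    (tendsto_of_tendsto_of_tendsto_of_le_of_le tendsto_const_nhds h₁ (fun _ => zero_le) e₁)
    (tendsto_of_tendsto_of_tendsto_of_le_of_le tendsto_const_nhds h₂ (fun _ => zero_le) e₂)

end form

end SkorohodIto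

/-! ### Elementary integrands: isometry, density, positivity of the form -/

namespace SkorohodIto

variable {T : ℝ} {Ω : Type*} [MeasurableSpace Ω] {X : Icc (0 : ℝ) T → Ω → ℝ}
  {P : Measure Ω} {μ : SignedMeasure (Icc (0 : ℝ) T × Icc (0 : ℝ) T)}

theorem Elementary.isBoundedMeasurable (S : Elementary T) : IsBoundedMeasurable S.toFun :=
  IsBoundedMeasurable.sum _ fun _ => (IsBoundedMeasurable.const _).indicator measurableSet_Ioc

/-- The elementary integrand `1_{]a,b]}`. -/
noncomputable def Elementary.single (a b : Icc (0 : ℝ) T) (h : a ≤ b) : Elementary T where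
  n := 1
  coeff _ := 1
  left _ := a
  right _ := b
  left_le_right _ := h

theorem Elementary.single_toFun (a b : Icc (0 : ℝ) T) (h : a ≤ b) :
    (Elementary.single a b h).toFun = (Ioc a b).indicator fun _ => 1 := by
  ext s
  exact Fin.sum_univ_one _

omit [MeasurableSpace Ω] in
theorem Elementary.single_integral (a b : Icc (0 : ℝ) T) (h : a ≤ b) (ω : Ω) :
    (Elementary.single a b h).integral X ω = X b ω - X a ω := by
  refine (Fin.sum_univ_one _).trans ?_
  exact one_mul _

theorem IsContinuousCenteredGaussian.memLp (hX : IsContinuousCenteredGaussian X P)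
    (t : Icc (0 : ℝ) T) : MemLp (X t) 2 P :=
  (hX.gaussian.hasGaussianLaw_eval t).memLp_two

theorem Elementary.memLp_integral (S : Elementary T) (hX : IsContinuousCenteredGaussian X P) :
    MemLp (S.integral X) 2 P :=
  memLp_finsetSum _ fun i _ =>
    ((hX.memLp (S.right i)).sub (hX.memLp (S.left i))).const_mul (S.coeff i)

theorem Elementary.measurable_integral (S : Elementary T)
    (hX : IsContinuousCenteredGaussian X P) : Measurable (S.integral X) :=
  Finset.measurable_sum _ fun i _ =>
    ((hX.measurable (S.right i)).sub (hX.measurable (S.left i))).const_mul (S.coeff i)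

theorem Elementary.integral_integral [IsProbabilityMeasure P] (S : Elementary T)
    (hX : IsContinuousCenteredGaussian X P) : ∫ ω, S.integral X ω ∂P = 0 := by
  have hi : ∀ t, Integrable (X t) P := fun t => (hX.memLp t).integrable one_le_two
  have hd : ∀ a b, Integrable (fun ω => X b ω - X a ω) P := fun a b => (hi b).sub (hi a)
  unfold Elementary.integral
  rw [integral_finsetSum _ fun i _ => (hd _ _).const_mul _]
  refine Finset.sum_eq_zero fun i _ => ?_
  rw [integral_const_mul, integral_sub (hi _) (hi _), hX.centered, hX.centered]
  simp

/-- The integrals of elementary integrands form a Gaussian process. -/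
theorem isGaussianProcess_integral (hX : IsContinuousCenteredGaussian X P) :
    IsGaussianProcess (fun S : Elementary T => S.integral X) P := by
  classical
  refine hX.gaussian.of_isGaussianProcess fun S => ?_
  let I : Finset (Icc (0 : ℝ) T) := Finset.univ.image S.left ∪ Finset.univ.image S.right
  have hl : ∀ i, S.left i ∈ I := fun i => by simp [I]
  have hr : ∀ i, S.right i ∈ I := fun i => by simp [I]
  refine ⟨I, ∑ i, S.coeff i • (ContinuousLinearMap.proj (R := ℝ) (φ := fun _ : I => ℝ)
    ⟨S.right i, hr i⟩ - ContinuousLinearMap.proj (R := ℝ) (φ := fun _ : I => ℝ)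
    ⟨S.left i, hl i⟩), fun ω => ?_⟩
  simp [Elementary.integral]

/-- The isometry between elementary integrands and their integrals. -/
theorem form_elementary [IsProbabilityMeasure P] (hX : IsContinuousCenteredGaussian X P)
    (hμ : IsCovarianceMeasure X P μ) (S S' : Elementary T) :
    form μ S.toFun S'.toFun = cov[S.integral X, S'.integral X; P] := by
  have hb : ∀ (a b : Icc (0 : ℝ) T) (c : ℝ),
      IsBoundedMeasurable ((Ioc a b).indicator fun _ => c) := fun a b c =>
    (IsBoundedMeasurable.const _).indicator measurableSet_Ioc
  have hm : ∀ a b, MemLp (fun ω => X b ω - X a ω) 2 P := fun a b => (hX.memLp b).sub (hX.memLp a)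
  change form μ (fun s => ∑ i, _) (fun s => ∑ i, _)
    = cov[fun ω => ∑ i, S.coeff i * (X (S.right i) ω - X (S.left i) ω),
      fun ω => ∑ i, S'.coeff i * (X (S'.right i) ω - X (S'.left i) ω); P]
  rw [covariance_fun_sum_fun_sum (fun i => (hm _ _).const_mul _) (fun i => (hm _ _).const_mul _),
    form_sum_left _ (fun i => hb _ _ _) (IsBoundedMeasurable.sum _ fun i => hb _ _ _)]
  refine Finset.sum_congr rfl fun i _ => ?_
  rw [form_sum_right _ (hb _ _ _) (fun i => hb _ _ _)]
  refine Finset.sum_congr rfl fun j _ => ?_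
  rw [form_indicator measurableSet_Ioc measurableSet_Ioc,
    hμ.rectangle _ _ _ _ (S.left_le_right i) (S'.left_le_right j),
    covariance_const_mul_left, covariance_const_mul_right,
    covariance_fun_sub_fun_sub (hX.memLp _) (hX.memLp _) (hX.memLp _) (hX.memLp _)]
  unfold planarIncrement
  ring

/-- Elementary functions vanish at 0, so their density in L² requires that the marginals do not
charge this point. -/
theorem marginal_singleton_zero (hμ : IsCovarianceMeasure X P μ) :
    marginal μ {s | (s : ℝ) = 0} = 0 := by
  have hm : MeasurableSet {s : Icc (0 : ℝ) T | (s : ℝ) = 0} :=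
    measurableSet_eq_fun measurable_subtype_coe measurable_const
  simp only [marginal, Measure.add_apply, Measure.map_apply measurable_fst hm,
    Measure.map_apply measurable_snd hm, add_eq_zero]
  exact ⟨measure_mono_null (fun p hp => Or.inl hp) hμ.axes,
    measure_mono_null (fun p hp => Or.inr hp) hμ.axes⟩

/-- Uniform approximation of a continuous function on `]0,T]` by elementary functions. -/
theorem exists_elementary_abs_sub_le (hT : 0 < T) {g : Icc (0 : ℝ) T → ℝ} (hg : Continuous g)
    {ε : ℝ} (hε : 0 < ε) :
    ∃ S : Elementary T, ∀ s : Icc (0 : ℝ) T, (s : ℝ) ≠ 0 → |S.toFun s - g s| ≤ ε := by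
  have huc := CompactSpace.uniformContinuous_of_continuous hg
  obtain ⟨δ, hδ, H⟩ := Metric.uniformContinuous_iff.mp huc ε hε
  obtain ⟨N, hN⟩ := exists_nat_gt (T / δ)
  have hNpos : (0 : ℝ) < N := lt_of_le_of_lt (div_nonneg hT.le hδ.le) hN
  have hTN : T / N < δ := by
    rw [div_lt_iff₀ hNpos]
    rw [div_lt_iff₀ hδ] at hN
    linarith
  have hmem : ∀ i : ℕ, i ≤ N → (i : ℝ) * (T / N) ∈ Icc (0 : ℝ) T := by
    intro i hi
    refine ⟨by positivity, ?_⟩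
    have : (i : ℝ) ≤ N := by exact_mod_cast hi
    calc (i : ℝ) * (T / N) ≤ N * (T / N) := by gcongr
      _ = T := mul_div_cancel₀ _ hNpos.ne'
  have hTN0 : 0 < T / N := by positivity
  let S : Elementary T :=
    { n := N
      coeff := fun i => g ⟨_, hmem (i + 1) i.2⟩
      left := fun i => ⟨_, hmem i i.2.le⟩
      right := fun i => ⟨_, hmem (i + 1) i.2⟩
      left_le_right := fun i => by
        change (i : ℝ) * (T / N) ≤ ((i + 1 : ℕ) : ℝ) * (T / N)
        gcongr
        simp }
  refine ⟨S, fun s hs => ?_⟩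
  have hs0 : 0 < (s : ℝ) := lt_of_le_of_ne s.2.1 (Ne.symm hs)
  -- The ceiling selects the half-open cell ](k-1)T/N, kT/N] that contains `s`. The value of the
  -- step function there is that of `g` at the right endpoint, at distance at most T/N < δ.
  set k := ⌈(s : ℝ) / (T / N)⌉₊ with hk
  have hk0 : 0 < k := Nat.ceil_pos.mpr (by positivity)
  have hkN : k ≤ N := by
    apply Nat.ceil_le.mpr
    rw [div_le_iff₀ hTN0, mul_div_cancel₀ _ hNpos.ne']
    exact s.2.2
  obtain ⟨j, hj⟩ : ∃ j, k = j + 1 := ⟨k - 1, by omega⟩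
  have hup : (s : ℝ) ≤ ((j + 1 : ℕ) : ℝ) * (T / N) := by
    rw [← hj, ← div_le_iff₀ hTN0]
    exact Nat.le_ceil _
  have hlow : (j : ℝ) * (T / N) < s := by
    rw [← lt_div_iff₀ hTN0]
    exact Nat.lt_ceil.mp (by omega)
  have hval : S.toFun s = g ⟨_, hmem (j + 1) (by omega)⟩ := by
    unfold Elementary.toFun
    rw [Finset.sum_eq_single (⟨j, by omega⟩ : Fin N)]
    · rw [indicator_of_mem]
      exact ⟨hlow, hup⟩
    · intro i _ hi
      rw [indicator_of_notMem]
      rintro ⟨h1, h2⟩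
      have h1' : ((i : ℕ) : ℝ) * (T / N) < s := h1
      have h2' : (s : ℝ) ≤ (((i : ℕ) + 1 : ℕ) : ℝ) * (T / N) := h2
      have a1 := lt_of_mul_lt_mul_right (h1'.trans_le hup) hTN0.le
      have a2 := lt_of_mul_lt_mul_right (hlow.trans_le h2') hTN0.le
      norm_cast at a1 a2
      exact hi (Fin.ext (by simp; omega))
    · simp
  rw [hval]
  refine (H ?_).le
  rw [Subtype.dist_eq, Real.dist_eq]
  have : ((j + 1 : ℕ) : ℝ) * (T / N) = j * (T / N) + T / N := by push_cast; ring
  rw [abs_lt]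
  constructor <;> linarith

/-- Elementary functions are dense in `L²` of the marginal. -/
theorem exists_elementary_eLpNorm_sub_le (hT : 0 < T) (hμ : IsCovarianceMeasure X P μ)
    {φ : Icc (0 : ℝ) T → ℝ} (hφ : MemLp φ 2 (marginal μ)) {ε : ℝ≥0∞} (hε : ε ≠ 0) :
    ∃ S : Elementary T, eLpNorm (fun s => S.toFun s - φ s) 2 (marginal μ) ≤ ε := by
  obtain ⟨g, hg, hgL⟩ := hφ.exists_boundedContinuous_eLpNorm_sub_le (by simp)
    (ENNReal.half_pos hε).ne'
  -- `M` is the L² norm of the constant 1: a uniform error η costs at most M η.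
  set M := marginal μ univ ^ (2 : ℝ≥0∞).toReal⁻¹ with hM
  have hMtop : M ≠ ∞ := ENNReal.rpow_ne_top_of_nonneg (by positivity) (measure_ne_top _ _)
  obtain ⟨η, hη, hηM⟩ : ∃ η : ℝ, 0 < η ∧ M * ENNReal.ofReal η ≤ ε / 2 := by
    obtain ⟨c, hc, hcε⟩ : ∃ c : NNReal, 0 < c ∧ M * c < ε / 2 := by
      obtain ⟨c, hc, h⟩ := ENNReal.exists_nnreal_pos_mul_lt hMtop (ENNReal.half_pos hε).ne'
      exact ⟨c, hc, by rwa [mul_comm]⟩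
    exact ⟨c, hc, by simpa using hcε.le⟩
  obtain ⟨S, hS⟩ := exists_elementary_abs_sub_le hT g.continuous hη
  refine ⟨S, ?_⟩
  have h1 : eLpNorm (fun s => S.toFun s - g s) 2 (marginal μ) ≤ ε / 2 := by
    refine (eLpNorm_le_of_ae_bound (C := η) ?_).trans hηM
    have := measure_eq_zero_iff_ae_notMem.mp (marginal_singleton_zero hμ)
    filter_upwards [this] with s hs using hS s hs
  have e : (fun s => S.toFun s - φ s) = (fun s => S.toFun s - g s) - (φ - g) := by
    ext s; simp
  rw [e]
  refine (eLpNorm_sub_le ((S.isBoundedMeasurable.memLp _ 2).sub hgL).1 (hφ.sub hgL).1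
    one_le_two).trans ?_
  exact (add_le_add h1 hg).trans (ENNReal.add_halves ε).le

theorem exists_elementary_tendsto (hT : 0 < T) (hμ : IsCovarianceMeasure X P μ)
    {φ : Icc (0 : ℝ) T → ℝ} (hφ : MemLp φ 2 (marginal μ)) :
    ∃ S : ℕ → Elementary T,
      Tendsto (fun k => eLpNorm (fun s => (S k).toFun s - φ s) 2 (marginal μ)) atTop (𝓝 0) := by
  choose S hS using fun k : ℕ => exists_elementary_eLpNorm_sub_le hT hμ hφ
    (ε := ((k : ℝ≥0∞) + 1)⁻¹) (by simp)
  refine ⟨S, tendsto_of_tendsto_of_tendsto_of_le_of_le tendsto_const_nhds ?_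
    (fun _ => zero_le) hS⟩
  have := (ENNReal.tendsto_inv_nat_nhds_zero).comp (tendsto_add_atTop_nat 1)
  refine this.congr fun k => ?_
  simp

section

variable [IsProbabilityMeasure P] (hT : 0 < T) (hX : IsContinuousCenteredGaussian X P)
  (hμ : IsCovarianceMeasure X P μ)
include hT hX hμ

/-- Symmetry is not part of the notion of covariance measure. On elementary functions the form is a
covariance, and the identity passes to the limit by density. Nonnegativity below is obtained in the
same way. -/
theorem form_comm {φ ψ : Icc (0 : ℝ) T → ℝ} (hφ : IsBoundedMeasurable φ)
    (hψ : IsBoundedMeasurable ψ) : form μ φ ψ = form μ ψ φ := by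
  obtain ⟨S, hS⟩ := exists_elementary_tendsto hT hμ (hφ.memLp _ 2)
  obtain ⟨S', hS'⟩ := exists_elementary_tendsto hT hμ (hψ.memLp _ 2)
  have t1 := tendsto_form (fun i => (S i).isBoundedMeasurable.memLp _ 2)
    (fun i => (S' i).isBoundedMeasurable.memLp _ 2) (hφ.memLp _ 2) (hψ.memLp _ 2) hS hS'
  have t2 := tendsto_form (fun i => (S' i).isBoundedMeasurable.memLp _ 2)
    (fun i => (S i).isBoundedMeasurable.memLp _ 2) (hψ.memLp _ 2) (hφ.memLp _ 2) hS' hS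
  refine tendsto_nhds_unique t1 (t2.congr fun i => ?_)
  rw [form_elementary hX hμ, form_elementary hX hμ, covariance_comm]

theorem form_self_nonneg {φ : Icc (0 : ℝ) T → ℝ} (hφ : IsBoundedMeasurable φ) :
    0 ≤ form μ φ φ := by
  obtain ⟨S, hS⟩ := exists_elementary_tendsto hT hμ (hφ.memLp _ 2)
  refine ge_of_tendsto' (tendsto_form (fun i => (S i).isBoundedMeasurable.memLp _ 2)
    (fun i => (S i).isBoundedMeasurable.memLp _ 2) (hφ.memLp _ 2) (hφ.memLp _ 2) hS hS)
    fun i => ?_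
  rw [form_elementary hX hμ, covariance_self ((S i).memLp_integral hX).1.aemeasurable]
  exact variance_nonneg _ _

theorem form_sub_self {φ ψ : Icc (0 : ℝ) T → ℝ} (hφ : IsBoundedMeasurable φ)
    (hψ : IsBoundedMeasurable ψ) :
    form μ (fun s => φ s - ψ s) (fun s => φ s - ψ s)
      = form μ φ φ - 2 * form μ φ ψ + form μ ψ ψ := by
  rw [form_sub_left hφ hψ (hφ.sub hψ), form_sub_right hφ hφ hψ, form_sub_right hψ hφ hψ,
    form_comm hT hX hμ hψ hφ]
  ring

/-- The Cauchy–Schwarz inequality. -/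
theorem form_sq_le {φ ψ : Icc (0 : ℝ) T → ℝ} (hφ : IsBoundedMeasurable φ)
    (hψ : IsBoundedMeasurable ψ) : form μ φ ψ ^ 2 ≤ form μ φ φ * form μ ψ ψ := by
  -- The quadratic polynomial x ↦ ‖φ - xψ‖² is nonnegative.
  have h := discrim_le_zero (a := form μ ψ ψ) (b := -(2 * form μ φ ψ)) (c := form μ φ φ)
    fun x => by
      have := form_self_nonneg hT hX hμ (hφ.sub (hψ.const_mul x))
      rw [form_sub_self hT hX hμ hφ (hψ.const_mul x), form_const_mul_right,
        form_const_mul_right, form_const_mul_left] at this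
      linarith
  unfold discrim at h
  linarith

end

end SkorohodIto

/-! ### The scalar product of H as a limit along truncations -/

namespace SkorohodIto

variable {T : ℝ} {Ω : Type*} [MeasurableSpace Ω] {X : Icc (0 : ℝ) T → Ω → ℝ}
  {P : Measure Ω} {μ : SignedMeasure (Icc (0 : ℝ) T × Icc (0 : ℝ) T)}

theorem isBoundedMeasurable_truncation {α : Type*} [MeasurableSpace α] {φ : α → ℝ}
    (hφ : Measurable φ) (A : ℝ) : IsBoundedMeasurable (truncation φ A) :=
  ⟨(measurable_id.indicator measurableSet_Ioc).comp hφ, |A|,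
    fun s => abs_truncation_le_bound φ A s⟩

theorem tendsto_truncation {α : Type*} (φ : α → ℝ) (s : α) :
    Tendsto (fun n : ℕ => truncation φ n s) atTop (𝓝 (φ s)) := by
  refine tendsto_const_nhds.congr' ?_
  obtain ⟨N, hN⟩ := exists_nat_gt |φ s|
  filter_upwards [eventually_ge_atTop N] with n hn
  exact (truncation_eq_self (hN.trans_le (by exact_mod_cast hn))).symm

theorem eventually_truncation_eq {α : Type*} [MeasurableSpace α] {φ : α → ℝ}
    (hφ : IsBoundedMeasurable φ) : ∀ᶠ n : ℕ in atTop, truncation φ n = φ := by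
  obtain ⟨C, hC⟩ := hφ.bounded
  obtain ⟨N, hN⟩ := exists_nat_gt C
  filter_upwards [eventually_ge_atTop N] with n hn
  ext s
  exact truncation_eq_self ((hC s).trans_lt (hN.trans_le (by exact_mod_cast hn)))

theorem innerH_eq_limUnder_form {φ ψ : Icc (0 : ℝ) T → ℝ} (hφ : Measurable φ)
    (hψ : Measurable ψ) :
    innerH μ φ ψ = limUnder atTop fun n : ℕ => form μ (truncation φ n) (truncation ψ n) := by
  unfold innerH
  congr 1
  ext n
  exact (form_eq_integral (isBoundedMeasurable_truncation hφ n)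
    (isBoundedMeasurable_truncation hψ n)).symm

theorem innerH_eq_form {φ ψ : Icc (0 : ℝ) T → ℝ} (hφ : IsBoundedMeasurable φ)
    (hψ : IsBoundedMeasurable ψ) : innerH μ φ ψ = form μ φ ψ := by
  rw [innerH_eq_limUnder_form hφ.measurable hψ.measurable]
  refine Tendsto.limUnder_eq (tendsto_const_nhds.congr' ?_)
  filter_upwards [eventually_truncation_eq hφ, eventually_truncation_eq hψ] with n h1 h2
  rw [h1, h2]

theorem MemLMu.integrable {φ : Icc (0 : ℝ) T → ℝ} (hφ : MemLMu μ φ) :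
    Integrable (fun p : Icc (0 : ℝ) T × Icc (0 : ℝ) T => φ p.1 * φ p.2) μ.variation := by
  refine ⟨((hφ.1.comp measurable_fst).mul (hφ.1.comp measurable_snd)).aestronglyMeasurable, ?_⟩
  refine lt_of_eq_of_lt ?_ hφ.2
  simp only [absNormSq, enorm_mul]

/-- Dominated convergence by |φ(u)φ(v)|. The two truncation levels vary independently, which is what
makes the truncations a Cauchy sequence for ‖·‖_H. -/
theorem MemLMu.tendsto_form_truncation {φ : Icc (0 : ℝ) T → ℝ} (hφ : MemLMu μ φ) :
    Tendsto (fun k : ℕ × ℕ => form μ (truncation φ k.1) (truncation φ k.2)) atTop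
      (𝓝 (innerH μ φ φ)) := by
  have e : innerH μ φ φ = ∫ p, φ p.1 * (φ p.2 * signDensity μ p) ∂μ.variation := by
    rw [innerH_eq_integral μ hφ.1 hφ.1 hφ.integrable,
      integral_eq_integral_signDensity μ hφ.integrable]
    simp_rw [mul_assoc]
  rw [e]
  refine tendsto_integral_filter_of_dominated_convergence (fun p => ‖φ p.1 * φ p.2‖) ?_ ?_
    hφ.integrable.norm ?_
  · exact Eventually.of_forall fun k => ((isBoundedMeasurable_form_integrand
      (isBoundedMeasurable_truncation hφ.1 _)
      (isBoundedMeasurable_truncation hφ.1 _)).measurable).aestronglyMeasurable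
  · refine Eventually.of_forall fun k => ae_of_all _ fun p => ?_
    rw [norm_mul, norm_mul, norm_mul]
    have h1 := abs_truncation_le_abs_self φ k.1 p.1
    have h2 := abs_truncation_le_abs_self φ k.2 p.2
    have h3 := abs_signDensity_le μ p
    refine mul_le_mul h1 ((mul_le_of_le_one_right (abs_nonneg _) h3).trans h2)
      (by positivity) (norm_nonneg _)
  · refine ae_of_all _ fun p => ?_
    rw [← prod_atTop_atTop_eq]
    exact ((tendsto_truncation φ p.1).comp tendsto_fst).mul
      (((tendsto_truncation φ p.2).comp tendsto_snd).mul_const _)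

theorem absNormSq_toReal {φ : Icc (0 : ℝ) T → ℝ} (hφ : IsBoundedMeasurable φ) :
    (absNormSq μ φ).toReal = ∫ p, |φ p.1 * φ p.2| ∂μ.variation := by
  rw [absNormSq, integral_eq_lintegral_of_nonneg_ae (ae_of_all _ fun p => abs_nonneg _)
    (hφ.prod hφ).measurable.norm.aestronglyMeasurable]
  congr 1
  refine lintegral_congr fun p => ?_
  rw [← enorm_mul, ← Real.norm_eq_abs, ofReal_norm]

theorem form_self_le {φ : Icc (0 : ℝ) T → ℝ} (hφ : IsBoundedMeasurable φ) :
    form μ φ φ ≤ (absNormSq μ φ).toReal := by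
  rw [absNormSq_toReal hφ]
  refine (le_abs_self _).trans ?_
  have := abs_integral_mul_signDensity_le μ ((hφ.prod hφ).integrable μ.variation)
  simp_rw [mul_assoc] at this
  exact this

section

variable [IsProbabilityMeasure P] (hT : 0 < T) (hX : IsContinuousCenteredGaussian X P)
  (hμ : IsCovarianceMeasure X P μ)
include hT hX hμ

/-- The product φ(u)ψ(v) is not known to be |μ|-integrable, so dominated convergence is not
available. Instead, Cauchy–Schwarz bounds the increments of the sequence by ‖φ_k - φ_l‖_H ‖ψ‖_H,
which tends to 0. Hence the limit in the definition of the scalar product exists and is not a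
default value. -/
theorem tendsto_form_truncation_left {φ ψ : Icc (0 : ℝ) T → ℝ} (hφ : MemLMu μ φ)
    (hψ : IsBoundedMeasurable ψ) :
    Tendsto (fun n : ℕ => form μ (truncation φ n) ψ) atTop (𝓝 (innerH μ φ ψ)) := by
  have htr := fun n : ℕ => isBoundedMeasurable_truncation hφ.1 (n : ℝ)
  have hdiag : Tendsto (fun n : ℕ => (n, n)) atTop (atTop : Filter (ℕ × ℕ)) := by
    rw [← prod_atTop_atTop_eq]; exact tendsto_id.prodMk tendsto_id
  have t0 := hφ.tendsto_form_truncation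
  have t1 := (t0.comp hdiag)
  have tf : Tendsto (fun k : ℕ × ℕ => k.1) atTop atTop := by
    rw [← prod_atTop_atTop_eq]; exact tendsto_fst
  have ts : Tendsto (fun k : ℕ × ℕ => k.2) atTop atTop := by
    rw [← prod_atTop_atTop_eq]; exact tendsto_snd
  -- This is ‖φ_k - φ_l‖_H² ‖ψ‖_H² after expansion; all three scalar products tend to ⟨φ, φ⟩_H.
  have t2 : Tendsto (fun k : ℕ × ℕ =>
      (form μ (truncation φ k.1) (truncation φ k.1) - 2 * form μ (truncation φ k.1)
        (truncation φ k.2) + form μ (truncation φ k.2) (truncation φ k.2)) * form μ ψ ψ)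
      atTop (𝓝 0) := by
    have := ((((t1.comp tf).sub (t0.const_mul 2)).add (t1.comp ts)).mul_const (form μ ψ ψ))
    convert! this using 2
    ring
  have hcau : CauchySeq fun n : ℕ => form μ (truncation φ n) ψ := by
    rw [cauchySeq_iff_tendsto_dist_atTop_0]
    have t3 := t2.sqrt
    rw [Real.sqrt_zero] at t3
    refine tendsto_of_tendsto_of_tendsto_of_le_of_le tendsto_const_nhds t3
      (fun _ => dist_nonneg) fun k => ?_
    apply Real.le_sqrt_of_sq_le
    rw [Real.dist_eq, sq_abs, ← form_sub_left (htr _) (htr _) hψ,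
      ← form_sub_self hT hX hμ (htr _) (htr _)]
    exact form_sq_le hT hX hμ ((htr _).sub (htr _)) hψ
  obtain ⟨l, hl⟩ := cauchySeq_tendsto_of_complete hcau
  have : innerH μ φ ψ = l := by
    rw [innerH_eq_limUnder_form hφ.1 hψ.measurable]
    refine Tendsto.limUnder_eq (hl.congr' ?_)
    filter_upwards [eventually_truncation_eq hψ] with n hn
    rw [hn]
  rwa [this]

theorem innerH_comm {φ ψ : Icc (0 : ℝ) T → ℝ} (hφ : Measurable φ)
    (hψ : Measurable ψ) : innerH μ ψ φ = innerH μ φ ψ := by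
  rw [innerH_eq_limUnder_form hφ hψ, innerH_eq_limUnder_form hψ hφ]
  congr 1
  ext n
  exact form_comm hT hX hμ (isBoundedMeasurable_truncation hψ n)
    (isBoundedMeasurable_truncation hφ n)

/-- Cauchy–Schwarz for the truncations of φ, then the limit. With χ elementary it shows that the
approximation in the definition of the Wiener integral also approximates the scalar products with
bounded ψ. -/
theorem innerH_sub_sq_le {φ ψ χ : Icc (0 : ℝ) T → ℝ} (hφ : MemLMu μ φ)
    (hψ : IsBoundedMeasurable ψ) (hχ : IsBoundedMeasurable χ) :
    (innerH μ χ ψ - innerH μ φ ψ) ^ 2 ≤ distSqH μ χ φ * form μ ψ ψ := by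
  have htr := fun n : ℕ => isBoundedMeasurable_truncation hφ.1 (n : ℝ)
  have hdiag : Tendsto (fun n : ℕ => (n, n)) atTop (atTop : Filter (ℕ × ℕ)) := by
    rw [← prod_atTop_atTop_eq]; exact tendsto_id.prodMk tendsto_id
  have l1 := ((tendsto_form_truncation_left hT hX hμ hφ hψ).const_sub (form μ χ ψ)).pow 2
  have l2 := (((tendsto_form_truncation_left hT hX hμ hφ hχ).const_mul 2).const_sub
    (form μ χ χ) |>.add (hφ.tendsto_form_truncation.comp hdiag)).mul_const (form μ ψ ψ)
  rw [distSqH, innerH_comm hT hX hμ hφ.1 hχ.measurable, innerH_eq_form hχ hψ,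
    innerH_eq_form hχ hχ]
  refine le_of_tendsto_of_tendsto' l1 l2 fun n => ?_
  rw [← form_sub_left hχ (htr n) hψ]
  refine (form_sq_le hT hX hμ (hχ.sub (htr n)) hψ).trans (le_of_eq ?_)
  rw [form_sub_self hT hX hμ hχ (htr n), form_comm hT hX hμ hχ (htr n)]
  rfl

theorem innerH_sq_le {φ ψ : Icc (0 : ℝ) T → ℝ} (hφ : MemLMu μ φ)
    (hψ : IsBoundedMeasurable ψ) :
    innerH μ φ ψ ^ 2 ≤ innerH μ φ φ * form μ ψ ψ := by
  -- The case χ = 0 of the preceding estimate.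
  have h := innerH_sub_sq_le hT hX hμ hφ hψ (IsBoundedMeasurable.const 0)
  rw [distSqH, innerH_eq_form (IsBoundedMeasurable.const 0) hψ,
    innerH_eq_form (IsBoundedMeasurable.const 0) (IsBoundedMeasurable.const 0),
    innerH_comm hT hX hμ hφ.1 measurable_const, form_zero_left, form_zero_left] at h
  have h0 : innerH μ φ (fun _ => 0) = 0 :=
    tendsto_nhds_unique (tendsto_form_truncation_left hT hX hμ hφ (IsBoundedMeasurable.const 0))
      (by simp [form_zero_right])
  rw [h0] at h
  simpa using h

end

end SkorohodIto

/-! ### Continuity in mean, and integration by parts for elementary integrals -/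

namespace SkorohodIto

variable {T : ℝ} {Ω : Type*} [MeasurableSpace Ω] {X : Icc (0 : ℝ) T → Ω → ℝ}
  {P : Measure Ω} {μ : SignedMeasure (Icc (0 : ℝ) T × Icc (0 : ℝ) T)}

section continuity

variable [IsProbabilityMeasure P] (hX : IsContinuousCenteredGaussian X P)
include hX

/-- Continuity of paths only gives pointwise convergence, but for a centered Gaussian increment |E
exp(i(X_b - X_a))| = exp(-Var/2). The left side converges to 1 by bounded convergence, so the
variance tends to 0. -/
theorem tendsto_variance_sub (a : Icc (0 : ℝ) T) :
    Tendsto (fun b => Var[fun ω => X b ω - X a ω; P]) (𝓝 a) (𝓝 0) := by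
  have hg : ∀ b, HasGaussianLaw (fun ω => X b ω - X a ω) P := fun b =>
    hX.gaussian.hasGaussianLaw_fun_sub
  have hc : ∀ b, ∫ ω, (X b ω - X a ω) ∂P = 0 := fun b => by
    rw [integral_sub ((hX.memLp b).integrable one_le_two) ((hX.memLp a).integrable one_le_two),
      hX.centered, hX.centered, sub_zero]
  have key : ∀ b, Var[fun ω => X b ω - X a ω; P]
      = -2 * Real.log ‖∫ ω, Complex.exp ((X b ω - X a ω : ℝ) * Complex.I) ∂P‖ := by
    intro b
    have h1 : charFun (P.map fun ω => X b ω - X a ω) 1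
        = ∫ ω, Complex.exp ((X b ω - X a ω : ℝ) * Complex.I) ∂P := by
      rw [charFun_apply_real, integral_map (hg b).aemeasurable (by fun_prop)]
      simp
    rw [← h1, (hg b).map_eq_gaussianReal, charFun_gaussianReal, hc b, Complex.norm_exp]
    simp [variance_nonneg]
    ring
  simp_rw [key]
  have hlim : Tendsto (fun b => ∫ ω, Complex.exp ((X b ω - X a ω : ℝ) * Complex.I) ∂P) (𝓝 a)
      (𝓝 (∫ ω, (1 : ℂ) ∂P)) := by
    refine tendsto_integral_filter_of_dominated_convergence (fun _ => 1) ?_ ?_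
      (integrable_const _) ?_
    · refine Eventually.of_forall fun b => Measurable.aestronglyMeasurable ?_
      have := (hX.measurable b).sub (hX.measurable a)
      exact Complex.measurable_exp.comp ((Complex.measurable_ofReal.comp this).mul_const _)
    · refine Eventually.of_forall fun b => ae_of_all _ fun ω => ?_
      rw [Complex.norm_exp_ofReal_mul_I]
    · refine ae_of_all _ fun ω => ?_
      have h0 : Continuous fun b => Complex.exp ((X b ω - X a ω : ℝ) * Complex.I) := by
        have := hX.continuous_paths ω
        fun_prop
      simpa using h0.tendsto a
  have h2 := (hlim.norm.log (by simp)).const_mul (-2)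
  simpa using h2

theorem tendsto_integral_abs_sub (a : Icc (0 : ℝ) T) :
    Tendsto (fun b => ∫ ω, |X b ω - X a ω| ∂P) (𝓝 a) (𝓝 0) := by
  have h := (tendsto_variance_sub hX a).sqrt
  rw [Real.sqrt_zero] at h
  refine tendsto_of_tendsto_of_tendsto_of_le_of_le tendsto_const_nhds h
    (fun b => integral_nonneg fun ω => abs_nonneg _) fun b => ?_
  apply Real.le_sqrt_of_sq_le
  have hL : MemLp (fun ω => X b ω - X a ω) 2 P := (hX.memLp b).sub (hX.memLp a)
  have h0 : 0 ≤ Var[fun ω => |X b ω - X a ω|; P] := variance_nonneg _ _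
  have hLa : MemLp (fun ω => |X b ω - X a ω|) 2 P := hL.abs
  rw [variance_eq_sub hLa] at h0
  have hc : ∫ ω, (X b ω - X a ω) ∂P = 0 := by
    rw [integral_sub ((hX.memLp b).integrable one_le_two) ((hX.memLp a).integrable one_le_two),
      hX.centered, hX.centered, sub_zero]
  rw [variance_of_integral_eq_zero hL.1.aemeasurable hc]
  simp only [Pi.pow_apply, sq_abs] at h0
  linarith

/-- The linear interpolation between two values of the process. -/
def interpolate (X : Icc (0 : ℝ) T → Ω → ℝ) (k : Icc (0 : ℝ) T × Icc (0 : ℝ) T × ℝ) (ω : Ω) : ℝ :=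
  X k.1 ω + k.2.2 * (X k.2.1 ω - X k.1 ω)

omit [IsProbabilityMeasure P] in
theorem measurable_interpolate (k : Icc (0 : ℝ) T × Icc (0 : ℝ) T × ℝ) :
    Measurable (interpolate X k) :=
  (hX.measurable _).add (((hX.measurable _).sub (hX.measurable _)).const_mul _)

omit [IsProbabilityMeasure P] in
theorem memLp_interpolate (k : Icc (0 : ℝ) T × Icc (0 : ℝ) T × ℝ) :
    MemLp (interpolate X k) 2 P :=
  (hX.memLp _).add (((hX.memLp _).sub (hX.memLp _)).const_mul _)

theorem continuous_integral_mul_comp_of_bounded {q : Ω → ℝ} (hq : IsBoundedMeasurable q)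
    {h : ℝ → ℝ} (hc : Continuous h) {C : ℝ} (hC : ∀ x, |h x| ≤ C) :
    Continuous fun k => ∫ ω, q ω * h (interpolate X k ω) ∂P := by
  obtain ⟨D, hD⟩ := hq.bounded
  refine continuous_of_dominated (bound := fun _ => D * C) (fun k => ?_) (fun k => ?_)
    (integrable_const _) (ae_of_all _ fun ω => ?_)
  · exact (hq.measurable.mul (hc.measurable.comp (measurable_interpolate hX k))).aestronglyMeasurable
  · refine ae_of_all _ fun ω => ?_
    rw [norm_mul]
    exact mul_le_mul (hD ω) (hC _) (norm_nonneg _) ((abs_nonneg _).trans (hD ω))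
  · have := hX.continuous_paths ω
    unfold interpolate
    fun_prop

/-- Here h may be unbounded and no integrable bound for the supremum of the path is used; the
Lipschitz property reduces the claim to continuity of X in L¹. -/
theorem continuous_integral_mul_comp_of_lipschitz {q : Ω → ℝ} (hq : IsBoundedMeasurable q)
    {h : ℝ → ℝ} {C : ℝ} (hC : ∀ x y, |h x - h y| ≤ C * |x - y|) :
    Continuous fun k => ∫ ω, q ω * h (interpolate X k ω) ∂P := by
  obtain ⟨D, hD⟩ := hq.bounded
  have hC0 : 0 ≤ C := by
    have := (abs_nonneg _).trans (hC 1 0)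
    simpa using this
  have hcont : Continuous h := by
    have : LipschitzWith C.toNNReal h := LipschitzWith.of_dist_le_mul fun x y => by
      rw [Real.dist_eq, Real.dist_eq, Real.coe_toNNReal _ hC0]
      exact hC x y
    exact this.continuous
  have hint : ∀ k, Integrable (fun ω => q ω * h (interpolate X k ω)) P := by
    intro k
    have h1 : Integrable (fun ω => D * (|h 0| + C * |interpolate X k ω|)) P :=
      ((integrable_const _).add
        (((memLp_interpolate hX k).integrable one_le_two).abs.const_mul C)).const_mul D
    refine h1.mono' (hq.measurable.mul
      (hcont.measurable.comp (measurable_interpolate hX k))).aestronglyMeasurable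
      (ae_of_all _ fun ω => ?_)
    rw [norm_mul]
    refine mul_le_mul (hD ω) ?_ (norm_nonneg _) ((abs_nonneg _).trans (hD ω))
    have := hC (interpolate X k ω) 0
    rw [sub_zero] at this
    rw [Real.norm_eq_abs]
    linarith [abs_sub_abs_le_abs_sub (h (interpolate X k ω)) (h 0)]
  have hXi : ∀ a b, Integrable (fun ω => |X a ω - X b ω|) P := fun a b =>
    (((hX.memLp a).sub (hX.memLp b)).integrable one_le_two).abs
  rw [continuous_iff_continuousAt]
  intro k₀
  rw [ContinuousAt, tendsto_iff_norm_sub_tendsto_zero]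
  have hD0 : 0 ≤ D := by
    have : Nonempty Ω := P.nonempty_of_neZero
    exact (abs_nonneg _).trans (hD (Classical.arbitrary Ω))
  have lim : Tendsto (fun k : Icc (0 : ℝ) T × Icc (0 : ℝ) T × ℝ =>
      D * C * (|1 - k.2.2| * ∫ ω, |X k.1 ω - X k₀.1 ω| ∂P
        + |k.2.2| * ∫ ω, |X k.2.1 ω - X k₀.2.1 ω| ∂P
        + |k.2.2 - k₀.2.2| * ∫ ω, |X k₀.2.1 ω - X k₀.1 ω| ∂P)) (𝓝 k₀) (𝓝 0) := by
    have c1 : Tendsto (fun k : Icc (0 : ℝ) T × Icc (0 : ℝ) T × ℝ => k.2.2) (𝓝 k₀) (𝓝 k₀.2.2) :=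
      (continuous_snd.snd.tendsto k₀)
    have c2 := (tendsto_integral_abs_sub hX k₀.1).comp (continuous_fst.tendsto k₀)
    have c3 := (tendsto_integral_abs_sub hX k₀.2.1).comp (continuous_snd.fst.tendsto k₀)
    have := (((((tendsto_const_nhds (x := (1 : ℝ))).sub c1).abs.mul c2).add
      (c1.abs.mul c3)).add (((c1.sub_const k₀.2.2).abs).mul_const
        (∫ ω, |X k₀.2.1 ω - X k₀.1 ω| ∂P))).const_mul (D * C)
    simpa using this
  refine tendsto_of_tendsto_of_tendsto_of_le_of_le tendsto_const_nhds lim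
    (fun _ => norm_nonneg _) fun k => ?_
  dsimp only
  have hsum : Integrable (fun ω => |1 - k.2.2| * |X k.1 ω - X k₀.1 ω|
      + |k.2.2| * |X k.2.1 ω - X k₀.2.1 ω|) P := ((hXi _ _).const_mul _).add ((hXi _ _).const_mul _)
  rw [← integral_sub (hint k) (hint k₀), ← integral_const_mul, ← integral_const_mul,
    ← integral_const_mul, ← integral_add ((hXi _ _).const_mul _) ((hXi _ _).const_mul _),
    ← integral_add hsum ((hXi _ _).const_mul _), ← integral_const_mul]
  refine norm_integral_le_of_norm_le ((hsum.add ((hXi _ _).const_mul _)).const_mul _) (ae_of_all _ fun ω => ?_)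
  rw [← mul_sub, norm_mul, mul_assoc]
  refine mul_le_mul (hD ω) ((hC _ _).trans (mul_le_mul_of_nonneg_left ?_ hC0)) (norm_nonneg _) hD0
  -- In each term either the increment tends to 0 in L¹ or the factor θ - θ₀ tends to 0.
  have e : interpolate X k ω - interpolate X k₀ ω = (1 - k.2.2) * (X k.1 ω - X k₀.1 ω)
      + k.2.2 * (X k.2.1 ω - X k₀.2.1 ω) + (k.2.2 - k₀.2.2) * (X k₀.2.1 ω - X k₀.1 ω) := by
    unfold interpolate; ring
  rw [e, ← abs_mul, ← abs_mul, ← abs_mul]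
  exact abs_add_three _ _ _

end continuity

section smooth

variable {n : ℕ} {g : (Fin n → ℝ) → ℝ}

theorem IsSmoothBounded.exists_bound (hg : IsSmoothBounded g) : ∃ C, ∀ x, |g x| ≤ C := by
  obtain ⟨C, hC⟩ := hg.2 0
  exact ⟨C, fun x => by simpa using hC x⟩

theorem IsSmoothBounded.exists_fderiv_bound (hg : IsSmoothBounded g) :
    ∃ C, ∀ x, ‖fderiv ℝ g x‖ ≤ C := by
  obtain ⟨C, hC⟩ := hg.2 1
  exact ⟨C, fun x => by simpa [norm_iteratedFDeriv_one] using hC x⟩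

theorem IsSmoothBounded.exists_fderiv_lipschitz (hg : IsSmoothBounded g) :
    ∃ C, ∀ x y, ‖fderiv ℝ g x - fderiv ℝ g y‖ ≤ C * ‖x - y‖ := by
  obtain ⟨C, hC⟩ := hg.2 2
  have hd : Differentiable ℝ (fderiv ℝ g) :=
    (hg.1.fderiv_right (m := 1) (by norm_cast)).differentiable one_ne_zero
  refine ⟨C, fun x y => ?_⟩
  refine convex_univ.norm_image_sub_le_of_norm_fderiv_le (𝕜 := ℝ) (f := fderiv ℝ g)
    (fun z _ => hd z) (fun z _ => ?_) (mem_univ y) (mem_univ x)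
  have := hC z
  rwa [← norm_iteratedFDeriv_fderiv, norm_iteratedFDeriv_one] at this

theorem IsSmoothBounded.contDiff (hg : IsSmoothBounded g) {k : ℕ} : ContDiff ℝ k g :=
  hg.1.of_le (by exact_mod_cast le_top)

end smooth

theorem apply_eq_sum_mul_single {n : ℕ} (L : (Fin n → ℝ) →L[ℝ] ℝ) (x : Fin n → ℝ) :
    L x = ∑ j, x j * L (Pi.single j 1) := by
  have h : x = ∑ j, x j • (Pi.single j 1 : Fin n → ℝ) := by
    ext i
    simp [Finset.sum_apply, Pi.single_apply]
  conv_lhs => rw [h]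
  rw [map_sum]
  simp only [map_smul, smul_eq_mul]

/-- Integration by parts for integrals of elementary integrands. -/
theorem integral_mul_comp_elementary [IsProbabilityMeasure P]
    (hX : IsContinuousCenteredGaussian X P) {n : ℕ} {g : (Fin n → ℝ) → ℝ}
    (hg : IsSmoothBounded g) (S : Fin n → Elementary T) (V Y : Elementary T) {p : ℝ → ℝ}
    (hp : ContDiff ℝ 1 p) {C : ℝ} (hC : ∀ x, |deriv p x| ≤ C) :
    ∫ ω, V.integral X ω * (g (fun j => (S j).integral X ω) * p (Y.integral X ω)) ∂P
      = ∑ j, cov[V.integral X, (S j).integral X; P]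
          * ∫ ω, fderiv ℝ g (fun j => (S j).integral X ω) (Pi.single j 1)
              * p (Y.integral X ω) ∂P
        + cov[V.integral X, Y.integral X; P]
          * ∫ ω, g (fun j => (S j).integral X ω) * deriv p (Y.integral X ω) ∂P := by
  classical
  obtain ⟨A, hA⟩ := hg.exists_bound
  obtain ⟨B, hB⟩ := hg.exists_fderiv_bound
  have hA0 : 0 ≤ A := (abs_nonneg _).trans (hA 0)
  have hB0 : 0 ≤ B := (norm_nonneg _).trans (hB 0)
  have hC0 : 0 ≤ C := (abs_nonneg _).trans (hC 0)
  have hpd : Differentiable ℝ p := hp.differentiable one_ne_zero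
  have hgd : Differentiable ℝ g := (hg.contDiff (k := 1)).differentiable (by simp)
  have hpb : ∀ y, |p y| ≤ |p 0| + C * |y| := by
    intro y
    have := convex_univ.norm_image_sub_le_of_norm_deriv_le (𝕜 := ℝ) (f := p)
      (fun z _ => hpd z) (fun z _ => hC z) (mem_univ 0) (mem_univ y)
    rw [sub_zero, Real.norm_eq_abs, Real.norm_eq_abs] at this
    linarith [abs_sub_abs_le_abs_sub (p y) (p 0)]
  let ψ : (Fin n → ℝ) × ℝ → ℝ := fun z => g z.1 * p z.2
  let W : Ω → (Fin n → ℝ) × ℝ := fun ω => (fun j => (S j).integral X ω, Y.integral X ω)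
  have hψ : ContDiff ℝ 1 ψ := ((hg.contDiff (k := 1)).comp contDiff_fst).mul (hp.comp contDiff_snd)
  have hfd : ∀ z v, fderiv ℝ ψ z v
      = (∑ j, v.1 j * fderiv ℝ g z.1 (Pi.single j 1)) * p z.2 + v.2 * (g z.1 * deriv p z.2) := by
    intro z v
    have h1 : HasFDerivAt (fun z : (Fin n → ℝ) × ℝ => g z.1)
        ((fderiv ℝ g z.1).comp (ContinuousLinearMap.fst ℝ _ _)) z :=
      (hgd z.1).hasFDerivAt.comp z hasFDerivAt_fst
    have h2 : HasFDerivAt (fun z : (Fin n → ℝ) × ℝ => p z.2)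
        ((fderiv ℝ p z.2).comp (ContinuousLinearMap.snd ℝ _ _)) z :=
      (hpd z.2).hasFDerivAt.comp z hasFDerivAt_snd
    have h5 : HasFDerivAt ψ _ z := h1.fun_mul h2
    rw [h5.fderiv]
    have h3 := apply_eq_sum_mul_single (fderiv ℝ g z.1) v.1
    have h4 : fderiv ℝ p z.2 v.2 = v.2 * deriv p z.2 := by
      rw [← fderiv_apply_one_eq_deriv, ← smul_eq_mul, ← map_smul]
      simp
    simp [h3, h4]
    ring
  have hgauss : HasGaussianLaw (fun ω => (V.integral X ω, W ω)) P := by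
    -- The index set lists `V`, `Y` and the `S j`, so that their integrals form one Gaussian vector.
    let ι := Option (Option (Fin n))
    let E : ι → Elementary T := fun i => i.elim V fun i => i.elim Y S
    have h1 := ((isGaussianProcess_integral hX).comp_right E).hasGaussianLaw Finset.univ
    let π : ι → (↥(Finset.univ : Finset ι) → ℝ) →L[ℝ] ℝ := fun i =>
      ContinuousLinearMap.proj (R := ℝ) (φ := fun _ : (Finset.univ : Finset ι) => ℝ) ⟨i, by simp⟩
    exact h1.map_fun ((π none).prod
      ((ContinuousLinearMap.pi fun j => π (some (some j))).prod (π (some none))))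
  have hmean : ∫ ω, V.integral X ω ∂P = 0 := V.integral_integral hX
  let c : (Fin n → ℝ) × ℝ :=
    (fun j => cov[V.integral X, (S j).integral X; P], cov[V.integral X, Y.integral X; P])
  have hL : ∀ (L : StrongDual ℝ ((Fin n → ℝ) × ℝ)) (z : (Fin n → ℝ) × ℝ),
      L z = ∑ j, L (Pi.single j 1, 0) * z.1 j + L (0, 1) * z.2 := by
    intro L z
    have e : z = ∑ j, z.1 j • ((Pi.single j 1, 0) : (Fin n → ℝ) × ℝ)
        + z.2 • ((0, 1) : (Fin n → ℝ) × ℝ) := by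
      ext j
      · simp [Prod.fst_sum, Finset.sum_apply, Pi.single_apply]
      · simp [Prod.snd_sum]
    conv_lhs => rw [e]
    rw [map_add, map_sum]
    simp only [map_smul, smul_eq_mul, mul_comm]
  -- The derivative of g(x) p(y) is at most B(|p(0)| + C|y|) + AC in norm, hence the constant of
  -- linear growth.
  have key := integral_mul_comp_of_hasGaussianLaw hgauss hmean c (fun L => ?_) hψ
    (C := B * (|p 0| + C) + A * C) (fun z => ?_)
  · simp only [hfd, c, W, ψ] at key
    rw [key]
    have hWm : Measurable fun ω => fun j => (S j).integral X ω :=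
      measurable_pi_lambda _ fun j => (S j).measurable_integral hX
    have i1 : ∀ j, Integrable (fun ω => fderiv ℝ g (fun j => (S j).integral X ω) (Pi.single j 1)
        * p (Y.integral X ω)) P := by
      intro j
      have hpI : Integrable (fun ω => p (Y.integral X ω)) P := by
        refine ((integrable_const (|p 0|)).add
          (((Y.memLp_integral hX).integrable one_le_two).abs.const_mul C)).mono'
          (hp.continuous.measurable.comp (Y.measurable_integral hX)).aestronglyMeasurable
          (ae_of_all _ fun ω => hpb _)
      refine hpI.bdd_mul (c := B * ‖(Pi.single j 1 : Fin n → ℝ)‖) ?_ (ae_of_all _ fun ω => ?_)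
      · exact ((((hg.contDiff (k := 1)).continuous_fderiv (by simp)).clm_apply
          continuous_const).measurable.comp hWm).aestronglyMeasurable
      · exact ((fderiv ℝ g _).le_opNorm _).trans (by gcongr; exact hB _)
    have i2 : Integrable (fun ω => g (fun j => (S j).integral X ω)
        * deriv p (Y.integral X ω)) P := by
      refine (integrable_const (A * C)).mono' ?_ (ae_of_all _ fun ω => ?_)
      · exact (((hg.contDiff (k := 1)).continuous.measurable.comp hWm).mul
          ((hp.continuous_deriv le_rfl).measurable.comp
            (Y.measurable_integral hX))).aestronglyMeasurable
      · rw [norm_mul]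
        exact mul_le_mul (hA _) (hC _) (norm_nonneg _) hA0
    simp_rw [Finset.sum_mul, mul_assoc]
    rw [integral_add (integrable_finsetSum _ fun j _ => (i1 j).const_mul _) (i2.const_mul _),
      integral_finsetSum _ fun j _ => (i1 j).const_mul _]
    simp_rw [integral_const_mul]
  · have hV := V.memLp_integral hX
    have hLW : (fun ω => L (W ω)) = (fun ω => ∑ j, L (Pi.single j 1, 0) * (S j).integral X ω)
        + fun ω => L (0, 1) * Y.integral X ω := funext fun ω => hL L (W ω)
    rw [hLW, hL L c, covariance_add_right hV (memLp_finsetSum _ fun j _ =>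
      ((S j).memLp_integral hX).const_mul _) ((Y.memLp_integral hX).const_mul _),
      covariance_fun_sum_right (fun j => ((S j).memLp_integral hX).const_mul _) hV,
      covariance_const_mul_right]
    refine congrArg₂ (· + ·) (Finset.sum_congr rfl fun j _ => ?_) ?_
    · rw [covariance_const_mul_right]
    · rfl
  · have hC1 : 0 ≤ B * (|p 0| + C) + A * C := by positivity
    refine ContinuousLinearMap.opNorm_le_bound _ (by positivity) fun v => ?_
    rw [hfd, ← apply_eq_sum_mul_single (fderiv ℝ g z.1) v.1]
    have n1 : ‖v.1‖ ≤ ‖v‖ := norm_fst_le v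
    have n2 : |v.2| ≤ ‖v‖ := norm_snd_le v
    have n3 : |z.2| ≤ ‖z‖ := norm_snd_le z
    calc ‖fderiv ℝ g z.1 v.1 * p z.2 + v.2 * (g z.1 * deriv p z.2)‖
        ≤ ‖fderiv ℝ g z.1 v.1‖ * |p z.2| + |v.2| * (|g z.1| * |deriv p z.2|) := by
          refine (norm_add_le _ _).trans (le_of_eq ?_)
          simp
      _ ≤ (B * ‖v‖) * (|p 0| + C * ‖z‖) + ‖v‖ * (A * C) := by
          gcongr
          · exact ((fderiv ℝ g z.1).le_opNorm _).trans (mul_le_mul (hB _) n1 (norm_nonneg _) hB0)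
          · exact (hpb _).trans (by gcongr)
          · exact hA _
          · exact hC _
      _ ≤ (B * (|p 0| + C) + A * C) * (1 + ‖z‖) * ‖v‖ := by
          rw [← sub_nonneg]
          have : 0 ≤ |p 0| := abs_nonneg _
          ring_nf
          positivity

end SkorohodIto

/-! ### Expectations along the interpolation between two times -/

namespace SkorohodIto

variable {T : ℝ} {Ω : Type*} [MeasurableSpace Ω] {X : Icc (0 : ℝ) T → Ω → ℝ}
  {P : Measure Ω} {μ : SignedMeasure (Icc (0 : ℝ) T × Icc (0 : ℝ) T)}

/-- An integral over a strip is controlled by the increment of a monotone function, the distribution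
function of the image of `m`. Such increments add up over a partition. -/
theorem abs_integral_le_mul_sub {α : Type*} [MeasurableSpace α] {m : Measure α}
    [IsFiniteMeasure m] {π : α → Icc (0 : ℝ) T} (hπ : Measurable π) {Ψ : α → ℝ}
    {a b : Icc (0 : ℝ) T} (hab : a ≤ b) {C : ℝ} (h1 : ∀ p, π p ∈ Ioc a b → |Ψ p| ≤ C)
    (h0 : ∀ p, π p ∉ Ioc a b → Ψ p = 0) :
    |∫ p, Ψ p ∂m| ≤ C * (m.real (π ⁻¹' Iic b) - m.real (π ⁻¹' Iic a)) := by
  have e : m.real (π ⁻¹' Ioc a b) = m.real (π ⁻¹' Iic b) - m.real (π ⁻¹' Iic a) := by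
    rw [← Iic_sdiff_Iic, preimage_sdiff, measureReal_sdiff (preimage_mono (Iic_subset_Iic.mpr hab))
      (hπ measurableSet_Iic)]
  rw [← e, ← setIntegral_eq_integral_of_forall_compl_eq_zero (s := π ⁻¹' Ioc a b) (fun p hp => h0 p hp)]
  rw [← Real.norm_eq_abs]
  exact norm_setIntegral_le_of_norm_le_const (measure_lt_top _ _) fun p hp => h1 p hp

theorem indicator_Iic_sub_indicator_Iic {a b : Icc (0 : ℝ) T} (hab : a ≤ b)
    (h : Icc (0 : ℝ) T → ℝ) (s : Icc (0 : ℝ) T) :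
    (Iic b).indicator h s - (Iic a).indicator h s = (Ioc a b).indicator h s := by
  rw [← Iic_sdiff_Iic, indicator_sdiff (Iic_subset_Iic.mpr hab)]
  rfl

/-- Axes are negligible for the variation of a covariance measure. -/
theorem ae_ne_zero (hμ : IsCovarianceMeasure X P μ) :
    ∀ᵐ p ∂μ.variation, (p.1 : ℝ) ≠ 0 ∧ (p.2 : ℝ) ≠ 0 := by
  filter_upwards [measure_eq_zero_iff_ae_notMem.mp hμ.axes] with p hp
  simpa [not_or] using hp

theorem form_congr_left (hμ : IsCovarianceMeasure X P μ) {φ φ' : Icc (0 : ℝ) T → ℝ}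
    (h : ∀ s : Icc (0 : ℝ) T, (s : ℝ) ≠ 0 → φ s = φ' s) (ψ : Icc (0 : ℝ) T → ℝ) :
    form μ φ ψ = form μ φ' ψ := by
  refine integral_congr_ae ?_
  filter_upwards [ae_ne_zero hμ] with p hp
  rw [h _ hp.1]

theorem form_congr_right (hμ : IsCovarianceMeasure X P μ) (φ : Icc (0 : ℝ) T → ℝ)
    {ψ ψ' : Icc (0 : ℝ) T → ℝ} (h : ∀ s : Icc (0 : ℝ) T, (s : ℝ) ≠ 0 → ψ s = ψ' s) :
    form μ φ ψ = form μ φ ψ' := by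
  refine integral_congr_ae ?_
  filter_upwards [ae_ne_zero hμ] with p hp
  rw [h _ hp.2]

/-- The L-shaped region {a < max(u,v) ≤ b} is the disjoint union of three rectangles: two arms
exchanged by the symmetry of the square, and the corner ]a,b]². -/
theorem indicator_max (a b : Icc (0 : ℝ) T) (hab : a ≤ b) (p : Icc (0 : ℝ) T × Icc (0 : ℝ) T) :
    (Ioc a b).indicator (fun _ => (1 : ℝ)) (max p.1 p.2)
      = (Iic a).indicator (fun _ => 1) p.1 * (Ioc a b).indicator (fun _ => 1) p.2
        + (Ioc a b).indicator (fun _ => 1) p.1 * (Iic a).indicator (fun _ => 1) p.2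
        + (Ioc a b).indicator (fun _ => 1) p.1 * (Ioc a b).indicator (fun _ => 1) p.2 := by
  classical
  simp only [indicator_apply, mem_Ioc, mem_Iic, lt_max_iff, max_le_iff]
  by_cases h1 : p.1 ≤ a <;> by_cases h2 : p.2 ≤ a
  · simp [h1, h2, not_lt.mpr h1, not_lt.mpr h2]
  · simp [h1, h2, not_lt.mpr h1, not_le.mp h2, h1.trans hab]
  · simp [h1, h2, not_lt.mpr h2, not_le.mp h1, h2.trans hab]
  · by_cases h3 : p.1 ≤ b <;> simp [h1, h2, h3, not_le.mp h1, not_le.mp h2]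

theorem abs_deriv_le_of_abs_deriv_deriv_le {f : ℝ → ℝ} (hf : ContDiff ℝ 2 f) {C : ℝ}
    (hC : ∀ x, |deriv (deriv f) x| ≤ C) (y : ℝ) : |deriv f y| ≤ |deriv f 0| + C * |y| := by
  have hf1 : ContDiff ℝ 1 (deriv f) := ((contDiff_succ_iff_deriv (n := 1)).mp hf).2.2
  have := convex_univ.norm_image_sub_le_of_norm_deriv_le (𝕜 := ℝ) (f := deriv f)
    (fun z _ => hf1.differentiable one_ne_zero z) (fun z _ => hC z) (mem_univ 0) (mem_univ y)
  rw [sub_zero, Real.norm_eq_abs, Real.norm_eq_abs] at this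
  linarith [abs_sub_abs_le_abs_sub (deriv f y) (deriv f 0)]

theorem abs_le_of_abs_deriv_deriv_le {f : ℝ → ℝ} (hf : ContDiff ℝ 2 f) {C : ℝ}
    (hC : ∀ x, |deriv (deriv f) x| ≤ C) (y : ℝ) :
    |f y| ≤ |f 0| + (|deriv f 0| + C) * (1 + |y|) * |y| := by
  refine abs_le_of_norm_fderiv_le (hf.of_le one_le_two) (fun x => ?_) y
  rw [← norm_deriv_eq_norm_fderiv]
  refine (abs_deriv_le_of_abs_deriv_deriv_le hf hC x).trans ?_
  have := abs_nonneg (deriv f 0)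
  have := abs_nonneg x
  have := (abs_nonneg _).trans (hC 0)
  rw [Real.norm_eq_abs]
  nlinarith

section

variable [IsProbabilityMeasure P] (hT : 0 < T) (hX : IsContinuousCenteredGaussian X P)
  (hμ : IsCovarianceMeasure X P μ)

include hX in
/-- Differentiation of an expectation along the interpolation between two values. -/
theorem hasDerivAt_integral_interpolate {q : Ω → ℝ} (hq : IsBoundedMeasurable q) {f : ℝ → ℝ}
    (hf : ContDiff ℝ 2 f) {C : ℝ} (hC : ∀ x, |deriv (deriv f) x| ≤ C) (a b : Icc (0 : ℝ) T)
    (θ : ℝ) :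
    HasDerivAt (fun θ => ∫ ω, q ω * f (interpolate X (a, b, θ) ω) ∂P)
      (∫ ω, (X b ω - X a ω) * (q ω * deriv f (interpolate X (a, b, θ) ω)) ∂P) θ := by
  obtain ⟨D, hD⟩ := hq.bounded
  have hD0 : 0 ≤ D := by
    have : Nonempty Ω := P.nonempty_of_neZero
    exact (abs_nonneg _).trans (hD (Classical.arbitrary Ω))
  have hC0 : 0 ≤ C := (abs_nonneg _).trans (hC 0)
  have hf1 : ContDiff ℝ 1 (deriv f) := by
    have := (contDiff_succ_iff_deriv (n := 1)).mp hf
    exact this.2.2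
  have hfd : Differentiable ℝ f := hf.differentiable two_ne_zero
  have hf'b := abs_deriv_le_of_abs_deriv_deriv_le hf hC
  have hfb := abs_le_of_abs_deriv_deriv_le hf hC
  have hY : ∀ θ, Measurable (interpolate X (a, b, θ)) := fun θ => measurable_interpolate hX _
  have hV : Measurable fun ω => X b ω - X a ω := (hX.measurable b).sub (hX.measurable a)
  have hVL : MemLp (fun ω => X b ω - X a ω) 2 P := (hX.memLp b).sub (hX.memLp a)
  -- The bound comes from |f'(y)| ≤ |f'(0)| + C|y| and from |θ'| ≤ |θ| + 1 on the unit ball around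
  -- θ; it is integrable because the increments and values of X lie in L².
  refine (hasDerivAt_integral_of_dominated_loc_of_deriv_le (s := Metric.ball θ 1)
    (F := fun θ ω => q ω * f (interpolate X (a, b, θ) ω))
    (F' := fun θ ω => (X b ω - X a ω) * (q ω * deriv f (interpolate X (a, b, θ) ω)))
    (bound := fun ω => D * ((|deriv f 0| * |X b ω - X a ω|) + (C * (|X b ω - X a ω| * |X a ω|)
      + C * (|θ| + 1) * (X b ω - X a ω) ^ 2)))
    (Metric.ball_mem_nhds θ one_pos) ?_ ?_ ?_ ?_ ?_ ?_).2
  · exact Eventually.of_forall fun θ =>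
      (hq.measurable.mul (hf.continuous.measurable.comp (hY θ))).aestronglyMeasurable
  · have hi := memLp_interpolate hX (a, b, θ)
    have hbd : Integrable (fun ω => D * (|f 0| + (|deriv f 0| + C) *
        (|interpolate X (a, b, θ) ω| + (interpolate X (a, b, θ) ω) ^ 2))) P :=
      ((integrable_const _).add (((hi.integrable one_le_two).abs.add
        hi.integrable_sq).const_mul _)).const_mul _
    refine hbd.mono' (hq.measurable.mul (hf.continuous.measurable.comp (hY θ))).aestronglyMeasurable
      (ae_of_all _ fun ω => ?_)
    rw [norm_mul]
    refine mul_le_mul (hD ω) ((hfb _).trans (le_of_eq ?_)) (norm_nonneg _) hD0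
    rw [← sq_abs (interpolate X (a, b, θ) ω)]
    ring
  · exact (hV.mul (hq.measurable.mul
      (hf1.continuous.measurable.comp (hY θ)))).aestronglyMeasurable
  · refine ae_of_all _ fun ω θ' hθ' => ?_
    have h1 : |θ'| ≤ |θ| + 1 := by
      have : |θ' - θ| < 1 := by simpa [Real.dist_eq] using hθ'
      linarith [abs_sub_abs_le_abs_sub θ' θ]
    have h2 : |interpolate X (a, b, θ') ω| ≤ |X a ω| + (|θ| + 1) * |X b ω - X a ω| := by
      refine (abs_add_le _ _).trans ?_
      rw [abs_mul]
      gcongr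
    have h3 : |deriv f (interpolate X (a, b, θ') ω)|
        ≤ |deriv f 0| + C * (|X a ω| + (|θ| + 1) * |X b ω - X a ω|) :=
      (hf'b _).trans (by gcongr)
    rw [norm_mul, norm_mul, ← sq_abs (X b ω - X a ω)]
    simp only [Real.norm_eq_abs]
    calc |X b ω - X a ω| * (|q ω| * |deriv f (interpolate X (a, b, θ') ω)|)
        ≤ |X b ω - X a ω| * (D * (|deriv f 0| + C * (|X a ω| + (|θ| + 1) * |X b ω - X a ω|))) := by
          gcongr
          exact hD ω
      _ = _ := by ring
  · exact (((hVL.integrable one_le_two).abs.const_mul _).add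
      (((hVL.abs.integrable_mul (hX.memLp a).abs).const_mul _).add
        (hVL.integrable_sq.const_mul _))).const_mul _
  · refine ae_of_all _ fun ω θ' _ => ?_
    have h1 : HasDerivAt (fun θ => interpolate X (a, b, θ) ω) (X b ω - X a ω) θ' := by
      have := ((hasDerivAt_id θ').mul_const (X b ω - X a ω)).const_add (X a ω)
      simpa [interpolate] using this
    have h2 := (((hfd _).hasDerivAt).comp θ' h1).const_mul (q ω)
    convert! h2 using 1
    ring

include hT hX hμ in
/-- Integration by parts along the interpolation between two values. -/
theorem integral_sub_mul_interpolate {n : ℕ} {g : (Fin n → ℝ) → ℝ}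
    (hg : IsSmoothBounded g) (S : Fin n → Elementary T) {f : ℝ → ℝ} (hf : ContDiff ℝ 2 f)
    {C : ℝ} (hC : ∀ x, |deriv (deriv f) x| ≤ C) {a b : Icc (0 : ℝ) T} (hab : a ≤ b) (θ : ℝ) :
    ∫ ω, (X b ω - X a ω) * (g (fun j => (S j).integral X ω)
        * deriv f (interpolate X (a, b, θ) ω)) ∂P
      = ∑ j, form μ (S j).toFun ((Ioc a b).indicator fun _ => 1)
          * ∫ ω, fderiv ℝ g (fun j => (S j).integral X ω) (Pi.single j 1)
              * deriv f (interpolate X (a, b, θ) ω) ∂P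
        + (form μ ((Iic a).indicator fun _ => 1) ((Ioc a b).indicator fun _ => 1)
            + θ * form μ ((Ioc a b).indicator fun _ => 1) ((Ioc a b).indicator fun _ => 1))
          * ∫ ω, g (fun j => (S j).integral X ω)
              * deriv (deriv f) (interpolate X (a, b, θ) ω) ∂P := by
  let z : Icc (0 : ℝ) T := ⟨0, le_rfl, hT.le⟩
  have hza : z ≤ a := a.2.1
  let V := Elementary.single a b hab
  -- Since X_0 = 0 almost surely, X_a + θ(X_b - X_a) is the integral of 1_{]0,a]} + θ 1_{]a,b]}.
  let Y : Elementary T :=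
    { n := 2
      coeff := ![1, θ]
      left := ![z, a]
      right := ![a, b]
      left_le_right := fun i => by fin_cases i <;> simp [hza, hab] }
  have hYi : ∀ᵐ ω ∂P, Y.integral X ω = interpolate X (a, b, θ) ω := by
    filter_upwards [hX.start_zero z rfl] with ω hω
    refine (Fin.sum_univ_two _).trans ?_
    simp [Y, interpolate, hω]
  have hYf : Y.toFun = fun s => (Ioc z a).indicator (fun _ => 1) s
      + θ * (Ioc a b).indicator (fun _ => 1) s := by
    ext s
    refine (Fin.sum_univ_two _).trans ?_
    by_cases hs : s ∈ Ioc a b <;> simp [Y, hs]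
  have hind : ∀ u v : Icc (0 : ℝ) T,
      IsBoundedMeasurable ((Ioc u v).indicator fun _ => (1 : ℝ)) := fun u v =>
    (IsBoundedMeasurable.const 1).indicator measurableSet_Ioc
  have hf1 : ContDiff ℝ 1 (deriv f) := by
    have := (contDiff_succ_iff_deriv (n := 1)).mp hf
    exact this.2.2
  have key := integral_mul_comp_elementary hX hg S V Y hf1 hC
  -- The axes are null for |μ|, so ]0,a] may be replaced by [0,a].
  have e1 : cov[V.integral X, Y.integral X; P]
      = form μ ((Iic a).indicator fun _ => 1) ((Ioc a b).indicator fun _ => 1)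
        + θ * form μ ((Ioc a b).indicator fun _ => 1) ((Ioc a b).indicator fun _ => 1) := by
    rw [covariance_comm, ← form_elementary hX hμ, Elementary.single_toFun, hYf,
      form_add_left (hind _ _) ((hind _ _).const_mul θ) (hind _ _), form_const_mul_left]
    congr 1
    refine form_congr_left hμ (fun s hs => ?_) _
    have : z < s := lt_of_le_of_ne s.2.1 (fun h => hs (by rw [← h]))
    by_cases hsa : s ≤ a <;> simp [hsa, this]
  have e2 : ∀ j, cov[V.integral X, (S j).integral X; P]
      = form μ (S j).toFun ((Ioc a b).indicator fun _ => 1) := fun j => by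
    rw [covariance_comm, ← form_elementary hX hμ, Elementary.single_toFun]
  rw [e1] at key
  simp_rw [e2] at key
  have c0 : ∫ ω, (X b ω - X a ω) * (g (fun j => (S j).integral X ω)
        * deriv f (interpolate X (a, b, θ) ω)) ∂P = ∫ ω, V.integral X ω *
          (g (fun j => (S j).integral X ω) * deriv f (Y.integral X ω)) ∂P := by
    refine integral_congr_ae ?_
    filter_upwards [hYi] with ω hω
    rw [hω, Elementary.single_integral]
  rw [c0, key]
  congr 1
  · refine Finset.sum_congr rfl fun j _ => ?_
    congr 1
    refine integral_congr_ae ?_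
    filter_upwards [hYi] with ω hω
    rw [hω]
  · congr 1
    refine integral_congr_ae ?_
    filter_upwards [hYi] with ω hω
    rw [hω]

end

end SkorohodIto

/-! ### Evolution of E(G f(X_t)) -/

namespace SkorohodIto

variable {T : ℝ} {Ω : Type*} [MeasurableSpace Ω] {X : Icc (0 : ℝ) T → Ω → ℝ}
  {P : Measure Ω} {μ : SignedMeasure (Icc (0 : ℝ) T × Icc (0 : ℝ) T)}

/-- The integral `∫∫ h(max(u,v)) dμ(u,v)`, written with the variation of `μ`. -/
noncomputable def maxForm {T : ℝ} (μ : SignedMeasure (Icc (0 : ℝ) T × Icc (0 : ℝ) T))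
    (h : Icc (0 : ℝ) T → ℝ) : ℝ :=
  ∫ p, h (max p.1 p.2) * signDensity μ p ∂μ.variation

theorem integrable_maxForm {h : Icc (0 : ℝ) T → ℝ} (hh : IsBoundedMeasurable h) :
    Integrable (fun p : Icc (0 : ℝ) T × Icc (0 : ℝ) T => h (max p.1 p.2) * signDensity μ p)
      μ.variation :=
  integrable_mul_signDensity μ
    ((hh.comp (measurable_fst.max measurable_snd)).integrable _)

theorem maxForm_sub {h h' : Icc (0 : ℝ) T → ℝ} (hh : IsBoundedMeasurable h)
    (hh' : IsBoundedMeasurable h') :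
    maxForm μ (fun s => h s - h' s) = maxForm μ h - maxForm μ h' := by
  unfold maxForm
  rw [← integral_sub (integrable_maxForm hh) (integrable_maxForm hh')]
  simp_rw [sub_mul]

theorem maxForm_const_mul (c : ℝ) (h : Icc (0 : ℝ) T → ℝ) :
    maxForm μ (fun s => c * h s) = c * maxForm μ h := by
  unfold maxForm
  rw [← integral_const_mul]
  simp_rw [mul_assoc]

theorem abs_maxForm_le {h : Icc (0 : ℝ) T → ℝ} {a b : Icc (0 : ℝ) T} (hab : a ≤ b) {C : ℝ}
    (hC : ∀ s ∈ Ioc a b, |h s| ≤ C) (h0 : ∀ s ∉ Ioc a b, h s = 0) :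
    |maxForm μ h| ≤ C * (μ.variation.real ((fun p => max p.1 p.2) ⁻¹' Iic b)
      - μ.variation.real ((fun p => max p.1 p.2) ⁻¹' Iic a)) := by
  refine abs_integral_le_mul_sub (measurable_fst.max measurable_snd) hab (fun p hp => ?_)
    fun p hp => by rw [h0 _ hp, zero_mul]
  rw [abs_mul]
  exact (mul_le_of_le_one_right (abs_nonneg _) (abs_signDensity_le μ p)).trans (hC _ hp)

theorem abs_form_le {φ h : Icc (0 : ℝ) T → ℝ} {D : ℝ} (hD : ∀ s, |φ s| ≤ D)
    {a b : Icc (0 : ℝ) T} (hab : a ≤ b) {C : ℝ}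
    (hC : ∀ s ∈ Ioc a b, |h s| ≤ C) (h0 : ∀ s ∉ Ioc a b, h s = 0) :
    |form μ φ h| ≤ D * C * (μ.variation.real (Prod.snd ⁻¹' Iic b)
      - μ.variation.real (Prod.snd ⁻¹' Iic a)) := by
  refine abs_integral_le_mul_sub measurable_snd hab (fun p hp => ?_)
    fun p hp => by rw [h0 _ hp, zero_mul, mul_zero]
  rw [abs_mul, abs_mul]
  exact mul_le_mul (hD _) ((mul_le_of_le_one_right (abs_nonneg _)
    (abs_signDensity_le μ p)).trans (hC _ hp)) (by positivity) ((abs_nonneg _).trans (hD p.1))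

theorem isBoundedMeasurable_of_continuous {h : Icc (0 : ℝ) T → ℝ} (hh : Continuous h) :
    IsBoundedMeasurable h := by
  refine ⟨hh.measurable, ?_⟩
  obtain ⟨C, hC⟩ := isCompact_univ.exists_bound_of_continuousOn (f := h) hh.continuousOn
  exact ⟨C, fun s => hC s (mem_univ s)⟩

section

variable [IsProbabilityMeasure P] (hT : 0 < T) (hX : IsContinuousCenteredGaussian X P)
  (hμ : IsCovarianceMeasure X P μ)

include hT hX hμ

/-- By symmetry of the form, the two arms of the L-shaped region have equal mass. This identity is
the source of the factor ½ in the Itô formula. -/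
theorem maxForm_indicator {a b : Icc (0 : ℝ) T} (hab : a ≤ b) :
    maxForm μ ((Ioc a b).indicator fun _ => 1)
      = 2 * form μ ((Iic a).indicator fun _ => 1) ((Ioc a b).indicator fun _ => 1)
        + form μ ((Ioc a b).indicator fun _ => 1) ((Ioc a b).indicator fun _ => 1) := by
  have h1 : IsBoundedMeasurable ((Iic a).indicator fun _ => (1 : ℝ)) :=
    (IsBoundedMeasurable.const 1).indicator measurableSet_Iic
  have h2 : IsBoundedMeasurable ((Ioc a b).indicator fun _ => (1 : ℝ)) :=
    (IsBoundedMeasurable.const 1).indicator measurableSet_Ioc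
  rw [two_mul]
  nth_rewrite 2 [form_comm hT hX hμ h1 h2]
  have i := fun {φ ψ : Icc (0 : ℝ) T → ℝ} (hφ : IsBoundedMeasurable φ)
    (hψ : IsBoundedMeasurable ψ) =>
      (isBoundedMeasurable_form_integrand (μ := μ) hφ hψ).integrable μ.variation
  have i12 : Integrable (fun p : Icc (0 : ℝ) T × Icc (0 : ℝ) T =>
      (Iic a).indicator (fun _ => (1 : ℝ)) p.1 *
        ((Ioc a b).indicator (fun _ => 1) p.2 * signDensity μ p) +
      (Ioc a b).indicator (fun _ => 1) p.1 *
        ((Iic a).indicator (fun _ => 1) p.2 * signDensity μ p)) μ.variation :=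
    (i h1 h2).add (i h2 h1)
  unfold form maxForm
  rw [← integral_add (i h1 h2) (i h2 h1), ← integral_add i12 (i h2 h2)]
  congr 1
  ext p
  rw [indicator_max a b hab]
  ring

/-- The increment of an expectation over a short interval. -/
theorem abs_integral_sub_sub_le {n : ℕ} {g : (Fin n → ℝ) → ℝ}
    (hg : IsSmoothBounded g) (S : Fin n → Elementary T) {f : ℝ → ℝ} (hf : ContDiff ℝ 2 f)
    {C : ℝ} (hC : ∀ x, |deriv (deriv f) x| ≤ C) {a b : Icc (0 : ℝ) T} (hab : a ≤ b)
    {ε : ℝ} {A : Fin n → ℝ} {B : ℝ}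
    (hA : ∀ θ ∈ Icc (0 : ℝ) 1, ∀ j, |∫ ω, fderiv ℝ g (fun j => (S j).integral X ω)
      (Pi.single j 1) * deriv f (interpolate X (a, b, θ) ω) ∂P - A j| ≤ ε)
    (hB : ∀ θ ∈ Icc (0 : ℝ) 1, |∫ ω, g (fun j => (S j).integral X ω)
      * deriv (deriv f) (interpolate X (a, b, θ) ω) ∂P - B| ≤ ε) :
    |∫ ω, g (fun j => (S j).integral X ω) * f (X b ω) ∂P
        - ∫ ω, g (fun j => (S j).integral X ω) * f (X a ω) ∂P
        - (∑ j, form μ (S j).toFun ((Ioc a b).indicator fun _ => 1) * A j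
          + 1 / 2 * maxForm μ ((Ioc a b).indicator fun _ => 1) * B)|
      ≤ ε * (∑ j, |form μ (S j).toFun ((Ioc a b).indicator fun _ => 1)|
        + |form μ ((Iic a).indicator fun _ => 1) ((Ioc a b).indicator fun _ => 1)|
        + |form μ ((Ioc a b).indicator fun _ => 1) ((Ioc a b).indicator fun _ => 1)|) := by
  have hε : 0 ≤ ε := (abs_nonneg _).trans (hB 0 (by simp))
  set c : Fin n → ℝ := fun j => form μ (S j).toFun ((Ioc a b).indicator fun _ => 1) with hc
  set ρ := form μ ((Iic a).indicator fun _ => 1) ((Ioc a b).indicator fun _ => 1) with hρ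
  set v := form μ ((Ioc a b).indicator fun _ => 1) ((Ioc a b).indicator fun _ => 1) with hv
  set A' : ℝ → Fin n → ℝ := fun θ j => ∫ ω, fderiv ℝ g (fun j => (S j).integral X ω)
      (Pi.single j 1) * deriv f (interpolate X (a, b, θ) ω) ∂P with hA'
  set B' : ℝ → ℝ := fun θ => ∫ ω, g (fun j => (S j).integral X ω)
      * deriv (deriv f) (interpolate X (a, b, θ) ω) ∂P with hB'
  have hWm : Measurable fun ω => fun j => (S j).integral X ω :=
    measurable_pi_lambda _ fun j => (S j).measurable_integral hX
  have hq : IsBoundedMeasurable fun ω => g (fun j => (S j).integral X ω) :=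
    ⟨(hg.contDiff (k := 1)).continuous.measurable.comp hWm,
      hg.exists_bound.imp fun _ h ω => h _⟩
  -- The primitive of the derivative with frozen coefficients `A`, `B` is subtracted. Its increment
  -- over [0,1] is ∑ c_j A_j + (ρ + v/2) B, where ρ + v/2 is half the mass of the L-shaped region;
  -- the mean value inequality bounds the rest.
  have hder : ∀ θ, HasDerivAt (fun θ => ∫ ω, g (fun j => (S j).integral X ω)
      * f (interpolate X (a, b, θ) ω) ∂P - (θ * ∑ j, c j * A j + (ρ * θ + v * θ ^ 2 / 2) * B))
      (∑ j, c j * (A' θ j - A j) + (ρ + θ * v) * (B' θ - B)) θ := by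
    intro θ
    have h1 := hasDerivAt_integral_interpolate hX hq hf hC a b θ
    rw [integral_sub_mul_interpolate hT hX hμ hg S hf hC hab θ] at h1
    have h2 : HasDerivAt (fun θ : ℝ => θ * ∑ j, c j * A j + (ρ * θ + v * θ ^ 2 / 2) * B)
        (∑ j, c j * A j + (ρ + θ * v) * B) θ := by
      have := ((hasDerivAt_id θ).mul_const (∑ j, c j * A j)).add
        (((hasDerivAt_id θ).const_mul ρ).add
          ((((hasDerivAt_id θ).pow 2).const_mul v).div_const 2) |>.mul_const B)
      convert! this using 1
      simp only [id, Nat.cast_ofNat, Nat.add_one_sub_one, pow_one]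
      ring
    convert! h1.sub h2 using 1
    simp_rw [mul_sub, Finset.sum_sub_distrib]
    ring
  have mv := (convex_Icc (0 : ℝ) 1).norm_image_sub_le_of_norm_hasDerivWithin_le
    (C := ε * (∑ j, |c j| + |ρ| + |v|)) (fun θ _ => (hder θ).hasDerivWithinAt) (fun θ hθ => ?_)
    (left_mem_Icc.mpr zero_le_one) (right_mem_Icc.mpr zero_le_one)
  · have e1 : ∀ ω, interpolate X (a, b, 1) ω = X b ω := fun ω => by simp [interpolate]
    have e0 : ∀ ω, interpolate X (a, b, 0) ω = X a ω := fun ω => by simp [interpolate]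
    simp only [e1, e0] at mv
    rw [maxForm_indicator hT hX hμ hab]
    convert! mv using 1
    · rw [Real.norm_eq_abs]
      congr 1
      ring
    · rw [sub_zero, norm_one, mul_one]
  · have hθ' : |θ| ≤ 1 := abs_le.mpr ⟨by linarith [hθ.1], hθ.2⟩
    calc ‖∑ j, c j * (A' θ j - A j) + (ρ + θ * v) * (B' θ - B)‖
        ≤ ∑ j, |c j| * |A' θ j - A j| + (|ρ| + |θ| * |v|) * |B' θ - B| := by
          refine (norm_add_le _ _).trans (add_le_add ?_ ?_)
          · refine (norm_sum_le _ _).trans (le_of_eq ?_)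
            simp
          · rw [norm_mul]
            refine mul_le_mul_of_nonneg_right ?_ (norm_nonneg _)
            rw [← abs_mul]
            exact abs_add_le _ _
      _ ≤ ∑ j, |c j| * ε + (|ρ| + 1 * |v|) * ε := by
          gcongr with j
          · exact hA θ hθ j
          · exact hB θ hθ
      _ = _ := by
          rw [← Finset.sum_mul]
          ring

/-- The evolution of `E (G f(X_t))` for a smooth cylindrical variable `G`. -/
theorem integral_mul_comp_sub_eq {n : ℕ} {g : (Fin n → ℝ) → ℝ}
    (hg : IsSmoothBounded g) (S : Fin n → Elementary T) {f : ℝ → ℝ} (hf : ContDiff ℝ 2 f)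
    {C : ℝ} (hC : ∀ x, |deriv (deriv f) x| ≤ C) (t : Icc (0 : ℝ) T) :
    ∫ ω, g (fun j => (S j).integral X ω) * f (X t ω) ∂P
        - ∫ ω, g (fun j => (S j).integral X ω) * f (X ⟨0, le_rfl, hT.le⟩ ω) ∂P
      = ∑ j, form μ (S j).toFun ((Iic t).indicator fun s =>
          ∫ ω, fderiv ℝ g (fun j => (S j).integral X ω) (Pi.single j 1) * deriv f (X s ω) ∂P)
        + 1 / 2 * maxForm μ ((Iic t).indicator fun s =>
          ∫ ω, g (fun j => (S j).integral X ω) * deriv (deriv f) (X s ω) ∂P) := by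
  have hWm : Measurable fun ω => fun j => (S j).integral X ω :=
    measurable_pi_lambda _ fun j => (S j).measurable_integral hX
  have hq : IsBoundedMeasurable fun ω => g (fun j => (S j).integral X ω) :=
    ⟨(hg.contDiff (k := 1)).continuous.measurable.comp hWm,
      hg.exists_bound.imp fun _ h ω => h _⟩
  obtain ⟨B₁, hB₁⟩ := hg.exists_fderiv_bound
  have hq' : ∀ j, IsBoundedMeasurable fun ω =>
      fderiv ℝ g (fun j => (S j).integral X ω) (Pi.single j 1) := fun j =>
    ⟨(((hg.contDiff (k := 1)).continuous_fderiv (by simp)).clm_apply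
      continuous_const).measurable.comp hWm, B₁ * ‖(Pi.single j 1 : Fin n → ℝ)‖, fun ω =>
      ((fderiv ℝ g _).le_opNorm _).trans (by gcongr; exact hB₁ _)⟩
  have hf1 : ContDiff ℝ 1 (deriv f) := by
    have := (contDiff_succ_iff_deriv (n := 1)).mp hf
    exact this.2.2
  have hlip : ∀ x y, |deriv f x - deriv f y| ≤ C * |x - y| := fun x y =>
    convex_univ.norm_image_sub_le_of_norm_deriv_le (𝕜 := ℝ) (f := deriv f)
      (fun z _ => hf1.differentiable one_ne_zero z) (fun z _ => hC z) (mem_univ y) (mem_univ x)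
  let A : Icc (0 : ℝ) T × Icc (0 : ℝ) T × ℝ → Fin n → ℝ := fun k j =>
    ∫ ω, fderiv ℝ g (fun j => (S j).integral X ω) (Pi.single j 1)
      * deriv f (interpolate X k ω) ∂P
  let B : Icc (0 : ℝ) T × Icc (0 : ℝ) T × ℝ → ℝ := fun k =>
    ∫ ω, g (fun j => (S j).integral X ω) * deriv (deriv f) (interpolate X k ω) ∂P
  have hAc : Continuous A := continuous_pi fun j =>
    continuous_integral_mul_comp_of_lipschitz hX (hq' j) hlip
  have hBc : Continuous B :=
    continuous_integral_mul_comp_of_bounded hX hq (hf1.continuous_deriv le_rfl) hC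
  -- Restricting θ to [0,1] makes the parameter space compact, so a single δ serves all
  -- coefficients.
  let Φ : Icc (0 : ℝ) T × Icc (0 : ℝ) T × Icc (0 : ℝ) 1 → (Fin n → ℝ) × ℝ := fun k =>
    (A (k.1, k.2.1, k.2.2), B (k.1, k.2.1, k.2.2))
  have hΦ : UniformContinuous Φ := CompactSpace.uniformContinuous_of_continuous
    ((hAc.comp (by fun_prop)).prodMk (hBc.comp (by fun_prop)))
  let α : Fin n → Icc (0 : ℝ) T → ℝ := fun j s =>
    ∫ ω, fderiv ℝ g (fun j => (S j).integral X ω) (Pi.single j 1) * deriv f (X s ω) ∂P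
  let β : Icc (0 : ℝ) T → ℝ := fun s =>
    ∫ ω, g (fun j => (S j).integral X ω) * deriv (deriv f) (X s ω) ∂P
  have hdiag : ∀ s θ, interpolate X (s, s, θ) = X s := fun s θ => by
    ext ω; simp [interpolate]
  have hAα : ∀ s θ j, A (s, s, θ) j = α j s := fun s θ j => by simp only [A, α, hdiag]
  have hBβ : ∀ s θ, B (s, s, θ) = β s := fun s θ => by simp only [B, β, hdiag]
  have hα : ∀ j, IsBoundedMeasurable (α j) := fun j => by
    apply isBoundedMeasurable_of_continuous
    have : α j = fun s => A (s, s, 0) j := funext fun s => (hAα s 0 j).symm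
    rw [this]
    exact (continuous_apply j).comp (hAc.comp (by fun_prop))
  have hβ : IsBoundedMeasurable β := by
    apply isBoundedMeasurable_of_continuous
    have : β = fun s => B (s, s, 0) := funext fun s => (hBβ s 0).symm
    rw [this]
    exact hBc.comp (by fun_prop)
  choose D hD using fun j => (S j).isBoundedMeasurable.bounded
  let z : Icc (0 : ℝ) T := ⟨0, le_rfl, hT.le⟩
  have hD0 : ∀ j, 0 ≤ D j := fun j => (abs_nonneg _).trans (hD j z)
  let M₂ : Icc (0 : ℝ) T → ℝ := fun s => μ.variation.real (Prod.snd ⁻¹' Iic s)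
  let M₃ : Icc (0 : ℝ) T → ℝ := fun s => μ.variation.real ((fun p => max p.1 p.2) ⁻¹' Iic s)
  have hM₃ : Monotone M₃ := fun a b hab =>
    measureReal_mono (preimage_mono (Iic_subset_Iic.mpr hab))
  have hM₂ : Monotone M₂ := fun a b hab =>
    measureReal_mono (preimage_mono (Iic_subset_Iic.mpr hab))
  -- The defect of the claimed identity, up to its value at 0. It is constant because its increments
  -- are at most ε times those of a monotone function.
  let N : Icc (0 : ℝ) T → ℝ := fun s => ∫ ω, g (fun j => (S j).integral X ω) * f (X s ω) ∂P
    - ∑ j, form μ (S j).toFun ((Iic s).indicator (α j)) - 1 / 2 * maxForm μ ((Iic s).indicator β)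
  have hconst : N z = N t := by
    -- One ∑ D_j comes from freezing the coefficients along the interpolation and one from the
    -- oscillation of `α` over ]a,b]; the 2 comes from the two masses multiplying E(G f''), and `M₃`
    -- from the oscillation of `β`.
    refine eq_of_abs_sub_le_mul N (fun s => (2 * ∑ j, D j + 2) * M₂ s + M₃ s) (fun ε hε => ?_)
      (show z ≤ t from t.2.1)
    obtain ⟨δ, hδ, H⟩ := Metric.uniformContinuous_iff.mp hΦ ε hε
    refine ⟨δ, hδ, fun a b hab hlt => ?_⟩
    have hd : ∀ s ∈ Icc a b, dist s a < δ := fun s hs => by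
      have h1 : (a : ℝ) ≤ s := hs.1
      have h2 : (s : ℝ) ≤ b := hs.2
      rw [Subtype.dist_eq, Real.dist_eq, abs_of_nonneg (by linarith)]
      linarith
    have hΦ' : ∀ k k', dist k k' < δ → (∀ j, |(Φ k).1 j - (Φ k').1 j| ≤ ε) ∧
        |(Φ k).2 - (Φ k').2| ≤ ε := by
      intro k k' hk
      have := H hk
      rw [Prod.dist_eq, max_lt_iff] at this
      exact ⟨fun j => (dist_le_pi_dist (Φ k).1 (Φ k').1 j).trans this.1.le, this.2.le⟩
    have h1 : ∀ θ ∈ Icc (0 : ℝ) 1, (∀ j, |A (a, b, θ) j - α j a| ≤ ε) ∧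
        |B (a, b, θ) - β a| ≤ ε := by
      intro θ hθ
      have := hΦ' (a, b, ⟨θ, hθ⟩) (a, a, ⟨θ, hθ⟩) (by
        simp only [Prod.dist_eq, dist_self]
        simpa using hd b ⟨hab, le_rfl⟩)
      simpa only [Φ, hAα, hBβ] using this
    have h2 : ∀ s ∈ Ioc a b, (∀ j, |α j a - α j s| ≤ ε) ∧ |β a - β s| ≤ ε := by
      intro s hs
      have := hΦ' (a, a, ⟨0, by simp⟩) (s, s, ⟨0, by simp⟩) (by
        simp only [Prod.dist_eq, dist_self]
        have := hd s ⟨hs.1.le, hs.2⟩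
        rw [dist_comm] at this
        simpa using this)
      simpa only [Φ, hAα, hBβ] using this
    have E1 := abs_integral_sub_sub_le hT hX hμ hg S hf hC hab
      (fun θ hθ => (h1 θ hθ).1) (fun θ hθ => (h1 θ hθ).2)
    have hind : IsBoundedMeasurable ((Ioc a b).indicator fun _ => (1 : ℝ)) :=
      (IsBoundedMeasurable.const 1).indicator measurableSet_Ioc
    have d2 : ∀ j, form μ (S j).toFun ((Iic b).indicator (α j))
        - form μ (S j).toFun ((Iic a).indicator (α j))
        = form μ (S j).toFun ((Ioc a b).indicator (α j)) := fun j => by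
      rw [← form_sub_right (S j).isBoundedMeasurable ((hα j).indicator measurableSet_Iic)
        ((hα j).indicator measurableSet_Iic)]
      simp_rw [indicator_Iic_sub_indicator_Iic hab]
    have d3 : maxForm μ ((Iic b).indicator β) - maxForm μ ((Iic a).indicator β)
        = maxForm μ ((Ioc a b).indicator β) := by
      rw [← maxForm_sub (hβ.indicator measurableSet_Iic) (hβ.indicator measurableSet_Iic)]
      simp_rw [indicator_Iic_sub_indicator_Iic hab]
    have e2 : ∀ j, form μ (S j).toFun ((Ioc a b).indicator fun _ => 1) * α j a
        - form μ (S j).toFun ((Ioc a b).indicator (α j))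
        = form μ (S j).toFun ((Ioc a b).indicator fun s => α j a - α j s) := fun j => by
      rw [mul_comm, ← form_const_mul_right, ← form_sub_right (S j).isBoundedMeasurable
        (hind.const_mul _) ((hα j).indicator measurableSet_Ioc)]
      congr 1
      ext s
      by_cases hs : s ∈ Ioc a b <;> simp [hs]
    have e3 : maxForm μ ((Ioc a b).indicator fun _ => 1) * β a
        - maxForm μ ((Ioc a b).indicator β)
        = maxForm μ ((Ioc a b).indicator fun s => β a - β s) := by
      rw [mul_comm, ← maxForm_const_mul, ← maxForm_sub (hind.const_mul _)
        (hβ.indicator measurableSet_Ioc)]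
      congr 1
      ext s
      by_cases hs : s ∈ Ioc a b <;> simp [hs]
    have b2 : ∀ j, |form μ (S j).toFun ((Ioc a b).indicator fun s => α j a - α j s)|
        ≤ D j * ε * (M₂ b - M₂ a) := fun j =>
      abs_form_le (hD j) hab (fun s hs => by rw [indicator_of_mem hs]; exact (h2 s hs).1 j)
        (fun s hs => by rw [indicator_of_notMem hs])
    have b3 : |maxForm μ ((Ioc a b).indicator fun s => β a - β s)| ≤ ε * (M₃ b - M₃ a) :=
      abs_maxForm_le hab (fun s hs => by rw [indicator_of_mem hs]; exact (h2 s hs).2)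
        (fun s hs => by rw [indicator_of_notMem hs])
    have i1 : ∀ s ∈ Ioc a b, |(Ioc a b).indicator (fun _ => (1 : ℝ)) s| ≤ 1 := fun s hs => by
      rw [indicator_of_mem hs]; simp
    have i0 : ∀ s ∉ Ioc a b, (Ioc a b).indicator (fun _ => (1 : ℝ)) s = 0 := fun s hs => by
      rw [indicator_of_notMem hs]
    have c2 : ∀ j, |form μ (S j).toFun ((Ioc a b).indicator fun _ => 1)|
        ≤ D j * 1 * (M₂ b - M₂ a) := fun j => abs_form_le (hD j) hab i1 i0
    have ind1 : ∀ (U : Set (Icc (0 : ℝ) T)) s, |U.indicator (fun _ => (1 : ℝ)) s| ≤ 1 := by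
      intro U s
      by_cases hs : s ∈ U <;> simp [hs]
    have c3 : |form μ ((Iic a).indicator fun _ => 1) ((Ioc a b).indicator fun _ => 1)|
        ≤ 1 * 1 * (M₂ b - M₂ a) := abs_form_le (ind1 _) hab i1 i0
    have c4 : |form μ ((Ioc a b).indicator fun _ => 1) ((Ioc a b).indicator fun _ => 1)|
        ≤ 1 * 1 * (M₂ b - M₂ a) := abs_form_le (ind1 _) hab i1 i0
    set R := ∫ ω, g (fun j => (S j).integral X ω) * f (X b ω) ∂P
        - ∫ ω, g (fun j => (S j).integral X ω) * f (X a ω) ∂P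
        - (∑ j, form μ (S j).toFun ((Ioc a b).indicator fun _ => 1) * α j a
          + 1 / 2 * maxForm μ ((Ioc a b).indicator fun _ => 1) * β a) with hR
    -- `R` uses the coefficients at the left endpoint `a`; the other two terms correct for their
    -- variation over ]a,b].
    have split : N b - N a = R
        + ∑ j, form μ (S j).toFun ((Ioc a b).indicator fun s => α j a - α j s)
        + 1 / 2 * maxForm μ ((Ioc a b).indicator fun s => β a - β s) := by
      simp_rw [← e2, ← e3, ← d2, ← d3, Finset.sum_sub_distrib]
      simp only [N, hR]
      ring
    have s1 : |∑ j, form μ (S j).toFun ((Ioc a b).indicator fun s => α j a - α j s)|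
        ≤ (∑ j, D j) * ε * (M₂ b - M₂ a) := by
      refine (Finset.abs_sum_le_sum_abs _ _).trans ((Finset.sum_le_sum fun j _ => b2 j).trans ?_)
      rw [Finset.sum_mul, Finset.sum_mul]
    have s2 : ∑ j, |form μ (S j).toFun ((Ioc a b).indicator fun _ => 1)|
        ≤ (∑ j, D j) * (M₂ b - M₂ a) := by
      refine (Finset.sum_le_sum fun j _ => c2 j).trans ?_
      simp_rw [mul_one]
      rw [Finset.sum_mul]
    have hmono := hM₃ hab
    have r1 : |R| ≤ ε * ((∑ j, D j) * (M₂ b - M₂ a) + (M₂ b - M₂ a) + (M₂ b - M₂ a)) :=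
      E1.trans (mul_le_mul_of_nonneg_left (by linarith) hε.le)
    have r3 : |1 / 2 * maxForm μ ((Ioc a b).indicator fun s => β a - β s)|
        ≤ ε * (M₃ b - M₃ a) := by
      rw [abs_mul, abs_of_pos (by norm_num : (0 : ℝ) < 1 / 2)]
      have := abs_nonneg (maxForm μ ((Ioc a b).indicator fun s => β a - β s))
      linarith
    rw [split]
    refine (abs_add_three _ _ _).trans ?_
    calc _ ≤ ε * ((∑ j, D j) * (M₂ b - M₂ a) + (M₂ b - M₂ a) + (M₂ b - M₂ a))
          + (∑ j, D j) * ε * (M₂ b - M₂ a) + ε * (M₃ b - M₃ a) := by linarith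
      _ = _ := by ring
  have hz2 : ∀ j, form μ (S j).toFun ((Iic z).indicator (α j)) = 0 := fun j => by
    rw [form_congr_right hμ _ (ψ' := fun _ => 0), form_zero_right]
    intro s hs
    rw [indicator_of_notMem]
    intro h
    exact hs (le_antisymm h s.2.1)
  have hz3 : maxForm μ ((Iic z).indicator β) = 0 := by
    refine integral_eq_zero_of_ae ?_
    filter_upwards [ae_ne_zero hμ] with p hp
    rw [indicator_of_notMem]
    · simp
    · intro h
      exact hp.1 (le_antisymm ((le_max_left p.1 p.2).trans h) p.1.2.1)
  simp only [N, hz2, hz3] at hconst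
  simp only [Finset.sum_const_zero, mul_zero, sub_zero] at hconst
  change _ = ∑ j, form μ (S j).toFun ((Iic t).indicator (α j))
    + 1 / 2 * maxForm μ ((Iic t).indicator β)
  change ∫ ω, g (fun j => (S j).integral X ω) * f (X t ω) ∂P
    - ∫ ω, g (fun j => (S j).integral X ω) * f (X z ω) ∂P = _
  linarith

end

end SkorohodIto

/-! ### Extension of duality to all cylindrical variables -/

namespace SkorohodIto

variable {T : ℝ} {Ω : Type*} [MeasurableSpace Ω] {X : Icc (0 : ℝ) T → Ω → ℝ}
  {P : Measure Ω} {μ : SignedMeasure (Icc (0 : ℝ) T × Icc (0 : ℝ) T)}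

/-- Lipschitz functions are continuous from `L²` to `L²`. -/
theorem tendsto_eLpNorm_comp_of_lipschitz {n : ℕ} {h : (Fin n → ℝ) → ℝ} {C : ℝ}
    (hC : ∀ x y, |h x - h y| ≤ C * ‖x - y‖) {W : ℕ → Fin n → Ω → ℝ} {W₀ : Fin n → Ω → ℝ}
    (hW : ∀ k j, AEStronglyMeasurable (W k j) P) (hW₀ : ∀ j, AEStronglyMeasurable (W₀ j) P)
    (hlim : ∀ j, Tendsto (fun k => eLpNorm (fun ω => W k j ω - W₀ j ω) 2 P) atTop (𝓝 0)) :
    Tendsto (fun k => eLpNorm (fun ω => h (fun j => W k j ω) - h (fun j => W₀ j ω)) 2 P) atTop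
      (𝓝 0) := by
  have hb : ∀ k, eLpNorm (fun ω => h (fun j => W k j ω) - h (fun j => W₀ j ω)) 2 P
      ≤ ENNReal.ofReal |C| * ∑ j, eLpNorm (fun ω => W k j ω - W₀ j ω) 2 P := by
    intro k
    calc _ ≤ ENNReal.ofReal |C| * eLpNorm (∑ j, fun ω => ‖W k j ω - W₀ j ω‖) 2 P := by
          refine eLpNorm_le_mul_eLpNorm_of_ae_le_mul (ae_of_all _ fun ω => ?_) 2
          rw [Real.norm_eq_abs, Finset.sum_apply, Real.norm_of_nonneg
            (Finset.sum_nonneg fun j _ => norm_nonneg _)]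
          refine (hC _ _).trans (mul_le_mul (le_abs_self C) ?_ (norm_nonneg _) (abs_nonneg _))
          refine (pi_norm_le_iff_of_nonneg (Finset.sum_nonneg fun j _ => norm_nonneg _)).mpr
            fun i => ?_
          exact Finset.single_le_sum (f := fun j => ‖W k j ω - W₀ j ω‖)
            (fun j _ => norm_nonneg _) (Finset.mem_univ i)
      _ ≤ _ := by
          gcongr
          refine (eLpNorm_sum_le (fun j _ => ((hW k j).sub (hW₀ j)).norm) one_le_two).trans
            (le_of_eq ?_)
          exact Finset.sum_congr rfl fun j _ => eLpNorm_norm _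
  have h0 : Tendsto (fun k => ENNReal.ofReal |C| *
      ∑ j, eLpNorm (fun ω => W k j ω - W₀ j ω) 2 P) atTop (𝓝 0) := by
    have := ENNReal.Tendsto.const_mul (tendsto_finsetSum Finset.univ fun j _ => hlim j)
      (Or.inr (ENNReal.ofReal_ne_top (r := |C|)))
    simpa using this
  exact tendsto_of_tendsto_of_tendsto_of_le_of_le tendsto_const_nhds h0 (fun _ => zero_le) hb

theorem measurable_form_process {φ : Icc (0 : ℝ) T → ℝ} (hφ : Measurable φ)
    {u : Icc (0 : ℝ) T → Ω → ℝ} (hu : Measurable (Function.uncurry u)) :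
    Measurable fun ω => form μ φ fun s => u s ω := by
  have : Measurable fun q : Ω × (Icc (0 : ℝ) T × Icc (0 : ℝ) T) =>
      φ q.2.1 * (u q.2.2 q.1 * signDensity μ q.2) := by
    refine Measurable.mul (hφ.comp (measurable_fst.comp measurable_snd)) (Measurable.mul ?_ ?_)
    · exact hu.comp ((measurable_snd.comp measurable_snd).prodMk measurable_fst)
    · exact (measurable_signDensity μ).comp measurable_snd
  exact (this.stronglyMeasurable.integral_prod_right (ν := μ.variation)).measurable

theorem measurable_absNormSq_process {u : Icc (0 : ℝ) T → Ω → ℝ}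
    (hu : Measurable (Function.uncurry u)) :
    Measurable fun ω => absNormSq μ fun s => u s ω := by
  have : Measurable fun q : Ω × (Icc (0 : ℝ) T × Icc (0 : ℝ) T) =>
      ‖u q.2.1 q.1‖ₑ * ‖u q.2.2 q.1‖ₑ := by
    exact (hu.comp ((measurable_fst.comp measurable_snd).prodMk measurable_fst)).enorm.mul
      (hu.comp ((measurable_snd.comp measurable_snd).prodMk measurable_fst)).enorm
  exact this.lintegral_prod_right'

theorem memLp_sqrt_absNormSq {u : Icc (0 : ℝ) T → Ω → ℝ} (hu : Measurable (Function.uncurry u))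
    (h2 : ∫⁻ ω, absNormSq μ (fun s => u s ω) ∂P < ∞) :
    MemLp (fun ω => √(absNormSq μ fun s => u s ω).toReal) 2 P := by
  have hm := (measurable_absNormSq_process (μ := μ) hu)
  rw [memLp_two_iff_integrable_sq hm.ennreal_toReal.sqrt.aestronglyMeasurable]
  simp_rw [Real.sq_sqrt ENNReal.toReal_nonneg]
  exact integrable_toReal_of_lintegral_ne_top hm.aemeasurable h2.ne

section

variable [IsProbabilityMeasure P] (hT : 0 < T) (hX : IsContinuousCenteredGaussian X P)
  (hμ : IsCovarianceMeasure X P μ) {u : Icc (0 : ℝ) T → Ω → ℝ}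

include hT hX hμ

theorem measurable_innerH_process {φ : Icc (0 : ℝ) T → ℝ} (hφ : MemLMu μ φ)
    (hu : Measurable (Function.uncurry u)) (hb : ∀ ω, IsBoundedMeasurable fun s => u s ω) :
    Measurable fun ω => innerH μ φ fun s => u s ω :=
  measurable_of_tendsto_metrizable
    (fun n : ℕ => measurable_form_process (isBoundedMeasurable_truncation hφ.1 n).measurable hu)
    (tendsto_pi_nhds.mpr fun ω => tendsto_form_truncation_left hT hX hμ hφ (hb ω))

/-- The error splits into a deterministic distance and a norm of ψ. For ψ a path of u, the latter is
square integrable in ω. The absolute value under the root makes nonnegativity of the expanded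
distance unnecessary. -/
theorem abs_innerH_sub_le {φ χ ψ : Icc (0 : ℝ) T → ℝ} (hφ : MemLMu μ φ)
    (hχ : IsBoundedMeasurable χ) (hψ : IsBoundedMeasurable ψ) :
    |innerH μ χ ψ - innerH μ φ ψ| ≤ √|distSqH μ χ φ| * √(absNormSq μ ψ).toReal := by
  rw [← Real.sqrt_mul (abs_nonneg _)]
  apply Real.abs_le_sqrt
  refine (innerH_sub_sq_le hT hX hμ hφ hψ hχ).trans ?_
  exact mul_le_mul (le_abs_self _) (form_self_le hψ) (form_self_nonneg hT hX hμ hψ)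
    (abs_nonneg _)

theorem abs_innerH_le {φ ψ : Icc (0 : ℝ) T → ℝ} (hφ : MemLMu μ φ)
    (hψ : IsBoundedMeasurable ψ) :
    |innerH μ φ ψ| ≤ √|innerH μ φ φ| * √(absNormSq μ ψ).toReal := by
  rw [← Real.sqrt_mul (abs_nonneg _)]
  apply Real.abs_le_sqrt
  refine (innerH_sq_le hT hX hμ hφ hψ).trans ?_
  exact mul_le_mul (le_abs_self _) (form_self_le hψ) (form_self_nonneg hT hX hμ hψ)
    (abs_nonneg _)

/-- The duality relation of the Skorohod integral extends from smooth functions of integrals of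
elementary integrands to all cylindrical variables. -/
theorem duality_of_elementary (hu : Measurable (Function.uncurry u))
    (hb : ∀ ω, IsBoundedMeasurable fun s => u s ω)
    (h2 : ∫⁻ ω, absNormSq μ (fun s => u s ω) ∂P < ∞) {Z : Ω → ℝ} (hZ : MemLp Z 2 P)
    (h : ∀ (n : ℕ) (g : (Fin n → ℝ) → ℝ) (S : Fin n → Elementary T), IsSmoothBounded g →
      ∫ ω, g (fun j => (S j).integral X ω) * Z ω ∂P
        = ∑ j, ∫ ω, fderiv ℝ g (fun j => (S j).integral X ω) (Pi.single j 1)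
          * form μ (S j).toFun (fun s => u s ω) ∂P)
    (F : Cyl X P μ) : ∫ ω, F.value ω * Z ω ∂P = ∫ ω, F.innerDeriv u ω ∂P := by
  have hN := memLp_sqrt_absNormSq hu h2
  choose hW S hS hSW using F.isWiener
  obtain ⟨C₀, hC₀⟩ := F.smooth.exists_bound
  obtain ⟨C₁, hC₁⟩ := F.smooth.exists_fderiv_bound
  obtain ⟨C₂, hC₂⟩ := F.smooth.exists_fderiv_lipschitz
  have hgc : Continuous F.f := (F.smooth.contDiff (k := 1)).continuous
  have hdc : ∀ j, Continuous fun x => fderiv ℝ F.f x (Pi.single j 1) := fun j =>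
    ((F.smooth.contDiff (k := 1)).continuous_fderiv (by simp)).clm_apply continuous_const
  have hSm : ∀ k j, AEStronglyMeasurable ((S j k).integral X) P := fun k j =>
    ((S j k).measurable_integral hX).aestronglyMeasurable
  have hWk : ∀ k, AEMeasurable (fun ω => fun j => (S j k).integral X ω) P := fun k =>
    aemeasurable_pi_lambda _ fun j => (hSm k j).aemeasurable
  have hW₀ : AEMeasurable (fun ω => fun j => F.wiener j ω) P :=
    aemeasurable_pi_lambda _ fun j => (hW j).1.aemeasurable
  have hlip₀ : ∀ x y, |F.f x - F.f y| ≤ C₁ * ‖x - y‖ := fun x y =>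
    convex_univ.norm_image_sub_le_of_norm_fderiv_le (𝕜 := ℝ) (f := F.f)
      (fun z _ => (F.smooth.contDiff (k := 1)).differentiable one_ne_zero z)
      (fun z _ => hC₁ z) (mem_univ y) (mem_univ x)
  have hone : ∀ j, ‖(Pi.single j 1 : Fin F.n → ℝ)‖ = 1 := fun j => by
    rw [Pi.norm_single, norm_one]
  have hlip₁ : ∀ j x y, |fderiv ℝ F.f x (Pi.single j 1) - fderiv ℝ F.f y (Pi.single j 1)|
      ≤ C₂ * ‖x - y‖ := fun j x y => by
    rw [← sub_apply, ← Real.norm_eq_abs]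
    refine ((fderiv ℝ F.f x - fderiv ℝ F.f y).le_opNorm _).trans ?_
    rw [hone, mul_one]
    exact hC₂ x y
  have hbd : ∀ j x, |fderiv ℝ F.f x (Pi.single j 1)| ≤ C₁ := fun j x => by
    refine ((fderiv ℝ F.f x).le_opNorm _).trans ?_
    rw [hone, mul_one]
    exact hC₁ x
  have memg : ∀ {W : Ω → Fin F.n → ℝ}, AEMeasurable W P → MemLp (fun ω => F.f (W ω)) 2 P :=
    fun hW => MemLp.of_bound (hgc.measurable.comp_aemeasurable hW).aestronglyMeasurable C₀
      (ae_of_all _ fun ω => hC₀ _)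
  have memd : ∀ j {W : Ω → Fin F.n → ℝ}, AEMeasurable W P →
      MemLp (fun ω => fderiv ℝ F.f (W ω) (Pi.single j 1)) 2 P :=
    fun j _ hW => MemLp.of_bound ((hdc j).measurable.comp_aemeasurable hW).aestronglyMeasurable
      C₁ (ae_of_all _ fun ω => hbd j _)
  have hφS : ∀ j k, IsBoundedMeasurable (S j k).toFun := fun j k => (S j k).isBoundedMeasurable
  have memq : ∀ j, MemLp (fun ω => innerH μ (F.φ j) fun s => u s ω) 2 P := fun j =>
    (hN.const_mul √|innerH μ (F.φ j) (F.φ j)|).mono'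
      (measurable_innerH_process hT hX hμ (F.mem j) hu hb).aestronglyMeasurable
      (ae_of_all _ fun ω => abs_innerH_le hT hX hμ (F.mem j) (hb ω))
  have hdiff : ∀ j k ω, |form μ (S j k).toFun (fun s => u s ω) - innerH μ (F.φ j) fun s => u s ω|
      ≤ √|distSqH μ (S j k).toFun (F.φ j)| * √(absNormSq μ fun s => u s ω).toReal :=
    fun j k ω => by
      rw [← innerH_eq_form (hφS j k) (hb ω)]
      exact abs_innerH_sub_le hT hX hμ (F.mem j) (hφS j k) (hb ω)
  have memqd : ∀ j k, MemLp (fun ω => form μ (S j k).toFun (fun s => u s ω)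
      - innerH μ (F.φ j) fun s => u s ω) 2 P := fun j k =>
    (hN.const_mul _).mono' ((measurable_form_process (hφS j k).measurable hu).sub
      (measurable_innerH_process hT hX hμ (F.mem j) hu hb)).aestronglyMeasurable
      (ae_of_all _ fun ω => hdiff j k ω)
  have memqk : ∀ j k, MemLp (fun ω => form μ (S j k).toFun (fun s => u s ω)) 2 P := fun j k => by
    refine ((memqd j k).add (memq j)).ae_eq (ae_of_all _ fun ω => ?_)
    exact sub_add_cancel _ _
  -- ⟨S_k, u⟩ converges to ⟨φ, u⟩ in L²(Ω), because the difference is at most the distance of S_k to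
  -- φ times ‖u‖_{|H|}.
  have tq : ∀ j, Tendsto (fun k => eLpNorm (fun ω => form μ (S j k).toFun (fun s => u s ω)
      - innerH μ (F.φ j) fun s => u s ω) 2 P) atTop (𝓝 0) := fun j => by
    have h0 : Tendsto (fun k => ENNReal.ofReal √|distSqH μ (S j k).toFun (F.φ j)| *
        eLpNorm (fun ω => √(absNormSq μ fun s => u s ω).toReal) 2 P) atTop (𝓝 0) := by
      have h1 : Tendsto (fun k => √|distSqH μ (S j k).toFun (F.φ j)|) atTop (𝓝 0) := by
        simpa using (hS j).abs.sqrt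
      have := ENNReal.Tendsto.mul_const (ENNReal.tendsto_ofReal h1) (Or.inr hN.2.ne)
      simpa using this
    refine tendsto_of_tendsto_of_tendsto_of_le_of_le tendsto_const_nhds h0 (fun _ => zero_le)
      fun k => eLpNorm_le_mul_eLpNorm_of_ae_le_mul (ae_of_all _ fun ω => ?_) 2
    rw [Real.norm_of_nonneg (Real.sqrt_nonneg _)]
    exact hdiff j k ω
  -- `F.f` and its partial derivatives are Lipschitz, so they carry the L² convergence of the Wiener
  -- integrals; products of L² limits then converge in L¹ on both sides of the duality.
  have tl := tendsto_integral_mul_of_tendsto_eLpNorm (fun k => memg (hWk k)) (fun _ : ℕ => hZ)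
    (memg hW₀) hZ (tendsto_eLpNorm_comp_of_lipschitz hlip₀ (W := fun k j => (S j k).integral X)
      hSm (fun j => (hW j).1) hSW) (by simp)
  have tr : ∀ j, _ := fun j => tendsto_integral_mul_of_tendsto_eLpNorm
    (fun k => memd j (hWk k)) (fun k => memqk j k) (memd j hW₀) (memq j)
    (tendsto_eLpNorm_comp_of_lipschitz (hlip₁ j) (W := fun k j => (S j k).integral X)
      hSm (fun j => (hW j).1) hSW) (tq j)
  have tr' := tendsto_finsetSum Finset.univ fun j _ => tr j
  simp_rw [h _ _ _ F.smooth] at tl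
  have e := tendsto_nhds_unique tl tr'
  refine e.trans ?_
  exact (integral_finsetSum _ fun j _ => (memd j hW₀).integrable_mul (memq j)).symm

end

end SkorohodIto

/-! ### Fubini, measurability and stopping -/

namespace SkorohodIto

variable {T : ℝ} {Ω : Type*} [MeasurableSpace Ω] {X : Icc (0 : ℝ) T → Ω → ℝ}
  {P : Measure Ω} {μ : SignedMeasure (Icc (0 : ℝ) T × Icc (0 : ℝ) T)}

theorem integrable_prod_of_lintegral_le {α β : Type*} [MeasurableSpace α] [MeasurableSpace β]
    {m : Measure α} {ν : Measure β} [SFinite m] [IsFiniteMeasure ν] {F : α × β → ℝ}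
    (hF : Measurable F) {M : ℝ≥0∞} (hM : M ≠ ∞) (h : ∀ y, ∫⁻ x, ‖F (x, y)‖ₑ ∂m ≤ M) :
    Integrable F (m.prod ν) := by
  refine ⟨hF.aestronglyMeasurable, ?_⟩
  rw [HasFiniteIntegral, lintegral_prod_symm _ hF.enorm.aemeasurable]
  refine (lintegral_mono h).trans_lt ?_
  rw [lintegral_const]
  exact ENNReal.mul_lt_top hM.lt_top (measure_lt_top _ _)

/-- Fubini's theorem for the product of a bounded variable and a process integrated against a
bounded weight. -/
theorem integral_mul_integral_comp {α β : Type*} [MeasurableSpace α] [MeasurableSpace β]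
    {ν : Measure β} [IsFiniteMeasure ν] [SFinite P] {v : α → Ω → ℝ}
    (hv : Measurable (Function.uncurry v)) {M : ℝ≥0∞} (hM : M ≠ ∞)
    (hvM : ∀ s, ∫⁻ ω, ‖v s ω‖ₑ ∂P ≤ M) {q : Ω → ℝ} (hq : IsBoundedMeasurable q) {r : β → α}
    (hr : Measurable r) {w : β → ℝ} (hw : IsBoundedMeasurable w) :
    ∫ ω, q ω * ∫ p, v (r p) ω * w p ∂ν ∂P = ∫ p, (∫ ω, q ω * v (r p) ω ∂P) * w p ∂ν := by
  obtain ⟨C, hC⟩ := hq.bounded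
  obtain ⟨D, hD⟩ := hw.bounded
  have e : ∀ x : Ω × β, ‖q x.1 * (v (r x.2) x.1 * w x.2)‖ₑ
      ≤ ENNReal.ofReal C * ENNReal.ofReal D * ‖v (r x.2) x.1‖ₑ := fun x => by
    rw [enorm_mul, enorm_mul, mul_comm ‖v _ _‖ₑ, ← mul_assoc]
    gcongr
    · rw [Real.enorm_eq_ofReal_abs]; exact ENNReal.ofReal_le_ofReal (hC _)
    · rw [Real.enorm_eq_ofReal_abs]; exact ENNReal.ofReal_le_ofReal (hD _)
  have hi : Integrable (fun x : Ω × β => q x.1 * (v (r x.2) x.1 * w x.2)) (P.prod ν) := by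
    refine integrable_prod_of_lintegral_le (M := ENNReal.ofReal C * ENNReal.ofReal D * M)
      ?_ (by finiteness) fun y => ?_
    · exact (hq.measurable.comp measurable_fst).mul
        ((hv.comp ((hr.comp measurable_snd).prodMk measurable_fst)).mul
          (hw.measurable.comp measurable_snd))
    · refine (lintegral_mono fun x => e (x, y)).trans ?_
      rw [lintegral_const_mul' _ _ (by finiteness)]
      gcongr
      exact hvM (r y)
  simp_rw [← integral_const_mul, ← integral_mul_const]
  rw [integral_integral_swap hi]
  simp_rw [mul_assoc]

theorem integral_mul_form [SFinite P] {v : Icc (0 : ℝ) T → Ω → ℝ}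
    (hv : Measurable (Function.uncurry v)) {M : ℝ≥0∞} (hM : M ≠ ∞)
    (hvM : ∀ s, ∫⁻ ω, ‖v s ω‖ₑ ∂P ≤ M) {q : Ω → ℝ} (hq : IsBoundedMeasurable q)
    {φ : Icc (0 : ℝ) T → ℝ} (hφ : IsBoundedMeasurable φ) :
    ∫ ω, q ω * form μ φ (fun s => v s ω) ∂P = form μ φ fun s => ∫ ω, q ω * v s ω ∂P := by
  have := integral_mul_integral_comp (ν := μ.variation) hv hM hvM hq measurable_snd
    ((hφ.comp measurable_fst).mul ⟨measurable_signDensity μ, 1, abs_signDensity_le μ⟩)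
  simpa only [form, mul_left_comm] using this

theorem integral_mul_maxForm [SFinite P] {v : Icc (0 : ℝ) T → Ω → ℝ}
    (hv : Measurable (Function.uncurry v)) {M : ℝ≥0∞} (hM : M ≠ ∞)
    (hvM : ∀ s, ∫⁻ ω, ‖v s ω‖ₑ ∂P ≤ M) {q : Ω → ℝ} (hq : IsBoundedMeasurable q) :
    ∫ ω, q ω * maxForm μ (fun s => v s ω) ∂P = maxForm μ fun s => ∫ ω, q ω * v s ω ∂P :=
  integral_mul_integral_comp (ν := μ.variation) hv hM hvM hq (measurable_fst.max measurable_snd)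
    ⟨measurable_signDensity μ, 1, abs_signDensity_le μ⟩

theorem lintegral_absNormSq_le [SFinite P] {v : Icc (0 : ℝ) T → Ω → ℝ}
    (hv : Measurable (Function.uncurry v)) {M : ℝ≥0∞} (hvM : ∀ s, ∫⁻ ω, ‖v s ω‖ₑ ^ 2 ∂P ≤ M) :
    ∫⁻ ω, absNormSq μ (fun s => v s ω) ∂P ≤ 2 * M * μ.variation univ := by
  have hv1 : ∀ s, Measurable (v s) := fun s => hv.comp measurable_prodMk_left
  have hm : Measurable fun q : Ω × (Icc (0 : ℝ) T × Icc (0 : ℝ) T) =>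
      ‖v q.2.1 q.1‖ₑ * ‖v q.2.2 q.1‖ₑ :=
    (hv.comp ((measurable_fst.comp measurable_snd).prodMk measurable_fst)).enorm.mul
      (hv.comp ((measurable_snd.comp measurable_snd).prodMk measurable_fst)).enorm
  unfold absNormSq
  rw [lintegral_lintegral_swap hm.aemeasurable]
  rw [← lintegral_const]
  refine lintegral_mono fun p => ?_
  calc ∫⁻ ω, ‖v p.1 ω‖ₑ * ‖v p.2 ω‖ₑ ∂P
      ≤ ∫⁻ ω, (‖v p.1 ω‖ₑ ^ 2 + ‖v p.2 ω‖ₑ ^ 2) ∂P := by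
        refine lintegral_mono fun ω => ?_
        rcases le_total ‖v p.1 ω‖ₑ ‖v p.2 ω‖ₑ with h | h
        · exact (mul_le_mul_left h _).trans (by rw [← sq]; exact le_add_self)
        · exact (mul_le_mul_right h _).trans (by rw [← sq]; exact le_self_add)
    _ ≤ 2 * M := by
        rw [lintegral_add_left ((hv1 _).enorm.pow_const 2), two_mul]
        exact add_le_add (hvM _) (hvM _)

theorem measurable_maxForm_process {v : Icc (0 : ℝ) T → Ω → ℝ}
    (hv : Measurable (Function.uncurry v)) :
    Measurable fun ω => maxForm μ fun s => v s ω := by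
  have : Measurable fun q : Ω × (Icc (0 : ℝ) T × Icc (0 : ℝ) T) =>
      v (max q.2.1 q.2.2) q.1 * signDensity μ q.2 :=
    Measurable.mul (hv.comp (((measurable_fst.comp measurable_snd).max
      (measurable_snd.comp measurable_snd)).prodMk measurable_fst))
      ((measurable_signDensity μ).comp measurable_snd)
  exact (this.stronglyMeasurable.integral_prod_right (ν := μ.variation)).measurable

theorem measurable_uncurry_stopAt {v : Icc (0 : ℝ) T → Ω → ℝ}
    (hv : Measurable (Function.uncurry v)) (t : Icc (0 : ℝ) T) :
    Measurable (Function.uncurry (stopAt v t)) := by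
  have : Function.uncurry (stopAt v t)
      = (Prod.fst ⁻¹' Iic t).indicator (Function.uncurry v) := by
    ext ⟨s, ω⟩
    by_cases hs : s ∈ Iic t <;> simp [stopAt, Function.uncurry, hs]
  rw [this]
  exact hv.indicator (measurable_fst measurableSet_Iic)

omit [MeasurableSpace Ω] in
theorem stopAt_apply (v : Icc (0 : ℝ) T → Ω → ℝ) (t : Icc (0 : ℝ) T) (ω : Ω) :
    (fun s => stopAt v t s ω) = (Iic t).indicator fun s => v s ω := by
  ext s
  by_cases hs : s ∈ Iic t <;> simp [stopAt, hs]

omit [MeasurableSpace Ω] in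
theorem stopAt_top (hT : 0 < T) (v : Icc (0 : ℝ) T → Ω → ℝ) :
    stopAt v ⟨T, hT.le, le_rfl⟩ = v := by
  ext s ω
  have : s ∈ Iic (⟨T, hT.le, le_rfl⟩ : Icc (0 : ℝ) T) := s.2.2
  simp [stopAt, this]

end SkorohodIto

/-! ### The Itô remainder is a Skorohod integral -/

namespace SkorohodIto

variable {T : ℝ} {Ω : Type*} [MeasurableSpace Ω] {X : Icc (0 : ℝ) T → Ω → ℝ}
  {P : Measure Ω} {μ : SignedMeasure (Icc (0 : ℝ) T × Icc (0 : ℝ) T)}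

/-- The variable `f(X_t) - f(X_0) - ½ ∫∫_{max ≤ t} f''(X_{max(u,v)}) dμ(u,v)`. -/
noncomputable def itoRemainder (hT : 0 < T) (X : Icc (0 : ℝ) T → Ω → ℝ)
    (μ : SignedMeasure (Icc (0 : ℝ) T × Icc (0 : ℝ) T)) (f : ℝ → ℝ) (t : Icc (0 : ℝ) T)
    (ω : Ω) : ℝ :=
  f (X t ω) - f (X ⟨0, le_rfl, hT.le⟩ ω)
    - 1 / 2 * maxForm μ fun s => stopAt (fun s ω => deriv (deriv f) (X s ω)) t s ω

theorem measurable_uncurry_comp (hX : ∀ t, Measurable (X t))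
    (hc : ∀ ω, Continuous fun t => X t ω) {h : ℝ → ℝ} (hh : Continuous h) :
    Measurable (Function.uncurry fun s ω => h (X s ω)) :=
  measurable_uncurry_of_continuous_of_measurable (fun ω => hh.comp (hc ω))
    fun s => hh.measurable.comp (hX s)

theorem measurable_itoRemainder (hT : 0 < T) (hX : ∀ t, Measurable (X t))
    (hc : ∀ ω, Continuous fun t => X t ω) {f : ℝ → ℝ} (hf : ContDiff ℝ 2 f)
    (t : Icc (0 : ℝ) T) : Measurable (itoRemainder hT X μ f t) := by
  have hf2 : Continuous (deriv (deriv f)) :=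
    (((contDiff_succ_iff_deriv (n := 1)).mp hf).2.2).continuous_deriv le_rfl
  refine ((hf.continuous.measurable.comp (hX _)).sub (hf.continuous.measurable.comp (hX _))).sub
    (Measurable.const_mul ?_ _)
  exact measurable_maxForm_process (measurable_uncurry_stopAt
    (measurable_uncurry_comp hX hc hf2) t)

theorem abs_maxForm_le_of_bounded {h : Icc (0 : ℝ) T → ℝ} {C : ℝ} (hC : ∀ s, |h s| ≤ C) :
    |maxForm μ h| ≤ C * μ.variation.real univ := by
  have hb : ∀ p : Icc (0 : ℝ) T × Icc (0 : ℝ) T,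
      ‖h (max p.1 p.2) * signDensity μ p‖ ≤ C := fun p => by
    rw [norm_mul]
    exact (mul_le_of_le_one_right (norm_nonneg _) (abs_signDensity_le μ p)).trans (hC _)
  exact norm_integral_le_of_norm_le_const (ae_of_all _ hb)

/-- f grows at most quadratically and Gaussian variables have fourth moments. -/
theorem IsContinuousCenteredGaussian.memLp_comp (hX : IsContinuousCenteredGaussian X P)
    [IsProbabilityMeasure P] {f : ℝ → ℝ}
    (hf : ContDiff ℝ 2 f) {C : ℝ} (hC : ∀ x, |deriv (deriv f) x| ≤ C) (t : Icc (0 : ℝ) T) :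
    MemLp (fun ω => f (X t ω)) 2 P := by
  have h4 : Integrable (fun ω => ‖X t ω‖ ^ 4) P :=
    ((hX.gaussian.hasGaussianLaw_eval t).memLp
      (by simp : ((4 : ℕ) : ℝ≥0∞) ≠ ∞)).integrable_norm_pow (by simp)
  have hsq : MemLp (fun ω => |X t ω| * |X t ω|) 2 P := by
    have hm := (hX.measurable t).abs
    refine (memLp_two_iff_integrable_sq (hm.mul hm).aestronglyMeasurable).mpr ?_
    refine h4.congr (ae_of_all _ fun ω => ?_)
    simp only [Real.norm_eq_abs, Pi.mul_apply]
    ring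
  have hb : MemLp (fun ω => |f 0| + (|deriv f 0| + C) * (|X t ω| + |X t ω| * |X t ω|)) 2 P := by
    have h1 : MemLp (fun ω => |X t ω|) 2 P := (hX.memLp t).norm
    have h2 : MemLp (fun ω => |X t ω| + |X t ω| * |X t ω|) 2 P := h1.add hsq
    have h3 := h2.const_mul (|deriv f 0| + C)
    exact (memLp_const (μ := P) (p := 2) |f 0|).add h3
  refine hb.mono' (hf.continuous.measurable.comp (hX.measurable t)).aestronglyMeasurable
    (ae_of_all _ fun ω => ?_)
  have := abs_le_of_abs_deriv_deriv_le hf hC (X t ω)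
  rw [Real.norm_eq_abs]
  linarith

section

variable [IsProbabilityMeasure P] (hT : 0 < T) (hX : IsContinuousCenteredGaussian X P)
  (hμ : IsCovarianceMeasure X P μ) {f : ℝ → ℝ} (hf : ContDiff ℝ 2 f) {C : ℝ}
  (hC : ∀ x, |deriv (deriv f) x| ≤ C)

include hX hf hC in
theorem memLp_itoRemainder (t : Icc (0 : ℝ) T) : MemLp (itoRemainder hT X μ f t) 2 P := by
  have hC0 : 0 ≤ C := (abs_nonneg _).trans (hC 0)
  refine ((hX.memLp_comp hf hC t).sub (hX.memLp_comp hf hC _)).sub (MemLp.const_mul ?_ _)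
  have hf2 : Continuous (deriv (deriv f)) :=
    (((contDiff_succ_iff_deriv (n := 1)).mp hf).2.2).continuous_deriv le_rfl
  refine MemLp.of_bound (measurable_maxForm_process (measurable_uncurry_stopAt
    (measurable_uncurry_comp hX.measurable hX.continuous_paths hf2) t)).aestronglyMeasurable
    (C * μ.variation.real univ) (ae_of_all _ fun ω => abs_maxForm_le_of_bounded fun s => ?_)
  by_cases hs : s ∈ Iic t
  · simpa [stopAt, hs] using hC _
  · simpa [stopAt, hs] using hC0

include hT hX hμ

theorem variance_le_variation (s : Icc (0 : ℝ) T) : Var[X s; P] ≤ μ.variation.real univ := by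
  let z : Icc (0 : ℝ) T := ⟨0, le_rfl, hT.le⟩
  have h1 := form_elementary hX hμ (Elementary.single z s s.2.1) (Elementary.single z s s.2.1)
  have h2 : (Elementary.single z s s.2.1).integral X =ᵐ[P] X s := by
    filter_upwards [hX.start_zero z rfl] with ω hω
    rw [Elementary.single_integral, hω, sub_zero]
  rw [covariance_self ((Elementary.memLp_integral _ hX).aestronglyMeasurable.aemeasurable),
    variance_congr h2] at h1
  rw [← h1]
  refine (le_abs_self _).trans ?_
  have h3 : ∀ r, |(Elementary.single z s s.2.1).toFun r| ≤ 1 := fun r => by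
    rw [Elementary.single_toFun]
    by_cases hr : r ∈ Ioc z s <;> simp [hr]
  have hb : ∀ p : Icc (0 : ℝ) T × Icc (0 : ℝ) T, ‖(Elementary.single z s s.2.1).toFun p.1
      * ((Elementary.single z s s.2.1).toFun p.2 * signDensity μ p)‖ ≤ 1 := fun p => by
    rw [norm_mul, norm_mul]
    exact mul_le_one₀ (h3 _) (by positivity)
      (mul_le_one₀ (h3 _) (norm_nonneg _) (abs_signDensity_le μ p))
  exact (norm_integral_le_of_norm_le_const (ae_of_all _ hb)).trans (one_mul _).le

include hf hC

/-- f' has linear growth and all variances are at most |μ|([0,T]²). Uniformity in s is what Fubini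
and the bound of E‖u‖²_{|H|} require. -/
theorem exists_lintegral_deriv_sq_le : ∃ M : ℝ≥0∞, M ≠ ∞ ∧
    ∀ t s, ∫⁻ ω, ‖stopAt (fun s ω => deriv f (X s ω)) t s ω‖ₑ ^ 2 ∂P ≤ M := by
  have hC0 : 0 ≤ C := (abs_nonneg _).trans (hC 0)
  refine ⟨ENNReal.ofReal (2 * |deriv f 0| ^ 2 + 2 * C ^ 2 * μ.variation.real univ),
    ENNReal.ofReal_ne_top, fun t s => ?_⟩
  have hi : Integrable (fun ω => 2 * |deriv f 0| ^ 2 + 2 * C ^ 2 * X s ω ^ 2) P :=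
    (integrable_const _).add ((hX.memLp s).integrable_sq.const_mul _)
  have hv : ∫ ω, X s ω ^ 2 ∂P ≤ μ.variation.real univ := by
    refine le_trans (le_of_eq ?_) (variance_le_variation hT hX hμ s)
    rw [variance_of_integral_eq_zero (hX.measurable s).aemeasurable (hX.centered s)]
  calc _ ≤ ∫⁻ ω, ENNReal.ofReal (2 * |deriv f 0| ^ 2 + 2 * C ^ 2 * X s ω ^ 2) ∂P := by
        refine lintegral_mono fun ω => ?_
        have h1 : |stopAt (fun s ω => deriv f (X s ω)) t s ω| ≤ |deriv f 0| + C * |X s ω| := by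
          by_cases hs : s ∈ Iic t
          · simpa [stopAt, hs] using abs_deriv_le_of_abs_deriv_deriv_le hf hC (X s ω)
          · simp only [stopAt, indicator_of_notMem hs, Pi.zero_apply, abs_zero]
            positivity
        rw [Real.enorm_eq_ofReal_abs, ← ENNReal.ofReal_pow (abs_nonneg _)]
        refine ENNReal.ofReal_le_ofReal ((pow_le_pow_left₀ (abs_nonneg _) h1 2).trans ?_)
        rw [← sq_abs (X s ω)]
        nlinarith [sq_nonneg (|deriv f 0| - C * |X s ω|)]
    _ = ENNReal.ofReal (∫ ω, (2 * |deriv f 0| ^ 2 + 2 * C ^ 2 * X s ω ^ 2) ∂P) :=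
        (ofReal_integral_eq_lintegral_ofReal hi (ae_of_all _ fun ω => by positivity)).symm
    _ ≤ _ := by
        refine ENNReal.ofReal_le_ofReal ?_
        rw [integral_add (integrable_const _) ((hX.memLp s).integrable_sq.const_mul _)]
        simp only [integral_const, probReal_univ, one_smul]
        rw [integral_const_mul]
        exact add_le_add le_rfl (mul_le_mul_of_nonneg_left hv (by positivity))

theorem lintegral_absNormSq_deriv_lt_top (t : Icc (0 : ℝ) T) :
    ∫⁻ ω, absNormSq μ (fun s => stopAt (fun s ω => deriv f (X s ω)) t s ω) ∂P < ∞ := by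
  obtain ⟨M, hM, h⟩ := exists_lintegral_deriv_sq_le hT hX hμ hf hC
  refine (lintegral_absNormSq_le (measurable_uncurry_stopAt (measurable_uncurry_comp hX.measurable
    hX.continuous_paths ((hf.continuous_deriv (by norm_num)))) t) (h t)).trans_lt ?_
  exact ENNReal.mul_lt_top (ENNReal.mul_lt_top (by simp) hM.lt_top) (measure_lt_top _ _)

/-- The duality relation for smooth functions of integrals of elementary integrands. -/
theorem integral_mul_itoRemainder {n : ℕ} {g : (Fin n → ℝ) → ℝ} (hg : IsSmoothBounded g)
    (S : Fin n → Elementary T) (t : Icc (0 : ℝ) T) :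
    ∫ ω, g (fun j => (S j).integral X ω) * itoRemainder hT X μ f t ω ∂P
      = ∑ j, ∫ ω, fderiv ℝ g (fun j => (S j).integral X ω) (Pi.single j 1)
        * form μ (S j).toFun (fun s => stopAt (fun s ω => deriv f (X s ω)) t s ω) ∂P := by
  have hWm : Measurable fun ω => fun j => (S j).integral X ω :=
    measurable_pi_lambda _ fun j => (S j).measurable_integral hX
  have hq : IsBoundedMeasurable fun ω => g (fun j => (S j).integral X ω) :=
    ⟨(hg.contDiff (k := 1)).continuous.measurable.comp hWm,
      hg.exists_bound.imp fun _ h ω => h _⟩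
  obtain ⟨B₁, hB₁⟩ := hg.exists_fderiv_bound
  have hq' : ∀ j, IsBoundedMeasurable fun ω =>
      fderiv ℝ g (fun j => (S j).integral X ω) (Pi.single j 1) := fun j =>
    ⟨(((hg.contDiff (k := 1)).continuous_fderiv (by simp)).clm_apply
      continuous_const).measurable.comp hWm, B₁ * ‖(Pi.single j 1 : Fin n → ℝ)‖, fun ω =>
      ((fderiv ℝ g _).le_opNorm _).trans (by gcongr; exact hB₁ _)⟩
  have hf1 : ContDiff ℝ 1 (deriv f) := ((contDiff_succ_iff_deriv (n := 1)).mp hf).2.2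
  have hC0 : 0 ≤ C := (abs_nonneg _).trans (hC 0)
  have hm1 := measurable_uncurry_stopAt
    (measurable_uncurry_comp hX.measurable hX.continuous_paths hf1.continuous) t
  have hm2 := measurable_uncurry_stopAt (measurable_uncurry_comp hX.measurable
    hX.continuous_paths (hf1.continuous_deriv le_rfl)) t
  have hI : ∀ (q : Ω → ℝ) (h : ℝ → ℝ), (fun s => ∫ ω, q ω * stopAt (fun s ω => h (X s ω)) t s ω ∂P)
      = (Iic t).indicator fun s => ∫ ω, q ω * h (X s ω) ∂P := fun q h => by
    ext s
    by_cases hs : s ∈ Iic t <;> simp [stopAt, hs]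
  obtain ⟨M, hM, h⟩ := exists_lintegral_deriv_sq_le hT hX hμ hf hC
  have hb1 : ∀ s, ∫⁻ ω, ‖stopAt (fun s ω => deriv f (X s ω)) t s ω‖ₑ ∂P ≤ 1 + M := fun s => by
    refine (lintegral_mono (g := fun ω =>
      1 + ‖stopAt (fun s ω => deriv f (X s ω)) t s ω‖ₑ ^ 2) fun ω => ?_).trans ?_
    · rcases le_total ‖stopAt (fun s ω => deriv f (X s ω)) t s ω‖ₑ 1 with h1 | h1
      · exact h1.trans le_self_add
      · exact (le_self_pow h1 two_ne_zero).trans le_add_self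
    · rw [lintegral_add_left measurable_const]
      exact add_le_add (by simp) (h t s)
  have hb2 : ∀ s, ∫⁻ ω, ‖stopAt (fun s ω => deriv (deriv f) (X s ω)) t s ω‖ₑ ∂P
      ≤ ENNReal.ofReal C := fun s => by
    refine (lintegral_mono (g := fun _ => ENNReal.ofReal C) fun ω => ?_).trans (by simp)
    rw [Real.enorm_eq_ofReal_abs]
    refine ENNReal.ofReal_le_ofReal ?_
    by_cases hs : s ∈ Iic t
    · simpa [stopAt, hs] using hC _
    · simpa [stopAt, hs] using hC0
  -- The evolution identity has expectations inside the integrals against μ; Fubini moves them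
  -- outside, which yields duality.
  have key := integral_mul_comp_sub_eq hT hX hμ hg S hf hC t
  simp_rw [← hI] at key
  rw [← integral_mul_maxForm hm2 ENNReal.ofReal_ne_top hb2 hq] at key
  simp_rw [← integral_mul_form hm1 (by finiteness) hb1 (hq' _) (S _).isBoundedMeasurable] at key
  have i1 : ∀ s, Integrable (fun ω => g (fun j => (S j).integral X ω) * f (X s ω)) P := fun s => by
    obtain ⟨D, hD⟩ := hq.bounded
    exact ((hX.memLp_comp hf hC s).integrable one_le_two).bdd_mul
      hq.measurable.aestronglyMeasurable (ae_of_all _ hD)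
  have i2 : Integrable (fun ω => g (fun j => (S j).integral X ω)
      * maxForm μ (fun s => stopAt (fun s ω => deriv (deriv f) (X s ω)) t s ω)) P := by
    refine (hq.mul ⟨measurable_maxForm_process hm2, C * μ.variation.real univ, fun ω =>
      abs_maxForm_le_of_bounded fun s => ?_⟩).integrable P
    by_cases hs : s ∈ Iic t
    · simpa [stopAt, hs] using hC _
    · simpa [stopAt, hs] using hC0
  have i12 := (i1 t).sub (i1 ⟨0, le_rfl, hT.le⟩)
  refine (integral_congr_ae (ae_of_all _ fun ω => ?_)).trans
    ((integral_sub i12 (i2.const_mul (1 / 2))).trans ?_)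
  · simp only [itoRemainder, Pi.sub_apply]
    ring
  · rw [integral_sub' (i1 t) (i1 _), integral_const_mul, key]
    ring

theorem isSkorohodIntegral_itoRemainder (t : Icc (0 : ℝ) T) :
    IsSkorohodIntegral X P μ (stopAt (fun s ω => deriv f (X s ω)) t)
      (itoRemainder hT X μ f t) where
  memLp := memLp_itoRemainder hT hX hf hC t
  aestronglyMeasurable := by
    refine (Measurable.stronglyMeasurable ?_).aestronglyMeasurable
    -- The remainder depends on the path of X alone, so its measurability can be proved with Ω
    -- carrying the σ-algebra generated by X.
    refine @measurable_itoRemainder T Ω (⨆ t, MeasurableSpace.comap (X t) (borel ℝ)) X μ hT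
      (fun t => ?_) hX.continuous_paths f hf t
    rw [← BorelSpace.measurable_eq (α := ℝ)]
    exact (comap_measurable (X t)).mono (le_iSup (fun t => MeasurableSpace.comap (X t) _) t) le_rfl
  centered := by
    -- Duality against the constant 1, a function of no variables, whose derivative is an empty sum.
    have := integral_mul_itoRemainder hT hX hμ hf hC (n := 0) (g := fun _ => 1)
      ⟨contDiff_const, fun k => ⟨1, fun x => by
        rcases k with _ | k
        · simp
        · simp [iteratedFDeriv_const_of_ne (𝕜 := ℝ) (Nat.succ_ne_zero k)]⟩⟩ (fun j => j.elim0) t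
    simpa using this
  duality := by
    have hf1 : Continuous (deriv f) := hf.continuous_deriv (by norm_num)
    refine duality_of_elementary hT hX hμ (measurable_uncurry_stopAt
      (measurable_uncurry_comp hX.measurable hX.continuous_paths hf1) t) (fun ω => ?_)
      (lintegral_absNormSq_deriv_lt_top hT hX hμ hf hC t) (memLp_itoRemainder hT hX hf hC t)
      fun n g S hg => integral_mul_itoRemainder hT hX hμ hf hC hg S t
    rw [stopAt_apply]
    exact (isBoundedMeasurable_of_continuous (hf1.comp (hX.continuous_paths ω))).indicator
      measurableSet_Iic

theorem memSkorohodDomain_stopAt (t : Icc (0 : ℝ) T) :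
    MemSkorohodDomain X P μ (stopAt (fun s ω => deriv f (X s ω)) t) :=
  ⟨measurable_uncurry_stopAt (measurable_uncurry_comp hX.measurable hX.continuous_paths
    (hf.continuous_deriv (by norm_num))) t, lintegral_absNormSq_deriv_lt_top hT hX hμ hf hC t, _,
    isSkorohodIntegral_itoRemainder hT hX hμ hf hC t⟩

end

end SkorohodIto

/-! ### Uniqueness of the Skorohod integral -/

namespace SkorohodIto

variable {T : ℝ} {Ω : Type*} [MeasurableSpace Ω] {X : Icc (0 : ℝ) T → Ω → ℝ}
  {P : Measure Ω} {μ : SignedMeasure (Icc (0 : ℝ) T × Icc (0 : ℝ) T)}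

theorem IsSmoothBounded.of_hasCompactSupport {n : ℕ} {g : (Fin n → ℝ) → ℝ}
    (hg : ContDiff ℝ ((⊤ : ℕ∞) : WithTop ℕ∞) g) (hs : HasCompactSupport g) : IsSmoothBounded g :=
  ⟨hg, fun k => (hg.continuous_iteratedFDeriv (by exact_mod_cast le_top)).bounded_above_of_compact_support
    (hs.iteratedFDeriv k)⟩

/-- An integrable variable that is orthogonal to the smooth functions of a random vector `V` with
compact support has zero conditional expectation given `V`. -/
theorem setIntegral_eq_zero_of_forall_integral_comp_mul_eq_zero [IsProbabilityMeasure P] {n : ℕ}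
    {V : Ω → Fin n → ℝ} (hV : Measurable V) {D : Ω → ℝ} (hD : Integrable D P)
    (h : ∀ g : (Fin n → ℝ) → ℝ, ContDiff ℝ ((⊤ : ℕ∞) : WithTop ℕ∞) g → HasCompactSupport g →
      ∫ ω, g (V ω) * D ω ∂P = 0) {A : Set Ω}
    (hA : MeasurableSet[MeasurableSpace.comap V inferInstance] A) : ∫ ω in A, D ω ∂P = 0 := by
  have hle : MeasurableSpace.comap V inferInstance ≤ ‹MeasurableSpace Ω› := hV.comap_le
  -- The conditional expectation of `D` is `k ∘ V`. Orthogonality to smooth functions of `V` means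
  -- that `k` integrates to zero against test functions under the law of `V`, hence vanishes almost
  -- everywhere.
  obtain ⟨k, hk, hkV⟩ := (stronglyMeasurable_condExp (μ := P) (f := D)
    (m := MeasurableSpace.comap V inferInstance)).exists_eq_measurable_comp
  have hcond : Integrable (k ∘ V) P := hkV ▸ integrable_condExp
  have hki : Integrable k (P.map V) :=
    (integrable_map_measure hk.aestronglyMeasurable hV.aemeasurable).mpr hcond
  have hk0 : ∀ᵐ x ∂P.map V, k x = 0 := by
    refine ae_eq_zero_of_integral_contDiff_smul_eq_zero hki.locallyIntegrable fun g hg hs => ?_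
    obtain ⟨C, hC⟩ := hg.continuous.bounded_above_of_compact_support hs
    have hgV : StronglyMeasurable[MeasurableSpace.comap V inferInstance] fun ω => g (V ω) :=
      (hg.continuous.measurable.comp (comap_measurable V)).stronglyMeasurable
    have hgD : Integrable (fun ω => g (V ω) * D ω) P :=
      hD.bdd_mul (hgV.mono hle).aestronglyMeasurable (ae_of_all _ fun ω => hC _)
    have hgk : AEStronglyMeasurable (fun x => g x • k x) (P.map V) :=
      (hg.continuous.stronglyMeasurable.smul hk).aestronglyMeasurable
    rw [integral_map hV.aemeasurable hgk, ← h g hg hs]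
    refine Eq.trans (integral_congr_ae ?_) (integral_condExp hle)
    filter_upwards [condExp_mul_of_stronglyMeasurable_left hgV hgD hD] with ω hω
    refine Eq.trans ?_ hω.symm
    rw [Pi.mul_apply, hkV]
    rfl
  rw [← setIntegral_condExp hle hD hA, hkV]
  refine setIntegral_eq_zero_of_ae_eq_zero ?_
  filter_upwards [ae_of_ae_map hV.aemeasurable hk0] with ω hω _
  exact hω

/-- The integrand is elementary, so a constant sequence approximates it. Thus smooth compactly
supported functions of finitely many values of X are cylindrical, and they suffice to test
uniqueness. -/
theorem isWienerIntegral_apply [IsProbabilityMeasure P] (hT : 0 < T)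
    (hX : IsContinuousCenteredGaussian X P)
    (t : Icc (0 : ℝ) T) : MemLMu μ ((Ioc ⟨0, le_rfl, hT.le⟩ t).indicator fun _ => 1) ∧
      IsWienerIntegral X P μ ((Ioc ⟨0, le_rfl, hT.le⟩ t).indicator fun _ => 1) (X t) := by
  have hb : IsBoundedMeasurable ((Ioc (⟨0, le_rfl, hT.le⟩ : Icc (0 : ℝ) T) t).indicator
      fun _ => (1 : ℝ)) := (IsBoundedMeasurable.const 1).indicator measurableSet_Ioc
  refine ⟨⟨hb.measurable, ?_⟩, hX.memLp t, fun _ => Elementary.single ⟨0, le_rfl, hT.le⟩ t t.2.1, ?_, ?_⟩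
  · have := ((hb.prod hb).integrable μ.variation).2
    rw [HasFiniteIntegral] at this
    simpa only [absNormSq, enorm_mul] using this
  · simp only [Elementary.single_toFun, distSqH]
    ring_nf
    exact tendsto_const_nhds
  · refine tendsto_const_nhds.congr fun _ => ?_
    refine ((eLpNorm_congr_ae ?_).trans eLpNorm_zero).symm
    filter_upwards [hX.start_zero ⟨0, le_rfl, hT.le⟩ rfl] with ω hω
    rw [Elementary.single_integral, hω, sub_zero, sub_self, Pi.zero_apply]

/-- The Skorohod integral is almost surely unique. -/
theorem IsSkorohodIntegral.ae_eq [IsProbabilityMeasure P] (hT : 0 < T)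
    (hX : IsContinuousCenteredGaussian X P) {u : Icc (0 : ℝ) T → Ω → ℝ} {Z₁ Z₂ : Ω → ℝ}
    (h₁ : IsSkorohodIntegral X P μ u Z₁) (h₂ : IsSkorohodIntegral X P μ u Z₂) : Z₁ =ᵐ[P] Z₂ := by
  have i₁ := h₁.memLp.integrable one_le_two
  have i₂ := h₂.memLp.integrable one_le_two
  have iD := i₁.sub i₂
  have hm : ∀ t, MeasurableSpace.comap (X t) (borel ℝ) ≤ ‹MeasurableSpace Ω› := fun t => by
    rw [← BorelSpace.measurable_eq (α := ℝ)]
    exact (hX.measurable t).comap_le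
  have hle : ⨆ t, MeasurableSpace.comap (X t) (borel ℝ) ≤ ‹MeasurableSpace Ω› := iSup_le hm
  have horth : ∀ (n : ℕ) (e : Fin n → Icc (0 : ℝ) T) (g : (Fin n → ℝ) → ℝ),
      ContDiff ℝ ((⊤ : ℕ∞) : WithTop ℕ∞) g → HasCompactSupport g →
      ∫ ω, g (fun j => X (e j) ω) * (Z₁ - Z₂) ω ∂P = 0 := by
    intro n e g hg hs
    have hsm := IsSmoothBounded.of_hasCompactSupport hg hs
    obtain ⟨C, hC⟩ := hsm.exists_bound
    let F : Cyl X P μ := ⟨n, g, hsm, _, fun j => (isWienerIntegral_apply hT hX (e j)).1,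
      fun j => X (e j), fun j => (isWienerIntegral_apply hT hX (e j)).2⟩
    have hgm : AEStronglyMeasurable (fun ω => g fun j => X (e j) ω) P :=
      (hg.continuous.measurable.comp
        (measurable_pi_lambda _ fun j => hX.measurable (e j))).aestronglyMeasurable
    have b₁ := i₁.bdd_mul hgm (ae_of_all _ fun ω => hC _)
    have b₂ := i₂.bdd_mul hgm (ae_of_all _ fun ω => hC _)
    simp_rw [Pi.sub_apply, mul_sub]
    rw [integral_sub b₁ b₂, sub_eq_zero]
    exact (h₁.duality F).trans (h₂.duality F).symm
  have key : ∀ A, MeasurableSet[⨆ t, MeasurableSpace.comap (X t) (borel ℝ)] A →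
      ∫ ω in A, (Z₁ - Z₂) ω ∂P = 0 := by
    have hgen := generateFrom_piiUnionInter_measurableSet
      (fun t => MeasurableSpace.comap (X t) (borel ℝ)) univ
    simp only [mem_univ, iSup_pos] at hgen
    -- Finite-dimensional cylinder events form a π-system generating the σ-algebra of X. The two
    -- integrals have the same integral over each of them, and equality of their means handles
    -- complements.
    refine MeasurableSpace.induction_on_inter hgen.symm
      (isPiSystem_piiUnionInter _ (fun t => @MeasurableSpace.isPiSystem_measurableSet _
        (MeasurableSpace.comap (X t) (borel ℝ))) univ) ?_ ?_ ?_ ?_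
    · simp
    · rintro A ⟨I, -, B, hB, rfl⟩
      let e : Fin I.card → Icc (0 : ℝ) T := fun j => (I.equivFin.symm j : Icc (0 : ℝ) T)
      refine setIntegral_eq_zero_of_forall_integral_comp_mul_eq_zero
        (V := fun ω j => X (e j) ω) (measurable_pi_lambda _ fun j => hX.measurable (e j)) iD
        (horth _ e) ?_
      refine Finset.measurableSet_biInter _ fun t ht => ?_
      obtain ⟨B', hB', hBB'⟩ := hB t ht
      refine ⟨(fun x => x (I.equivFin ⟨t, ht⟩)) ⁻¹' B', ?_, ?_⟩
      · rw [← BorelSpace.measurable_eq (α := ℝ)] at hB'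
        exact (measurable_pi_apply _) hB'
      · rw [← hBB', ← preimage_comp]
        congr 1
        ext ω
        simp [e]
    · intro A hA h0
      have := integral_add_compl (hle _ hA) iD
      have hc : ∫ ω, (Z₁ - Z₂) ω ∂P = 0 := by
        rw [integral_sub' i₁ i₂, h₁.centered, h₂.centered, sub_zero]
      rw [h0, hc, zero_add] at this
      exact this
    · intro B hd hB h0
      rw [integral_iUnion (fun i => hle _ (hB i)) hd iD.integrableOn]
      simp_rw [h0, tsum_zero]
  have := ae_eq_of_forall_setIntegral_eq_of_sigmaFinite' hle (μ := P) (f := Z₁) (g := Z₂)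
    (fun s _ _ => i₁.integrableOn) (fun s _ _ => i₂.integrableOn) (fun s hs _ => ?_)
    h₁.aestronglyMeasurable h₂.aestronglyMeasurable
  · exact this
  · have h0 := key s hs
    rw [integral_sub' i₁.integrableOn i₂.integrableOn] at h0
    exact sub_eq_zero.mp h0

theorem skorohodIntegral_ae_eq [IsProbabilityMeasure P] (hT : 0 < T)
    (hX : IsContinuousCenteredGaussian X P) {u : Icc (0 : ℝ) T → Ω → ℝ} {Z : Ω → ℝ}
    (hu : MemSkorohodDomain X P μ u) (hZ : IsSkorohodIntegral X P μ u Z) :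
    skorohodIntegral X P μ u =ᵐ[P] Z := by
  rw [skorohodIntegral, dif_pos hu]
  exact hu.2.2.choose_spec.ae_eq hT hX hZ

end SkorohodIto

/-! ### The variance function as image of the covariance measure; the Itô formula -/

namespace SkorohodIto

variable {T : ℝ} {Ω : Type*} [MeasurableSpace Ω] {X : Icc (0 : ℝ) T → Ω → ℝ}
  {P : Measure Ω} {μ : SignedMeasure (Icc (0 : ℝ) T × Icc (0 : ℝ) T)}

theorem boundedVariationOn_univ_of_abs_sub_le {α : Type*} [LinearOrder α] {f M : α → ℝ}
    (hM : ∀ a b, a ≤ b → |f b - f a| ≤ M b - M a) {C : ℝ} (hC : ∀ x, |M x| ≤ C) :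
    BoundedVariationOn f univ := by
  have hmono : Monotone M := fun a b hab =>
    sub_nonneg.mp ((abs_nonneg _).trans (hM a b hab))
  refine ne_top_of_le_ne_top ((hmono.monotoneOn univ).boundedVariationOn fun x _ => hC x)
    (iSup_le fun p => ?_)
  refine (Finset.sum_le_sum fun i _ => ?_).trans
    (eVariationOn.sum_le (f := M) (n := p.1) p.2.2.1 p.2.2.2)
  rw [edist_dist, edist_dist, Real.dist_eq, Real.dist_eq]
  exact ENNReal.ofReal_le_ofReal ((hM _ _ (p.2.2.1 i.le_succ)).trans (le_abs_self _))

theorem continuous_variance [IsProbabilityMeasure P] (hX : IsContinuousCenteredGaussian X P) :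
    Continuous fun t => Var[X t; P] := by
  rw [continuous_iff_continuousAt]
  intro a
  have e : ∀ t, Var[X t; P] = ∫ ω, X t ω * X t ω ∂P := fun t => by
    rw [variance_of_integral_eq_zero (hX.measurable t).aemeasurable (hX.centered t)]
    simp only [sq]
  have h : Tendsto (fun b => eLpNorm (fun ω => X b ω - X a ω) 2 P) (𝓝 a) (𝓝 0) := by
    have e2 : ∀ b, eLpNorm (fun ω => X b ω - X a ω) 2 P
        = ENNReal.ofReal √Var[fun ω => X b ω - X a ω; P] := fun b => by
      have hL : MemLp (fun ω => X b ω - X a ω) 2 P := (hX.memLp b).sub (hX.memLp a)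
      have hc : ∫ ω, (X b ω - X a ω) ∂P = 0 := by
        rw [integral_sub ((hX.memLp b).integrable one_le_two)
          ((hX.memLp a).integrable one_le_two), hX.centered, hX.centered, sub_zero]
      rw [variance_of_integral_eq_zero hL.1.aemeasurable hc,
        hL.eLpNorm_eq_integral_rpow_norm two_ne_zero ENNReal.ofNat_ne_top, Real.sqrt_eq_rpow]
      simp
    simp_rw [e2]
    have := ENNReal.tendsto_ofReal (tendsto_variance_sub hX a).sqrt
    simpa using this
  simp only [ContinuousAt, e]
  exact tendsto_integral_mul_of_tendsto_eLpNorm hX.memLp hX.memLp (hX.memLp a) (hX.memLp a) h h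

section

variable [IsProbabilityMeasure P] (hT : 0 < T) (hX : IsContinuousCenteredGaussian X P)
  (hμ : IsCovarianceMeasure X P μ)

include hT hX hμ

/-- {max(u,v) ≤ t} is the square [0,t]², which differs from ]0,t]² by a null part of the axes; on
the latter the isometry gives Var(X_t - X_0). -/
theorem variance_eq_apply (t : Icc (0 : ℝ) T) :
    Var[X t; P] = μ ((fun p => max p.1 p.2) ⁻¹' Iic t) := by
  let z : Icc (0 : ℝ) T := ⟨0, le_rfl, hT.le⟩
  have h1 := form_elementary hX hμ (Elementary.single z t t.2.1) (Elementary.single z t t.2.1)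
  have h2 : (Elementary.single z t t.2.1).integral X =ᵐ[P] X t := by
    filter_upwards [hX.start_zero z rfl] with ω hω
    rw [Elementary.single_integral, hω, sub_zero]
  rw [covariance_self ((Elementary.memLp_integral _ hX).aestronglyMeasurable.aemeasurable),
    variance_congr h2, Elementary.single_toFun] at h1
  have h3 : ∀ s : Icc (0 : ℝ) T, (s : ℝ) ≠ 0 →
      (Ioc z t).indicator (fun _ => (1 : ℝ)) s = (Iic t).indicator (fun _ => 1) s := fun s hs => by
    have : z < s := lt_of_le_of_ne s.2.1 fun h => hs (congrArg Subtype.val h).symm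
    by_cases hst : s ≤ t <;> simp [this, hst]
  rw [← h1, form_congr_left hμ h3, form_congr_right hμ _ h3,
    form_indicator measurableSet_Iic measurableSet_Iic, one_mul, one_mul]
  congr 1
  ext p
  simp [Prod.le_def]

/-- The increments of γ are masses of the regions {a < max(u,v) ≤ b}, bounded by those of |μ|, which
is finite. -/
theorem boundedVariationOn_variance : BoundedVariationOn (fun t => Var[X t; P]) univ := by
  refine boundedVariationOn_univ_of_abs_sub_le
    (M := fun t => μ.variation.real ((fun p => max p.1 p.2) ⁻¹' Iic t)) (fun a b hab => ?_)
    (C := μ.variation.real univ) fun t => ?_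
  · have hm : Measurable fun p : Icc (0 : ℝ) T × Icc (0 : ℝ) T => max p.1 p.2 :=
      measurable_fst.max measurable_snd
    have e : ∀ t, Var[X t; P] = maxForm μ ((Iic t).indicator fun _ => 1) := fun t => by
      rw [variance_eq_apply hT hX hμ, apply_eq_setIntegral_signDensity μ (hm measurableSet_Iic),
        ← integral_indicator (hm measurableSet_Iic), maxForm]
      congr 1
      ext p
      rw [← indicator_comp_right (s := Iic t) fun p : Icc (0 : ℝ) T × Icc (0 : ℝ) T => max p.1 p.2]
      by_cases hp : p ∈ (fun p : Icc (0 : ℝ) T × Icc (0 : ℝ) T => max p.1 p.2) ⁻¹' Iic t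
      · rw [indicator_of_mem hp, indicator_of_mem hp, Function.comp_apply, one_mul]
      · rw [indicator_of_notMem hp, indicator_of_notMem hp, zero_mul]
    have hb : ∀ t, IsBoundedMeasurable ((Iic t : Set (Icc (0 : ℝ) T)).indicator
        fun _ => (1 : ℝ)) := fun t => (IsBoundedMeasurable.const 1).indicator measurableSet_Iic
    rw [e, e, ← maxForm_sub (hb b) (hb a)]
    simp_rw [indicator_Iic_sub_indicator_Iic hab]
    refine (abs_maxForm_le hab (C := 1) (fun s hs => ?_) fun s hs => ?_).trans (one_mul _).le
    · simp [hs]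
    · simp [hs]
  · rw [abs_of_nonneg measureReal_nonneg]
    exact measureReal_mono (subset_univ _)

/-- The Stieltjes measure of the variance function is the image of the covariance measure under
the maximum. -/
theorem vectorMeasure_variance (hγ : BoundedVariationOn (fun t => Var[X t; P]) univ) :
    hγ.vectorMeasure = μ.map fun p => max p.1 p.2 := by
  have hm : Measurable fun p : Icc (0 : ℝ) T × Icc (0 : ℝ) T => max p.1 p.2 :=
    measurable_fst.max measurable_snd
  let z : Icc (0 : ℝ) T := ⟨0, le_rfl, hT.le⟩
  have hz : Var[X z; P] = 0 := by
    rw [variance_congr (hX.start_zero z rfl)]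
    exact variance_zero P
  have hc := continuous_variance hX
  -- The Stieltjes mass of [0,t] is a difference of one-sided limits of γ; since γ is continuous and
  -- γ(0) = 0, it equals γ(t).
  have key : ∀ t, hγ.vectorMeasure (Iic t) = μ.map (fun p => max p.1 p.2) (Iic t) := fun t => by
    have : Iic t = Icc z t := by
      ext s
      simp only [mem_Iic, mem_Icc]
      exact ⟨fun h => ⟨s.2.1, h⟩, fun h => h.2⟩
    rw [VectorMeasure.map_apply _ hm measurableSet_Iic, ← variance_eq_apply hT hX hμ, this,
      hγ.vectorMeasure_Icc t.2.1, hc.continuousWithinAt.rightLim_eq,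
      hc.continuousWithinAt.leftLim_eq, hz, sub_zero]
  refine VectorMeasure.ext_of_generateFrom (range Iic) ?_ ?_ isPiSystem_Iic ?_
  · rintro _ ⟨t, rfl⟩
    exact key t
  · rw [← borel_eq_generateFrom_Iic]
    exact BorelSpace.measurable_eq
  · have := key ⟨T, hT.le, le_rfl⟩
    have hu : Iic (⟨T, hT.le, le_rfl⟩ : Icc (0 : ℝ) T) = univ := eq_univ_of_forall fun s => s.2.2
    rwa [hu] at this

theorem setIntegral_variance (hγ : BoundedVariationOn (fun t => Var[X t; P]) univ)
    {h : Icc (0 : ℝ) T → ℝ} (hh : Continuous h) (t : Icc (0 : ℝ) T) :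
    ∫ᵛ s in Iic t, h s ∂•hγ.vectorMeasure = maxForm μ ((Iic t).indicator h) := by
  have hm : Measurable fun p : Icc (0 : ℝ) T × Icc (0 : ℝ) T => max p.1 p.2 :=
    measurable_fst.max measurable_snd
  have hb : IsBoundedMeasurable ((Iic t).indicator h) :=
    (isBoundedMeasurable_of_continuous hh).indicator measurableSet_Iic
  have hi : Integrable (fun p : Icc (0 : ℝ) T × Icc (0 : ℝ) T =>
    (Iic t).indicator h (max p.1 p.2)) μ.variation := (hb.comp hm).integrable _
  rw [vectorMeasure_variance hT hX hμ hγ, ← VectorMeasure.integral_indicator measurableSet_Iic,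
    VectorMeasure.integral_map hm hb.measurable.aestronglyMeasurable hi,
    integral_eq_integral_signDensity μ hi, maxForm]

/-- The Itô formula for a continuous centered Gaussian process with a covariance measure. -/
theorem ito_formula (hγ : BoundedVariationOn (fun t => Var[X t; P]) univ) {f : ℝ → ℝ}
    (hf : ContDiff ℝ 2 f) {C : ℝ} (hC : ∀ x, |deriv (deriv f) x| ≤ C) (t : Icc (0 : ℝ) T) :
    ∀ᵐ ω ∂P, f (X t ω) = f (X ⟨0, le_rfl, hT.le⟩ ω)
      + skorohodIntegral X P μ (stopAt (fun s ω => deriv f (X s ω)) t) ω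
      + 1 / 2 * ∫ᵛ s in Iic t, deriv (deriv f) (X s ω) ∂•hγ.vectorMeasure := by
  have hf2 : Continuous (deriv (deriv f)) :=
    (((contDiff_succ_iff_deriv (n := 1)).mp hf).2.2).continuous_deriv le_rfl
  filter_upwards [skorohodIntegral_ae_eq hT hX (memSkorohodDomain_stopAt hT hX hμ hf hC t)
    (isSkorohodIntegral_itoRemainder hT hX hμ hf hC t)] with ω hω
  have e := setIntegral_variance hT hX hμ hγ (hf2.comp (hX.continuous_paths ω)) t
  simp only [Function.comp_def] at e
  rw [hω, e, itoRemainder, stopAt_apply]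
  ring

theorem memSkorohodDomain {f : ℝ → ℝ} (hf : ContDiff ℝ 2 f) {C : ℝ}
    (hC : ∀ x, |deriv (deriv f) x| ≤ C) :
    MemSkorohodDomain X P μ fun s ω => deriv f (X s ω) := by
  have := memSkorohodDomain_stopAt hT hX hμ hf hC ⟨T, hT.le, le_rfl⟩
  rwa [stopAt_top hT] at this

end

end SkorohodIto

/-! ### The homogeneous part of the bifractional covariance -/

namespace SkorohodIto

section lebesgue

variable {T : ℝ}

theorem map_lebesgue : (lebesgue T).map Subtype.val = volume.restrict (Icc 0 T) :=
  map_comap_subtype_coe measurableSet_Icc _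

theorem lebesgue_preimage {s : Set ℝ} (hs : MeasurableSet s) :
    lebesgue T (Subtype.val ⁻¹' s) = volume (s ∩ Icc 0 T) := by
  rw [← Measure.restrict_apply hs, ← map_lebesgue, Measure.map_apply measurable_subtype_coe hs]

instance : IsFiniteMeasure (lebesgue T) := ⟨by
  have := lebesgue_preimage (T := T) MeasurableSet.univ
  rw [preimage_univ, univ_inter] at this
  rw [this]
  exact measure_Icc_lt_top⟩

theorem lebesgue_Ioc (a b : Icc (0 : ℝ) T) : lebesgue T (Ioc a b) = ENNReal.ofReal (b - a) := by
  have : Ioc a b = Subtype.val ⁻¹' Ioc (a : ℝ) b := rfl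
  rw [this, lebesgue_preimage measurableSet_Ioc, inter_eq_left.mpr, Real.volume_Ioc]
  exact fun x hx => ⟨a.2.1.trans hx.1.le, hx.2.trans b.2.2⟩

theorem lebesgue_Iic (t : Icc (0 : ℝ) T) : lebesgue T (Iic t) = ENNReal.ofReal t := by
  have : Iic t = Subtype.val ⁻¹' Icc 0 (t : ℝ) := by
    ext s
    exact ⟨fun h => ⟨s.2.1, h⟩, fun h => h.2⟩
  rw [this, lebesgue_preimage measurableSet_Icc, inter_eq_left.mpr, Real.volume_Icc, sub_zero]
  exact fun x hx => ⟨hx.1, hx.2.trans t.2.2⟩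

theorem lebesgue_zero : lebesgue T {s | (s : ℝ) = 0} = 0 := by
  have : {s : Icc (0 : ℝ) T | (s : ℝ) = 0} = Subtype.val ⁻¹' {(0 : ℝ)} := rfl
  rw [this, lebesgue_preimage (measurableSet_singleton _)]
  exact measure_mono_null inter_subset_left Real.volume_singleton

theorem setIntegral_lebesgue_Ioc {a b : Icc (0 : ℝ) T} (hab : a ≤ b) (h : ℝ → ℝ) :
    ∫ s in Ioc a b, h s ∂lebesgue T = ∫ x in (a : ℝ)..b, h x := by
  have e := (MeasurableEmbedding.subtype_coe (measurableSet_Icc (a := 0) (b := T))).setIntegral_map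
    (μ := lebesgue T) h (Ioc (a : ℝ) b)
  rw [map_lebesgue, Measure.restrict_restrict measurableSet_Ioc, inter_eq_left.mpr] at e
  · rw [intervalIntegral.integral_of_le hab, e]
    rfl
  · exact fun x hx => ⟨a.2.1.trans hx.1.le, hx.2.trans b.2.2⟩

end lebesgue

section kernel

/-- The partial derivative `(1 + r^{2H})^{K-1}`, `r = s/t`, of `(t^{2H} + s^{2H})^K` in `t` when
`2HK = 1`, extended by `1` to negative `r`. -/
noncomputable def bifractionalKernel (H K r : ℝ) : ℝ := (1 + (max r 0) ^ (2 * H)) ^ (K - 1)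

variable {H K : ℝ}

theorem one_le_one_add_rpow (H r : ℝ) : 1 ≤ 1 + (max r 0) ^ (2 * H) :=
  le_add_of_nonneg_right (Real.rpow_nonneg (le_max_right _ _) _)

theorem bifractionalKernel_nonneg (H K r : ℝ) : 0 ≤ bifractionalKernel H K r :=
  Real.rpow_nonneg (zero_le_one.trans (one_le_one_add_rpow H r)) _

theorem bifractionalKernel_le_one (hK : K ≤ 1) (H r : ℝ) : bifractionalKernel H K r ≤ 1 :=
  Real.rpow_le_one_of_one_le_of_nonpos (one_le_one_add_rpow H r) (by linarith)

/-- The exponent K - 1 is nonpositive. This monotonicity makes one minus the kernel a distribution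
function, and so gives the mixed increments a sign. -/
theorem antitone_bifractionalKernel (hH : 0 < H) (hK : K ≤ 1) :
    Antitone (bifractionalKernel H K) := fun r r' h =>
  Real.rpow_le_rpow_of_nonpos (zero_lt_one.trans_le (one_le_one_add_rpow H r))
    (add_le_add le_rfl (Real.rpow_le_rpow (le_max_right _ _) (max_le_max h le_rfl)
      (by positivity))) (by linarith)

theorem continuous_bifractionalKernel (hH : 0 < H) : Continuous (bifractionalKernel H K) := by
  have h1 : Continuous fun r : ℝ => 1 + (max r 0) ^ (2 * H) :=
    continuous_const.add ((continuous_id.max continuous_const).rpow_const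
      fun x => Or.inr (by positivity))
  exact h1.rpow_const fun r => Or.inl (zero_lt_one.trans_le (one_le_one_add_rpow H r)).ne'

theorem hasDerivAt_add_rpow_rpow (hHK : 2 * H * K = 1) {s τ : ℝ} (hs : 0 ≤ s)
    (hτ : 0 < τ) :
    HasDerivAt (fun τ => (τ ^ (2 * H) + s ^ (2 * H)) ^ K) (bifractionalKernel H K (s / τ)) τ := by
  have hpos : 0 < τ ^ (2 * H) + s ^ (2 * H) :=
    add_pos_of_pos_of_nonneg (Real.rpow_pos_of_pos hτ _) (Real.rpow_nonneg hs _)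
  have h1 := ((Real.hasDerivAt_rpow_const (p := 2 * H) (Or.inl hτ.ne')).add_const
    (s ^ (2 * H))).rpow_const (p := K) (Or.inl hpos.ne')
  refine h1.congr_deriv ?_
  have e : τ ^ (2 * H) + s ^ (2 * H) = τ ^ (2 * H) * (1 + (s / τ) ^ (2 * H)) := by
    rw [Real.div_rpow hs hτ.le]
    field_simp
  -- The exponents add up to 2HK - 1 = 0: by homogeneity of degree one, only the ratio s/τ remains
  -- in the derivative.
  have e2 : (τ ^ (2 * H)) ^ (K - 1) * τ ^ (2 * H - 1) = 1 := by
    rw [← Real.rpow_mul hτ.le, ← Real.rpow_add hτ]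
    convert! Real.rpow_zero τ using 2
    linear_combination hHK
  rw [e, Real.mul_rpow (Real.rpow_nonneg hτ.le _) (by positivity), bifractionalKernel,
    max_eq_left (by positivity)]
  linear_combination (2 * H * K * (1 + (s / τ) ^ (2 * H)) ^ (K - 1)) * e2
    + (1 + (s / τ) ^ (2 * H)) ^ (K - 1) * hHK

theorem measurable_bifractionalKernel_div (hH : 0 < H) (s : ℝ) :
    Measurable fun τ => bifractionalKernel H K (s / τ) :=
  (continuous_bifractionalKernel hH).measurable.comp (measurable_const.div measurable_id)

theorem intervalIntegrable_bifractionalKernel_div (hH : 0 < H) (hK : K ≤ 1) (s a b : ℝ) :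
    IntervalIntegrable (fun τ => bifractionalKernel H K (s / τ)) volume a b := by
  refine (intervalIntegrable_const (c := (1 : ℝ))).mono_fun
    (measurable_bifractionalKernel_div hH s).aestronglyMeasurable (ae_of_all _ fun τ => ?_)
  simp only [Real.norm_of_nonneg (bifractionalKernel_nonneg _ _ _), norm_one]
  exact bifractionalKernel_le_one hK _ _

theorem integral_bifractionalKernel_div (hH : 0 < H) (hK0 : 0 < K) (hK : K ≤ 1)
    (hHK : 2 * H * K = 1) {s a b : ℝ} (hs : 0 ≤ s) (ha : 0 ≤ a) (hab : a ≤ b) :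
    ∫ τ in a..b, bifractionalKernel H K (s / τ)
      = (b ^ (2 * H) + s ^ (2 * H)) ^ K - (a ^ (2 * H) + s ^ (2 * H)) ^ K := by
  refine intervalIntegral.integral_eq_sub_of_hasDerivAt_of_le hab
    (f := fun τ => (τ ^ (2 * H) + s ^ (2 * H)) ^ K) ?_ (fun τ hτ => ?_)
    (intervalIntegrable_bifractionalKernel_div hH hK s a b)
  · have h1 : Continuous fun τ : ℝ => τ ^ (2 * H) + s ^ (2 * H) :=
      (continuous_id.rpow_const fun x => Or.inr (by positivity)).add continuous_const
    exact (h1.rpow_const fun x => Or.inr hK0.le).continuousOn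
  · exact hasDerivAt_add_rpow_rpow hHK hs (ha.trans_lt hτ.1)

/-- The function `1 - (1 + r^{2H})^{K-1}` as a Stieltjes function. -/
noncomputable def bifractionalStieltjes (hH : 0 < H) (hK : K ≤ 1) : StieltjesFunction ℝ where
  toFun r := 1 - bifractionalKernel H K r
  mono' _ _ h := sub_le_sub_left (antitone_bifractionalKernel hH hK h) 1
  right_continuous' _ :=
    (continuous_const.sub (continuous_bifractionalKernel hH)).continuousWithinAt

theorem bifractionalStieltjes_apply (hH : 0 < H) (hK : K ≤ 1) (r : ℝ) :
    bifractionalStieltjes hH hK r = 1 - bifractionalKernel H K r := rfl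

instance (hH : 0 < H) (hK : K ≤ 1) : IsFiniteMeasure (bifractionalStieltjes hH hK).measure :=
  StieltjesFunction.isFiniteMeasure_of_forall_abs_le _ (C := 1) fun r => by
    rw [bifractionalStieltjes_apply, abs_le]
    constructor <;> linarith [bifractionalKernel_nonneg H K r, bifractionalKernel_le_one hK H r]

end kernel

section scale

variable {T : ℝ}

/-- The law of `(τξ, τ)` on the square, for `τ` distributed by the Lebesgue measure and `ξ > 0` by
`κ`, on the event that `τξ ≤ T`. -/
noncomputable def scaleMeasure (hT : 0 < T) (κ : Measure ℝ) :
    Measure (Icc (0 : ℝ) T × Icc (0 : ℝ) T) :=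
  (((lebesgue T).prod κ).restrict {q | 0 < q.2 ∧ q.1 * q.2 ≤ T}).map
    fun q => (projIcc 0 T hT.le (q.1 * q.2), q.1)

theorem measurable_scale (hT : 0 < T) : Measurable fun q : Icc (0 : ℝ) T × ℝ =>
    (projIcc 0 T hT.le (q.1 * q.2), q.1) := by
  have : Measurable fun q : Icc (0 : ℝ) T × ℝ => (q.1 : ℝ) * q.2 :=
    (measurable_subtype_coe.comp measurable_fst).mul measurable_snd
  exact (continuous_projIcc.measurable.comp this).prodMk measurable_fst

instance (hT : 0 < T) (κ : Measure ℝ) [IsFiniteMeasure κ] : IsFiniteMeasure (scaleMeasure hT κ) := by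
  unfold scaleMeasure
  infer_instance

theorem measurableSet_scale : MeasurableSet {q : Icc (0 : ℝ) T × ℝ | 0 < q.2 ∧ q.1 * q.2 ≤ T} :=
  (measurableSet_lt measurable_const measurable_snd).inter (measurableSet_le
    ((measurable_subtype_coe.comp measurable_fst).mul measurable_snd) measurable_const)

theorem scaleMeasure_axes (hT : 0 < T) (κ : Measure ℝ) [IsFiniteMeasure κ] :
    scaleMeasure hT κ {p | (p.1 : ℝ) = 0 ∨ (p.2 : ℝ) = 0} = 0 := by
  have hm : MeasurableSet {p : Icc (0 : ℝ) T × Icc (0 : ℝ) T | (p.1 : ℝ) = 0 ∨ (p.2 : ℝ) = 0} :=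
    (measurableSet_eq_fun (measurable_subtype_coe.comp measurable_fst) measurable_const).union
      (measurableSet_eq_fun (measurable_subtype_coe.comp measurable_snd) measurable_const)
  rw [scaleMeasure, Measure.map_apply (measurable_scale hT) hm,
    Measure.restrict_apply (measurable_scale hT hm)]
  -- As ξ > 0, either coordinate of (τξ, τ) can vanish only for τ = 0.
  refine measure_mono_null (t := {s : Icc (0 : ℝ) T | (s : ℝ) = 0} ×ˢ univ) ?_ ?_
  · rintro ⟨τ, ξ⟩ ⟨h1, h2, h3⟩
    refine ⟨?_, mem_univ _⟩
    rcases h1 with h1 | h1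
    · have h4 : (0 : ℝ) ≤ τ * ξ := mul_nonneg τ.2.1 h2.le
      simp only [projIcc_of_mem hT.le ⟨h4, h3⟩] at h1
      exact (mul_eq_zero.mp h1).resolve_right h2.ne'
    · exact h1
  · rw [Measure.prod_prod, lebesgue_zero, zero_mul]

/-- For fixed τ > 0, τξ lies in ]a₁,b₁] exactly when ξ lies in ]a₁/τ, b₁/τ]. The restriction to ξ >
0 and τξ ≤ T, and hence the projection, are then without effect. -/
theorem scaleMeasure_rectangle (hT : 0 < T) (κ : Measure ℝ) [IsFiniteMeasure κ]
    (a₁ b₁ a₂ b₂ : Icc (0 : ℝ) T) :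
    scaleMeasure hT κ (Ioc a₁ b₁ ×ˢ Ioc a₂ b₂)
      = ∫⁻ τ in Ioc a₂ b₂, κ (Ioc (a₁ / τ : ℝ) (b₁ / τ)) ∂lebesgue T := by
  have hm : MeasurableSet (Ioc a₁ b₁ ×ˢ Ioc a₂ b₂) := measurableSet_Ioc.prod measurableSet_Ioc
  rw [scaleMeasure, Measure.map_apply (measurable_scale hT) hm,
    Measure.restrict_apply (measurable_scale hT hm),
    Measure.prod_apply ((measurable_scale hT hm).inter measurableSet_scale),
    ← lintegral_indicator measurableSet_Ioc]
  refine lintegral_congr fun τ => ?_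
  by_cases hτ : τ ∈ Ioc a₂ b₂
  · rw [indicator_of_mem hτ]
    congr 1
    have hpos : (0 : ℝ) < τ := a₂.2.1.trans_lt hτ.1
    ext ξ
    simp only [mem_preimage, mem_inter_iff, mem_prod, mem_ofPred_eq, hτ, and_true]
    rw [mem_Ioc (a := (a₁ / τ : ℝ)), div_lt_iff₀' hpos, le_div_iff₀' hpos]
    constructor
    · rintro ⟨h1, h2, h3⟩
      rw [projIcc_of_mem hT.le ⟨mul_nonneg τ.2.1 h2.le, h3⟩] at h1
      exact h1
    · rintro ⟨h1, h2⟩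
      have h3 : (0 : ℝ) < τ * ξ := a₁.2.1.trans_lt h1
      have h4 : (τ : ℝ) * ξ ≤ T := h2.trans b₁.2.2
      rw [projIcc_of_mem hT.le ⟨h3.le, h4⟩]
      exact ⟨⟨h1, h2⟩, pos_of_mul_pos_right h3 hpos.le, h4⟩
  · rw [indicator_of_notMem hτ]
    convert! measure_empty (μ := κ)
    ext ξ
    simp [hτ]

end scale

end SkorohodIto

/-! ### The bifractional covariance measure -/

namespace SkorohodIto

section measure

variable {T H K : ℝ}

/-- The image of the Lebesgue measure on the diagonal of the square. -/
noncomputable def diagonalMeasure (T : ℝ) : Measure (Icc (0 : ℝ) T × Icc (0 : ℝ) T) :=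
  (lebesgue T).map fun s => (s, s)

theorem measurable_diagonal : Measurable fun s : Icc (0 : ℝ) T => (s, s) :=
  measurable_id.prodMk measurable_id

instance : IsFiniteMeasure (diagonalMeasure T) := by
  unfold diagonalMeasure
  infer_instance

theorem diagonalMeasure_rectangle (a₁ b₁ a₂ b₂ : Icc (0 : ℝ) T) :
    diagonalMeasure T (Ioc a₁ b₁ ×ˢ Ioc a₂ b₂)
      = ENNReal.ofReal (min (b₁ : ℝ) b₂ - max (a₁ : ℝ) a₂) := by
  rw [diagonalMeasure, Measure.map_apply measurable_diagonal
    (measurableSet_Ioc.prod measurableSet_Ioc), mk_preimage_prod]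
  simp only [preimage_id']
  rw [Ioc_inter_Ioc, lebesgue_Ioc]
  rcases le_total a₁ a₂ with h | h <;> rcases le_total b₁ b₂ with h' | h' <;>
    have h1 : _ := (Subtype.coe_le_coe.mpr h) <;> have h2 : _ := (Subtype.coe_le_coe.mpr h') <;>
    simp [h, h', h1, h2]

theorem diagonalMeasure_axes :
    diagonalMeasure T {p | (p.1 : ℝ) = 0 ∨ (p.2 : ℝ) = 0} = 0 := by
  have hm : MeasurableSet {p : Icc (0 : ℝ) T × Icc (0 : ℝ) T | (p.1 : ℝ) = 0 ∨ (p.2 : ℝ) = 0} :=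
    (measurableSet_eq_fun (measurable_subtype_coe.comp measurable_fst) measurable_const).union
      (measurableSet_eq_fun (measurable_subtype_coe.comp measurable_snd) measurable_const)
  rw [diagonalMeasure, Measure.map_apply measurable_diagonal hm]
  refine measure_mono_null (fun s hs => ?_) lebesgue_zero
  exact hs.elim id id

/-- Twice the length of the overlap of two intervals is the planar increment of -|t - s|; this is
why the diagonal measure enters with weight 2. -/
theorem two_mul_max_min_sub_max {a₁ b₁ a₂ b₂ : ℝ} (h₁ : a₁ ≤ b₁) (h₂ : a₂ ≤ b₂) :
    2 * max (min b₁ b₂ - max a₁ a₂) 0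
      = |b₂ - a₁| + |a₂ - b₁| - |b₂ - b₁| - |a₂ - a₁| := by
  rcases le_total a₁ a₂ with h | h <;> rcases le_total b₁ b₂ with h' | h' <;>
    rcases le_total a₂ b₁ with h'' | h'' <;> rcases le_total a₁ b₂ with h''' | h''' <;>
    simp only [h, h', min_eq_left, min_eq_right, max_eq_left, max_eq_right, abs_of_nonneg,
      abs_of_nonpos, sub_nonneg, sub_nonpos, h'', h''', h₁, h₂] <;>
    linarith

/-- The slice at τ has mass equal to the drop of the kernel from a₁/τ to b₁/τ. Integrating over τ
recovers the primitive (τ^{2H} + s^{2H})^K at s = a₁ and s = b₁, without any mixed second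
derivative. -/
theorem scaleMeasure_real_rectangle (hT : 0 < T) (hH : 0 < H) (hK0 : 0 < K) (hK : K ≤ 1)
    (hHK : 2 * H * K = 1) {a₁ b₁ a₂ b₂ : Icc (0 : ℝ) T} (h₁ : a₁ ≤ b₁) (h₂ : a₂ ≤ b₂) :
    (scaleMeasure hT (bifractionalStieltjes hH hK).measure).real (Ioc a₁ b₁ ×ˢ Ioc a₂ b₂)
      = -planarIncrement (fun s t : ℝ => (t ^ (2 * H) + s ^ (2 * H)) ^ K) a₁ b₁ a₂ b₂ := by
  have hnn : ∀ τ : Icc (0 : ℝ) T, 0 ≤ bifractionalKernel H K (a₁ / τ)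
      - bifractionalKernel H K (b₁ / τ) := fun τ => sub_nonneg.mpr
    (antitone_bifractionalKernel hH hK (div_le_div_of_nonneg_right h₁ τ.2.1))
  have hm : Measurable fun τ : ℝ => bifractionalKernel H K (a₁ / τ)
      - bifractionalKernel H K (b₁ / τ) :=
    (measurable_bifractionalKernel_div hH _).sub (measurable_bifractionalKernel_div hH _)
  have e := setIntegral_lebesgue_Ioc h₂ fun τ => bifractionalKernel H K (a₁ / τ)
    - bifractionalKernel H K (b₁ / τ)
  rw [integral_eq_lintegral_of_nonneg_ae (ae_of_all _ hnn)
    (hm.comp measurable_subtype_coe).aestronglyMeasurable,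
    intervalIntegral.integral_sub (intervalIntegrable_bifractionalKernel_div hH hK _ _ _)
      (intervalIntegrable_bifractionalKernel_div hH hK _ _ _),
    integral_bifractionalKernel_div hH hK0 hK hHK a₁.2.1 a₂.2.1 h₂,
    integral_bifractionalKernel_div hH hK0 hK hHK b₁.2.1 a₂.2.1 h₂] at e
  rw [Measure.real, scaleMeasure_rectangle]
  simp only [StieltjesFunction.measure_Ioc, bifractionalStieltjes_apply, sub_sub_sub_cancel_left]
  rw [e, planarIncrement]
  ring

/-- The covariance measure of the bifractional Brownian motion with `2HK = 1`. -/
noncomputable def bifractionalMeasure (hT : 0 < T) (hH : 0 < H) (hK : K ≤ 1) :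
    SignedMeasure (Icc (0 : ℝ) T × Icc (0 : ℝ) T) :=
  ((2 : ℝ) ^ K)⁻¹ • ((2 : ℝ) • (diagonalMeasure T).toSignedMeasure
    - (scaleMeasure hT (bifractionalStieltjes hH hK).measure).toSignedMeasure)

theorem bifractionalMeasure_apply (hT : 0 < T) (hH : 0 < H) (hK : K ≤ 1)
    {A : Set (Icc (0 : ℝ) T × Icc (0 : ℝ) T)} (hA : MeasurableSet A) :
    bifractionalMeasure hT hH hK A = ((2 : ℝ) ^ K)⁻¹ * (2 * (diagonalMeasure T).real A
      - (scaleMeasure hT (bifractionalStieltjes hH hK).measure).real A) := by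
  simp [bifractionalMeasure, Measure.toSignedMeasure_apply_measurable hA]

variable {Ω : Type*} [MeasurableSpace Ω] {X : Icc (0 : ℝ) T → Ω → ℝ} {P : Measure Ω}

theorem isCovarianceMeasure_bifractionalMeasure (hT : 0 < T) (hH : 0 < H) (hK0 : 0 < K)
    (hK : K ≤ 1) (hHK : 2 * H * K = 1)
    (hcov : ∀ s t : Icc (0 : ℝ) T, cov[X s, X t; P] = bifractionalCovariance H K s t) :
    IsCovarianceMeasure X P (bifractionalMeasure hT hH hK) where
  rectangle a₁ b₁ a₂ b₂ h₁ h₂ := by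
    rw [bifractionalMeasure_apply hT hH hK (measurableSet_Ioc.prod measurableSet_Ioc),
      scaleMeasure_real_rectangle hT hH hK0 hK hHK h₁ h₂, Measure.real, diagonalMeasure_rectangle,
      ENNReal.toReal_ofReal', two_mul_max_min_sub_max h₁ h₂]
    simp only [planarIncrement, hcov, bifractionalCovariance, hHK, Real.rpow_one]
    ring
  axes := by
    refine le_antisymm ?_ zero_le
    let m : Measure (Icc (0 : ℝ) T × Icc (0 : ℝ) T) := ENNReal.ofReal ((2 : ℝ) ^ K)⁻¹ •
      ((2 : ℝ≥0∞) • diagonalMeasure T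
        + scaleMeasure hT (bifractionalStieltjes hH hK).measure)
    -- The variation of a difference is at most the sum of the two positive measures, neither of
    -- which charges the axes.
    have hle : (bifractionalMeasure hT hH hK).variation ≤ m := by
      refine VectorMeasure.variation_le_of_forall_enorm_le fun E hE => ?_
      rw [bifractionalMeasure_apply hT hH hK hE, enorm_mul]
      simp only [m, Measure.smul_apply, Measure.add_apply, smul_eq_mul]
      refine mul_le_mul' (Real.enorm_of_nonneg (by positivity)).le ?_
      refine (enorm_sub_le).trans (add_le_add ?_ ?_)
      · rw [Real.enorm_of_nonneg (by positivity), ENNReal.ofReal_mul zero_le_two]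
        simp
      · rw [Real.enorm_of_nonneg measureReal_nonneg, ofReal_measureReal]
    refine (hle _).trans (le_of_eq ?_)
    simp only [m, Measure.smul_apply, Measure.add_apply, smul_eq_mul, diagonalMeasure_axes,
      scaleMeasure_axes, mul_zero, add_zero]

theorem variance_of_bifractional (hX : ∀ t, Measurable (X t)) (hHK : 2 * H * K = 1)
    (hcov : ∀ s t : Icc (0 : ℝ) T, cov[X s, X t; P] = bifractionalCovariance H K s t)
    (t : Icc (0 : ℝ) T) : Var[X t; P] = t := by
  have h2 : (0 : ℝ) < 2 ^ K := by positivity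
  rw [← covariance_self (hX t).aemeasurable, hcov, bifractionalCovariance, sub_self, abs_zero,
    hHK, Real.rpow_one, sub_zero, ← two_mul, Real.mul_rpow zero_le_two (Real.rpow_nonneg t.2.1 _),
    ← Real.rpow_mul t.2.1, hHK, Real.rpow_one]
  field_simp

end measure

/-- If `Var X_t = t`, integrals against the variance are Lebesgue integrals. -/
theorem setIntegral_variance_eq_lebesgue {T : ℝ} {Ω : Type*} [MeasurableSpace Ω]
    {X : Icc (0 : ℝ) T → Ω → ℝ} {P : Measure Ω}
    {μ : SignedMeasure (Icc (0 : ℝ) T × Icc (0 : ℝ) T)} [IsProbabilityMeasure P] (hT : 0 < T)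
    (hX : IsContinuousCenteredGaussian X P) (hμ : IsCovarianceMeasure X P μ)
    (hγ : BoundedVariationOn (fun t => Var[X t; P]) univ)
    (hvar : ∀ t : Icc (0 : ℝ) T, Var[X t; P] = t) (h : Icc (0 : ℝ) T → ℝ) (t : Icc (0 : ℝ) T) :
    ∫ᵛ s in Iic t, h s ∂•hγ.vectorMeasure = ∫ s in Iic t, h s ∂lebesgue T := by
  have hm : Measurable fun p : Icc (0 : ℝ) T × Icc (0 : ℝ) T => max p.1 p.2 :=
    measurable_fst.max measurable_snd
  have key : ∀ t : Icc (0 : ℝ) T,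
      hγ.vectorMeasure (Iic t) = (lebesgue T).toSignedMeasure (Iic t) := fun t => by
    rw [vectorMeasure_variance hT hX hμ hγ, VectorMeasure.map_apply _ hm measurableSet_Iic,
      ← variance_eq_apply hT hX hμ, hvar, Measure.toSignedMeasure_apply_measurable measurableSet_Iic,
      Measure.real, lebesgue_Iic, ENNReal.toReal_ofReal t.2.1]
  have e : hγ.vectorMeasure = (lebesgue T).toSignedMeasure := by
    refine VectorMeasure.ext_of_generateFrom (range Iic) ?_ ?_ isPiSystem_Iic ?_
    · rintro _ ⟨t, rfl⟩
      exact key t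
    · rw [← borel_eq_generateFrom_Iic]
      exact BorelSpace.measurable_eq
    · have := key ⟨T, hT.le, le_rfl⟩
      have hu : Iic (⟨T, hT.le, le_rfl⟩ : Icc (0 : ℝ) T) = univ :=
        eq_univ_of_forall fun s => s.2.2
      rwa [hu] at this
  rw [e, ← VectorMeasure.integral_indicator measurableSet_Iic, integral_lsmul_toSignedMeasure,
    integral_indicator measurableSet_Iic]

end SkorohodIto

theorem mainTheorem1 {T : ℝ} (hT : 0 < T) {Ω : Type*} [MeasurableSpace Ω] (P : Measure Ω)
    [IsProbabilityMeasure P] (X : Icc (0 : ℝ) T → Ω → ℝ)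
    (hX : SkorohodIto.IsContinuousCenteredGaussian X P) :
    (∀ μ : SignedMeasure (Icc (0 : ℝ) T × Icc (0 : ℝ) T),
      SkorohodIto.IsCovarianceMeasure X P μ →
      ∃ hγ : BoundedVariationOn (fun t : Icc (0 : ℝ) T => Var[X t; P]) univ,
      ∀ f : ℝ → ℝ, ContDiff ℝ 2 f → (∃ C : ℝ, ∀ x, |deriv (deriv f) x| ≤ C) →
        SkorohodIto.MemSkorohodDomain X P μ (fun s ω => deriv f (X s ω)) ∧
        ∀ t : Icc (0 : ℝ) T,
          SkorohodIto.MemSkorohodDomain X P μ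
            (SkorohodIto.stopAt (fun s ω => deriv f (X s ω)) t) ∧
          ∀ᵐ ω ∂P, f (X t ω) = f (X ⟨0, le_rfl, hT.le⟩ ω)
            + SkorohodIto.skorohodIntegral X P μ
                (SkorohodIto.stopAt (fun s ω => deriv f (X s ω)) t) ω
            + 1 / 2 * ∫ᵛ s in Iic t, deriv (deriv f) (X s ω) ∂•hγ.vectorMeasure) ∧
    (∀ H K : ℝ, 0 < H → H < 1 → 0 < K → K ≤ 1 → 2 * H * K = 1 →
      (∀ s t : Icc (0 : ℝ) T, cov[X s, X t; P] = SkorohodIto.bifractionalCovariance H K s t) →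
      ∃ μ : SignedMeasure (Icc (0 : ℝ) T × Icc (0 : ℝ) T),
        SkorohodIto.IsCovarianceMeasure X P μ ∧
        ∀ f : ℝ → ℝ, ContDiff ℝ 2 f → (∃ C : ℝ, ∀ x, |deriv (deriv f) x| ≤ C) →
          SkorohodIto.MemSkorohodDomain X P μ (fun s ω => deriv f (X s ω)) ∧
          ∀ t : Icc (0 : ℝ) T,
            SkorohodIto.MemSkorohodDomain X P μ
              (SkorohodIto.stopAt (fun s ω => deriv f (X s ω)) t) ∧
            ∀ᵐ ω ∂P, f (X t ω) = f (X ⟨0, le_rfl, hT.le⟩ ω)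
              + SkorohodIto.skorohodIntegral X P μ
                  (SkorohodIto.stopAt (fun s ω => deriv f (X s ω)) t) ω
              + 1 / 2 * ∫ s in Iic t, deriv (deriv f) (X s ω) ∂SkorohodIto.lebesgue T) := by
  refine ⟨fun μ hμ => ?_, fun H K hH _ hK0 hK hHK hcov => ?_⟩
  · have hγ := SkorohodIto.boundedVariationOn_variance hT hX hμ
    refine ⟨hγ, fun f hf ⟨C, hC⟩ => ⟨SkorohodIto.memSkorohodDomain hT hX hμ hf hC, fun t => ?_⟩⟩
    exact ⟨SkorohodIto.memSkorohodDomain_stopAt hT hX hμ hf hC t,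
      SkorohodIto.ito_formula hT hX hμ hγ hf hC t⟩
  · have hμ := SkorohodIto.isCovarianceMeasure_bifractionalMeasure hT hH hK0 hK hHK hcov
    have hγ := SkorohodIto.boundedVariationOn_variance hT hX hμ
    refine ⟨_, hμ, fun f hf ⟨C, hC⟩ =>
      ⟨SkorohodIto.memSkorohodDomain hT hX hμ hf hC, fun t => ?_⟩⟩
    refine ⟨SkorohodIto.memSkorohodDomain_stopAt hT hX hμ hf hC t, ?_⟩
    filter_upwards [SkorohodIto.ito_formula hT hX hμ hγ hf hC t] with ω hω
    rw [← SkorohodIto.setIntegral_variance_eq_lebesgue hT hX hμ hγ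
      (SkorohodIto.variance_of_bifractional hX.measurable hHK hcov)]
    exact hω
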